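/- For a finite simple graph $G$ and an integer $k\ge 0$, let $i_k(G)$ be the number of independent sets of $G$ with exactly $k$ vertices, and let $m_k(G)$ be the number of matchings of $G$ (sets of pairwise disjoint edges) with exactly $k$ edges. For integers $d\ge 1$ and $n\ge 0$ with $2d\mid n$, let $H_{d,n}$ be the disjoint union of $n/(2d)$ copies of the complete bipartite graph $K_{d,d}$. For every integer $d\ge 2$ and every real $\varepsilon>0$ there exists $N=N(d,\varepsilon)$ such that the following holds. For every integer $n\ge N$ divisible by $2d$, every $d$-regular simple graph $G$ on $n$ vertices, and every integer $k>\varepsilon n$, \[ i_k(G)\le i_k(H_{d,n})\qquad\text{and}\qquad m_k(G)\le m_k(H_{d,n}). \] -/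

import Mathlib

namespace RegularSlices

/-- `i_k(G)`: the number of independent sets of `G` with exactly `k` vertices. -/
noncomputable def indepCount {V : Type*} (G : SimpleGraph V) (k : ℕ) : ℕ :=
  {s : Finset V | G.IsNIndepSet k s}.ncard

/-- `m_k(G)`: the number of matchings of `G` with exactly `k` edges. A matching is a subgraph in
which every vertex has exactly one neighbour, so it is determined by its set of edges. -/
noncomputable def matchingCount {V : Type*} (G : SimpleGraph V) (k : ℕ) : ℕ :=
  {M : G.Subgraph | M.IsMatching ∧ M.edgeSet.ncard = k}.ncard

/-- `H_{d,n}`: the disjoint union of `n / (2 * d)` copies of `K_{d,d}`; the first coordinate of a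
vertex is the index of its copy. -/
def unionKdd (d n : ℕ) : SimpleGraph (Fin (n / (2 * d)) × (Fin d ⊕ Fin d)) where
  Adj x y := x.1 = y.1 ∧ (completeBipartiteGraph (Fin d) (Fin d)).Adj x.2 y.2
  symm := ⟨fun _ _ h => ⟨h.1.symm, h.2.symm⟩⟩
  loopless := ⟨fun _ h => (completeBipartiteGraph (Fin d) (Fin d)).irrefl h.2⟩

end RegularSlices

/-! Let P be the generating polynomial of a single K_{d,d}: `indPoly d` for independent sets,
`matPoly d` for matchings. Its coefficients are positive and log-concave (`LogConcavePoly`). Split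
off the components of G that are copies of K_{d,d}: the generating polynomial of G becomes P^t * Q,
where Q belongs to a closed set of 2ds vertices lying in no such component, while that of H_{d,n} is
P^(t+s). The claim is then a comparison of the k-th coefficients of P^t * Q and P^(t+s). Since s may
be tiny compared with t, every loss must be controlled by s alone.

Gap at the level of polynomials. The occupancy method (linear programming duality over random local
views) gives Q'/Q ≤ s P'/P for all x > 0. The defect is an exact sum of nonnegative slacks of local
views (`ind_occupancy_identity`, `mat_occupancy_identity`). For independent sets the slack comes
from a local LYM inequality and Chebyshev's sum inequality; for matchings it comes from strict
monotonicity of an explicit dual sequence (`lt_succ_of_rec`). A vertex outside every K_{d,d} sees a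
view with positive slack with probability bounded below on compact ranges of x, because a
configuration can be rewritten near that vertex at bounded cost (`sum_pow_card_le_of_modify`). The
logarithmic derivative therefore gains a multiple of s on a compact interval, and integration
(`eval_le_of_derivative_le`) gives Q(x) ≤ P(x)^s exp(-c s) for all x ≥ l₀.

Transfer to coefficients (`exists_forall_coeff_pow_mul_le`). Choose x so that k is a mode of a_j
x^j, where a_j are the coefficients of P^(t+s); the condition k > εn keeps x away from 0. With R =
`tilt P x`, a probability polynomial, the k-th coefficient of P^(t+s) is P(x)^(t+s) x^(-k) times the
largest coefficient of R^(t+s), and that of P^t * Q is at most P(x)^t x^(-k) Q(x) times the largest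
coefficient of R^t. It remains to see that passing from R^t to R^(t+s) costs the largest coefficient
at most a factor exp(-c s), uniformly in x ≥ l₀ once t + s is large
(`exists_forall_exp_mul_maxCoeff_tilt_le`). The reason is that a log-concave law with a small
maximum is flat around its mode, so one more bounded convolution hardly lowers it
(`one_sub_mul_maxCoeff_le`). -/

open Polynomial Finset

/-! ### Log-concave sequences and their convolutions. -/

namespace RegularSlices

/-- The coefficients of a polynomial, extended by zero to negative indices. -/
noncomputable def coeffZ (P : ℝ[X]) (n : ℤ) : ℝ := if 0 ≤ n then P.coeff n.toNat else 0

/-- Nonnegative log-concave sequences without internal zeros: all `2 × 2` minors of the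
Toeplitz matrix of `a` are nonnegative. -/
def IsPF2 (a : ℤ → ℝ) : Prop :=
  (∀ n, 0 ≤ a n) ∧ ∀ w x y z, w ≤ x → w ≤ y → w + z = x + y → a w * a z ≤ a x * a y

@[simp] lemma coeffZ_natCast (P : ℝ[X]) (n : ℕ) : coeffZ P n = P.coeff n := by
  simp [coeffZ]

lemma coeffZ_of_neg (P : ℝ[X]) {n : ℤ} (hn : n < 0) : coeffZ P n = 0 := by
  simp [coeffZ, not_le.mpr hn]

/-- A consequence of the Cauchy–Binet formula for two rows. -/
lemma sum_mul_sum_le_of_minors {ι : Type*} (T : Finset ι) (u u' v v' : ι → ℝ)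
    (h : ∀ l ∈ T, ∀ m ∈ T, 0 ≤ (u l * u' m - u m * u' l) * (v l * v' m - v m * v' l)) :
    (∑ l ∈ T, u l * v' l) * (∑ l ∈ T, u' l * v l) ≤
      (∑ l ∈ T, u l * v l) * (∑ l ∈ T, u' l * v' l) := by
  have h1 : 0 ≤ ∑ l ∈ T, ∑ m ∈ T, (u l * u' m - u m * u' l) * (v l * v' m - v m * v' l) :=
    sum_nonneg fun l hl => sum_nonneg fun m hm => h l hl m hm
  have h2 : ∑ l ∈ T, ∑ m ∈ T, (u l * u' m - u m * u' l) * (v l * v' m - v m * v' l) =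
      2 * ((∑ l ∈ T, u l * v l) * (∑ l ∈ T, u' l * v' l)) -
      2 * ((∑ l ∈ T, u l * v' l) * (∑ l ∈ T, u' l * v l)) := by
    have e1 : ∑ l ∈ T, ∑ m ∈ T, (u l * u' m - u m * u' l) * (v l * v' m - v m * v' l) =
        ∑ l ∈ T, ∑ m ∈ T, ((u l * v l) * (u' m * v' m) + (u' l * v' l) * (u m * v m)
          - (u l * v' l) * (u' m * v m) - (u' l * v l) * (u m * v' m)) :=
      sum_congr rfl fun l _ => sum_congr rfl fun m _ => by ring
    rw [e1]
    simp only [sum_add_distrib, sum_sub_distrib, ← sum_mul_sum]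
    ring
  linarith

/-- The cutoff L is free so that convolutions with different shifts can be written over one index
set, as Cauchy–Binet requires. -/
lemma sum_coeffZ_mul_shift (P Q : ℝ[X]) (n γ L : ℤ) (hγ : 0 ≤ γ) (hL : n ≤ L) :
    ∑ l ∈ Icc (0 : ℤ) L, coeffZ P (l - γ) * coeffZ Q (n - l) = coeffZ (P * Q) (n - γ) := by
  by_cases hn : n - γ < 0
  · rw [coeffZ_of_neg _ hn]
    refine sum_eq_zero fun l _ => ?_
    by_cases h : l - γ < 0
    · rw [coeffZ_of_neg _ h, zero_mul]
    · rw [coeffZ_of_neg Q (by omega), mul_zero]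
  · obtain ⟨m, hm⟩ : ∃ m : ℕ, n - γ = m := ⟨(n - γ).toNat, by omega⟩
    rw [hm, coeffZ_natCast, coeff_mul, Nat.sum_antidiagonal_eq_sum_range_succ_mk]
    symm
    refine sum_bij_ne_zero (fun i _ _ => (i : ℤ) + γ) ?_ ?_ ?_ ?_
    · intro i hi _
      have := mem_range.mp hi
      rw [mem_Icc]; constructor <;> omega
    · intro i _ _ j _ _ h
      omega
    · intro l hl h
      have h1 : ¬ l - γ < 0 := fun h1 => h (by rw [coeffZ_of_neg _ h1, zero_mul])
      have h2 : ¬ n - l < 0 := fun h2 => h (by rw [coeffZ_of_neg Q h2, mul_zero])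
      have e1 : l - γ = ((l - γ).toNat : ℤ) := by omega
      have e2 : n - l = ((m - (l - γ).toNat : ℕ) : ℤ) := by omega
      refine ⟨(l - γ).toNat, mem_range.mpr (by omega), ?_, by omega⟩
      rw [e1, e2, coeffZ_natCast, coeffZ_natCast] at h
      exact h
    · intro i hi _
      have := mem_range.mp hi
      have e1 : (i : ℤ) + γ - γ = (i : ℕ) := by omega
      have e2 : n - ((i : ℤ) + γ) = ((m - i : ℕ) : ℤ) := by omega
      rw [e1, e2, coeffZ_natCast, coeffZ_natCast]

/-- The Toeplitz matrix of a product is the product of the Toeplitz matrices, so by Cauchy–Binet its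
2 × 2 minors are sums of products of nonnegative minors. -/
lemma IsPF2.mul {P Q : ℝ[X]} (hP : IsPF2 (coeffZ P)) (hQ : IsPF2 (coeffZ Q)) :
    IsPF2 (coeffZ (P * Q)) := by
  have key : ∀ w x y z, w ≤ x → x ≤ y → w + z = x + y →
      coeffZ (P * Q) w * coeffZ (P * Q) z ≤ coeffZ (P * Q) x * coeffZ (P * Q) y := by
    intro w x y z hwx hxy hs
    have a1 := sum_coeffZ_mul_shift P Q y 0 z le_rfl (by omega)
    have a2 := sum_coeffZ_mul_shift P Q z 0 z le_rfl le_rfl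
    -- Shifting by y - w turns the indices y and z into w and x, so the four coefficients are the
    -- entries of a single 2 × 2 minor.
    have a3 := sum_coeffZ_mul_shift P Q y (y - w) z (by omega) (by omega)
    have a4 := sum_coeffZ_mul_shift P Q z (y - w) z (by omega) le_rfl
    have e3 : y - (y - w) = w := by ring
    have e4 : z - (y - w) = x := by omega
    rw [sub_zero] at a1 a2
    rw [e3] at a3
    rw [e4] at a4
    rw [← a1, ← a2, ← a3, ← a4, mul_comm, mul_comm (∑ l ∈ Icc (0 : ℤ) z, _ * coeffZ Q (z - l))]
    have main : ∀ l m : ℤ, l ≤ m → 0 ≤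
        (coeffZ P (l - 0) * coeffZ P (m - (y - w)) - coeffZ P (m - 0) * coeffZ P (l - (y - w))) *
        (coeffZ Q (y - l) * coeffZ Q (z - m) - coeffZ Q (y - m) * coeffZ Q (z - l)) := by
      intro l m hlm
      refine mul_nonneg ?_ ?_
      · have := hP.2 (l - (y - w)) (l - 0) (m - (y - w)) (m - 0) (by omega) (by omega) (by omega)
        linarith
      · have := hQ.2 (y - m) (y - l) (z - m) (z - l) (by omega) (by omega) (by omega)
        linarith
    refine sum_mul_sum_le_of_minors _ _ _ _ _ fun l _ m _ => ?_
    rcases le_total l m with h | h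
    · exact (main l m h).trans_eq (by ring)
    · exact (main m l h).trans_eq (by ring)
  refine ⟨fun n => ?_, fun w x y z h1 h2 h3 => ?_⟩
  · rw [← sub_zero n, ← sum_coeffZ_mul_shift P Q n 0 n le_rfl le_rfl]
    exact sum_nonneg fun l _ => mul_nonneg (hP.1 _) (hQ.1 _)
  · rcases le_total x y with h | h
    · exact key w x y z h1 h h3
    · rw [mul_comm (coeffZ _ x)]
      exact key w y x z h2 h (by omega)

lemma isPF2_one : IsPF2 (coeffZ (1 : ℝ[X])) := by
  have h : ∀ n : ℤ, coeffZ (1 : ℝ[X]) n = if n = 0 then 1 else 0 := by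
    intro n
    rcases lt_or_ge n 0 with hn | hn
    · rw [coeffZ_of_neg _ hn, if_neg (by omega)]
    · lift n to ℕ using hn
      rw [coeffZ_natCast, coeff_one]
      simp
  refine ⟨fun n => ?_, fun w x y z h1 h2 h3 => ?_⟩
  · rw [h]; split_ifs <;> norm_num
  · simp only [h]
    split_ifs <;> first | omega | norm_num

lemma IsPF2.pow {P : ℝ[X]} (hP : IsPF2 (coeffZ P)) (n : ℕ) : IsPF2 (coeffZ (P ^ n)) := by
  induction n with
  | zero => simpa using isPF2_one
  | succ n ih => rw [pow_succ]; exact ih.mul hP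

/-- A positive sequence on `{0, …, d}` satisfying `aᵢ aᵢ₊₂ ≤ aᵢ₊₁²` is log-concave in the
strong sense. -/
lemma isPF2_of_sq {P : ℝ[X]} {d : ℕ} (hdeg : P.natDegree ≤ d) (hpos : ∀ i ≤ d, 0 < P.coeff i)
    (hlc : ∀ i, i + 2 ≤ d → P.coeff i * P.coeff (i + 2) ≤ P.coeff (i + 1) ^ 2) :
    IsPF2 (coeffZ P) := by
  have hnn : ∀ n, 0 ≤ P.coeff n := by
    intro n
    rcases le_or_gt n d with h | h
    · exact (hpos n h).le
    · rw [coeff_eq_zero_of_natDegree_lt (by omega)]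
  have step : ∀ k i, i + k + 1 ≤ d →
      P.coeff i * P.coeff (i + k + 1) ≤ P.coeff (i + 1) * P.coeff (i + k) := by
    intro k
    induction k with
    | zero => intro i _; rw [add_zero, mul_comm]
    | succ k ih =>
      intro i hi
      have h1 := ih i (by omega)
      have h2 := hlc (i + k) (by omega)
      have p1 := hpos (i + k) (by omega)
      have p2 := hpos (i + k + 1) (by omega)
      rw [← add_assoc]
      refine le_of_mul_le_mul_right ?_ p1
      calc P.coeff i * P.coeff (i + k + 1 + 1) * P.coeff (i + k)
          = P.coeff i * (P.coeff (i + k) * P.coeff (i + k + 2)) := by ring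
        _ ≤ P.coeff i * P.coeff (i + k + 1) ^ 2 := mul_le_mul_of_nonneg_left h2 (hnn _)
        _ = (P.coeff i * P.coeff (i + k + 1)) * P.coeff (i + k + 1) := by ring
        _ ≤ (P.coeff (i + 1) * P.coeff (i + k)) * P.coeff (i + k + 1) :=
            mul_le_mul_of_nonneg_right h1 p2.le
        _ = _ := by ring
  have step' : ∀ i j, i ≤ j → P.coeff i * P.coeff (j + 1) ≤ P.coeff (i + 1) * P.coeff j := by
    intro i j hij
    obtain ⟨k, rfl⟩ := Nat.exists_eq_add_of_le hij
    rcases le_or_gt (i + k + 1) d with h | h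
    · exact step k i h
    · rw [coeff_eq_zero_of_natDegree_lt (show P.natDegree < i + k + 1 by omega), mul_zero]
      exact mul_nonneg (hnn _) (hnn _)
  have main : ∀ e w y : ℕ, w + e ≤ y →
      P.coeff w * P.coeff (y + e) ≤ P.coeff (w + e) * P.coeff y := by
    intro e
    induction e with
    | zero => intro w y _; simp
    | succ e ih =>
      intro w y h
      have h1 := ih (w + 1) y (by omega)
      have h2 := step' w (y + e) (by omega)
      have e1 : w + 1 + e = w + (e + 1) := by ring
      rw [e1] at h1
      exact h2.trans h1
  have hnz : ∀ n, 0 ≤ coeffZ P n := by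
    intro n
    unfold coeffZ
    split_ifs
    · exact hnn _
    · exact le_rfl
  refine ⟨hnz, ?_⟩
  have key : ∀ w x y z, w ≤ x → x ≤ y → w + z = x + y →
      coeffZ P w * coeffZ P z ≤ coeffZ P x * coeffZ P y := by
    intro w x y z h1 h2 h3
    rcases lt_or_ge w 0 with hw | hw
    · rw [coeffZ_of_neg _ hw, zero_mul]
      exact mul_nonneg (hnz _) (hnz _)
    · lift w to ℕ using hw
      lift x to ℕ using by omega
      lift y to ℕ using by omega
      lift z to ℕ using by omega
      simp only [coeffZ_natCast]
      have := main (x - w) w y (by omega)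
      rwa [show y + (x - w) = z by omega, show w + (x - w) = x by omega] at this
  intro w x y z h1 h2 h3
  rcases le_total x y with h | h
  · exact key w x y z h1 h h3
  · rw [mul_comm (coeffZ _ x)]
    exact key w y x z h2 h (by omega)

end RegularSlices

/-! ### The largest coefficient of powers of a probability polynomial. -/

namespace RegularSlices

/-- The largest coefficient of a polynomial. -/
noncomputable def maxCoeff (A : ℝ[X]) : ℝ :=
  (range (A.natDegree + 1)).sup' nonempty_range_add_one A.coeff

lemma exists_coeff_eq_maxCoeff (A : ℝ[X]) : ∃ j ≤ A.natDegree, A.coeff j = maxCoeff A := by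
  obtain ⟨j, hj, h⟩ := exists_mem_eq_sup' (s := range (A.natDegree + 1))
    nonempty_range_add_one A.coeff
  exact ⟨j, Nat.lt_succ_iff.mp (mem_range.mp hj), h.symm⟩

lemma coeff_le_maxCoeff {A : ℝ[X]} (hA : ∀ n, 0 ≤ A.coeff n) (n : ℕ) :
    A.coeff n ≤ maxCoeff A := by
  have h : ∀ m ≤ A.natDegree, A.coeff m ≤ maxCoeff A := fun m hm =>
    le_sup' A.coeff (mem_range.mpr (Nat.lt_succ_iff.mpr hm))
  rcases le_or_gt n A.natDegree with hn | hn
  · exact h n hn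
  · rw [coeff_eq_zero_of_natDegree_lt hn]
    exact (hA 0).trans (h 0 (Nat.zero_le _))

lemma maxCoeff_le {A : ℝ[X]} {M : ℝ} (h : ∀ n, A.coeff n ≤ M) : maxCoeff A ≤ M := by
  obtain ⟨j, -, hj⟩ := exists_coeff_eq_maxCoeff A
  rw [← hj]; exact h j

lemma maxCoeff_nonneg {A : ℝ[X]} (hA : ∀ n, 0 ≤ A.coeff n) : 0 ≤ maxCoeff A :=
  (hA 0).trans (coeff_le_maxCoeff hA 0)

lemma sum_range_coeff_eq_eval_one (A : ℝ[X]) {n : ℕ} (hn : A.natDegree < n) :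
    ∑ i ∈ range n, A.coeff i = A.eval 1 := by
  rw [eval_eq_sum_range' hn]; simp

lemma sum_range_coeff_le_eval_one {A : ℝ[X]} (hA : ∀ n, 0 ≤ A.coeff n) (n : ℕ) :
    ∑ i ∈ range n, A.coeff i ≤ A.eval 1 := by
  rw [← sum_range_coeff_eq_eval_one A (lt_of_lt_of_le (Nat.lt_succ_self _)
    (le_max_right n (A.natDegree + 1)))]
  exact sum_le_sum_of_subset_of_nonneg (range_mono (le_max_left _ _)) fun i _ _ => hA i

lemma coeff_mul_nonneg {A B : ℝ[X]} (hA : ∀ n, 0 ≤ A.coeff n) (hB : ∀ n, 0 ≤ B.coeff n) (n : ℕ) :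
    0 ≤ (A * B).coeff n := by
  rw [coeff_mul]
  exact sum_nonneg fun x _ => mul_nonneg (hA _) (hB _)

lemma coeff_pow_nonneg {A : ℝ[X]} (hA : ∀ n, 0 ≤ A.coeff n) (t n : ℕ) : 0 ≤ (A ^ t).coeff n := by
  induction t generalizing n with
  | zero => rw [pow_zero, coeff_one]; split_ifs <;> norm_num
  | succ t ih => rw [pow_succ]; exact coeff_mul_nonneg ih hA n

/-- The sum Σ satisfies Σ ≤ dM + (1 - η)Σ: the first d terms are at most M each, and the rest is a
shifted copy shrunk by 1 - η. -/
lemma sum_range_le_of_shift_le {q : ℕ → ℝ} {d : ℕ} {M η : ℝ} (hη : 0 < η)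
    (hq : ∀ i, 0 ≤ q i) (hM : ∀ i, q i ≤ M) (h : ∀ i, q (i + d) ≤ (1 - η) * q i) (N : ℕ) :
    ∑ i ∈ range N, q i ≤ d * M / η := by
  have h1 : ∑ i ∈ range N, q i ≤ ∑ i ∈ range (d + N), q i :=
    sum_le_sum_of_subset_of_nonneg (range_mono (by omega)) fun i _ _ => hq i
  rw [sum_range_add] at h1
  have h2 : ∑ i ∈ range d, q i ≤ d * M := by
    simpa using sum_le_card_nsmul (range d) q M fun i _ => hM i
  have h3 : ∑ i ∈ range N, q (d + i) ≤ (1 - η) * ∑ i ∈ range N, q i := by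
    rw [mul_sum]
    exact sum_le_sum fun i _ => by rw [add_comm]; exact h i
  rw [le_div_iff₀ hη]
  nlinarith

/-- A window of `d + 1` large coefficients survives multiplication by a probability polynomial of
degree at most `d`. -/
lemma le_coeff_mul_of_window {R A : ℝ[X]} {d : ℕ} {m : ℝ} (hR : ∀ n, 0 ≤ R.coeff n)
    (hA : ∀ n, 0 ≤ A.coeff n) (hdeg : R.natDegree ≤ d) (h1 : R.eval 1 = 1) {j : ℕ}
    (h : ∀ i ≤ d, m ≤ A.coeff (j + i)) : m ≤ (R * A).coeff (j + d) := by
  rw [coeff_mul, Nat.sum_antidiagonal_eq_sum_range_succ_mk]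
  calc m = ∑ i ∈ range (d + 1), R.coeff i * m := by
        rw [← sum_mul, sum_range_coeff_eq_eval_one R (by omega), h1, one_mul]
    _ ≤ ∑ i ∈ range (d + 1), R.coeff i * A.coeff (j + d - i) := by
        refine sum_le_sum fun i hi => mul_le_mul_of_nonneg_left ?_ (hR i)
        have := mem_range.mp hi
        rw [show j + d - i = j + (d - i) by omega]
        exact h _ (by omega)
    _ ≤ _ := sum_le_sum_of_subset_of_nonneg (range_mono (by omega)) fun i _ _ =>
        mul_nonneg (hR _) (hA _)

/-- If the largest coefficient of a log-concave probability polynomial is small, then one further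
convolution with a distribution on `{0, …, d}` barely decreases it. -/
lemma one_sub_mul_maxCoeff_le {R A : ℝ[X]} {d : ℕ} {η : ℝ} (hη : 0 < η)
    (hR : ∀ n, 0 ≤ R.coeff n) (hdeg : R.natDegree ≤ d) (h1 : R.eval 1 = 1)
    (hA : IsPF2 (coeffZ A)) (hA1 : A.eval 1 = 1) (hM : 2 * d * maxCoeff A < η) :
    (1 - η) * maxCoeff A ≤ maxCoeff (R * A) := by
  have hA0 : ∀ n, 0 ≤ A.coeff n := fun n => by simpa using hA.1 n
  have hRA := coeff_mul_nonneg hR hA0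
  obtain ⟨j, hj, hjM⟩ := exists_coeff_eq_maxCoeff A
  set M := maxCoeff A with hMdef
  have hMn : 0 ≤ M := maxCoeff_nonneg hA0
  have hle : ∀ n, coeffZ A n ≤ M := by
    intro n
    rcases lt_or_ge n 0 with hn | hn
    · rw [coeffZ_of_neg _ hn]; exact hMn
    · lift n to ℕ using hn
      rw [coeffZ_natCast]; exact coeff_le_maxCoeff hA0 n
  have hjZ : coeffZ A j = M := by rw [coeffZ_natCast, hjM]
  have hMpos : 0 < M := by
    rcases hMn.lt_or_eq with h | h
    · exact h
    · exfalso
      have : A.eval 1 = 0 := by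
        rw [← sum_range_coeff_eq_eval_one A (Nat.lt_succ_self _)]
        refine sum_eq_zero fun i _ => le_antisymm ?_ (hA0 i)
        rw [h]; exact coeff_le_maxCoeff hA0 i
      rw [hA1] at this
      exact one_ne_zero this
  -- If the coefficient d places to the right of the mode j is still large, log-concavity makes the
  -- whole window j, …, j + d large; symmetrically to the left.
  by_cases hr : (1 - η) * M ≤ coeffZ A (j + d)
  · refine (le_coeff_mul_of_window hR hA0 hdeg h1 (j := j) fun i hi => ?_).trans
      (coeff_le_maxCoeff hRA (j + d))
    have h2 := hA.2 j (j + i : ℕ) (j + (d - i) : ℕ) (j + d) (by push_cast; omega)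
      (by push_cast; omega) (by push_cast; omega)
    have h3 := hle (j + (d - i) : ℕ)
    have h4 := hA.1 (j + i : ℕ)
    rw [hjZ] at h2
    rw [coeffZ_natCast] at h2 h4
    have h5 : coeffZ A (j + d) * M ≤ A.coeff (j + i) * M := by
      rw [mul_comm]
      exact h2.trans (mul_le_mul_of_nonneg_left h3 h4)
    exact hr.trans (le_of_mul_le_mul_right h5 hMpos)
  by_cases hl : (1 - η) * M ≤ coeffZ A (j - d)
  · rcases lt_or_ge j d with hjd | hjd
    · rw [coeffZ_of_neg _ (by omega)] at hl
      exact hl.trans (maxCoeff_nonneg hRA)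
    · refine (le_coeff_mul_of_window hR hA0 hdeg h1 (j := j - d) fun i hi => ?_).trans
        (coeff_le_maxCoeff hRA (j - d + d))
      have h2 := hA.2 (j - d) (j - d + i : ℕ) (j - i : ℕ) j (by omega)
        (by omega) (by omega)
      have h3 := hle (j - i : ℕ)
      have h4 := hA.1 (j - d + i : ℕ)
      rw [hjZ] at h2
      rw [coeffZ_natCast] at h2 h4
      exact hl.trans (le_of_mul_le_mul_right (h2.trans (mul_le_mul_of_nonneg_left h3 h4)) hMpos)
  -- Otherwise every d steps away from the mode cost a factor 1 - η on both sides, so the total mass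
  -- is at most 2dM/η < 1.
  exfalso
  push Not at hr hl
  have hright : ∀ i : ℕ, coeffZ A (j + (i + d : ℕ)) ≤ (1 - η) * coeffZ A (j + i) := by
    intro i
    have h2 := hA.2 j (j + i) (j + d) (j + (i + d : ℕ)) (by omega) (by omega) (by push_cast; ring)
    rw [hjZ] at h2
    refine le_of_mul_le_mul_left (h2.trans ?_) hMpos
    have := mul_le_mul_of_nonneg_left hr.le (hA.1 (j + i))
    linarith
  have hleft : ∀ i : ℕ, coeffZ A (j - 1 - (i + d : ℕ)) ≤ (1 - η) * coeffZ A (j - 1 - i) := by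
    intro i
    have h2 := hA.2 (j - 1 - (i + d : ℕ)) (j - 1 - i) (j - d) j (by omega) (by omega)
      (by push_cast; ring)
    rw [hjZ] at h2
    refine le_of_mul_le_mul_right (h2.trans ?_) hMpos
    have := mul_le_mul_of_nonneg_left hl.le (hA.1 (j - 1 - i))
    linarith
  have s1 := sum_range_le_of_shift_le (q := fun i => coeffZ A (j + i)) hη (fun i => hA.1 _)
    (fun i => hle _) hright (A.natDegree + 1 - j)
  have s2 := sum_range_le_of_shift_le (q := fun i => coeffZ A (j - 1 - i)) hη (fun i => hA.1 _)
    (fun i => hle _) hleft j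
  have e1 : A.eval 1 = ∑ i ∈ range j, coeffZ A (j - 1 - i) +
      ∑ i ∈ range (A.natDegree + 1 - j), coeffZ A (j + i) := by
    rw [← sum_range_coeff_eq_eval_one A (show A.natDegree < j + (A.natDegree + 1 - j) by omega),
      sum_range_add, ← sum_range_reflect]
    congr 1
    · refine sum_congr rfl fun i hi => ?_
      have := mem_range.mp hi
      rw [← coeffZ_natCast]; congr 1; omega
  have : 1 ≤ d * M / η + d * M / η := by linarith
  rw [← add_div, le_div_iff₀ hη] at this
  linarith

lemma maxCoeff_mul_le {R A : ℝ[X]} (hR : ∀ n, 0 ≤ R.coeff n) (h1 : R.eval 1 = 1)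
    (hA : ∀ n, 0 ≤ A.coeff n) : maxCoeff (R * A) ≤ maxCoeff A := by
  refine maxCoeff_le fun n => ?_
  rw [coeff_mul, Nat.sum_antidiagonal_eq_sum_range_succ_mk]
  calc ∑ i ∈ range n.succ, R.coeff i * A.coeff (n - i)
      ≤ ∑ i ∈ range n.succ, R.coeff i * maxCoeff A :=
        sum_le_sum fun i _ => mul_le_mul_of_nonneg_left (coeff_le_maxCoeff hA _) (hR i)
    _ = (∑ i ∈ range n.succ, R.coeff i) * maxCoeff A := by rw [sum_mul]
    _ ≤ 1 * maxCoeff A := by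
        refine mul_le_mul_of_nonneg_right ?_ (maxCoeff_nonneg hA)
        rw [← h1]; exact sum_range_coeff_le_eval_one hR _
    _ = _ := one_mul _

/-- Reaching l takes l summands equal to 1 and L - l equal to 0, each of probability at least κ. -/
lemma pow_le_coeff_pow {R : ℝ[X]} {κ : ℝ} (hκ : 0 ≤ κ) (hR : ∀ n, 0 ≤ R.coeff n)
    (h0 : κ ≤ R.coeff 0) (h1 : κ ≤ R.coeff 1) (L : ℕ) : ∀ l ≤ L, κ ^ L ≤ (R ^ L).coeff l := by
  induction L with
  | zero => intro l hl; obtain rfl : l = 0 := by omega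
            simp
  | succ L ih =>
    have key : ∀ i l, κ ≤ R.coeff i → l ≤ L → κ ^ (L + 1) ≤ (R ^ (L + 1)).coeff (l + i) := by
      intro i l hi hl
      rw [pow_succ (R : ℝ[X]), coeff_mul, pow_succ]
      refine (mul_le_mul (ih l hl) hi hκ (coeff_pow_nonneg hR _ _)).trans ?_
      exact single_le_sum (f := fun x : ℕ × ℕ => (R ^ L).coeff x.1 * R.coeff x.2)
        (fun x _ => mul_nonneg (coeff_pow_nonneg hR _ _) (hR _))
        (show (l, i) ∈ antidiagonal (l + i) by simp)
    intro l hl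
    rcases Nat.lt_or_ge l (L + 1) with h | h
    · exact key 0 l h0 (by omega)
    · obtain rfl : l = L + 1 := by omega
      exact key 1 L h1 le_rfl

/-- Convolution with a distribution charging `0, …, L` decreases the largest coefficient of a
probability polynomial by a fixed amount as long as it exceeds `2 / (L + 1)`. -/
lemma maxCoeff_mul_le_sub {B A : ℝ[X]} {L : ℕ} {b : ℝ} (hb : 0 ≤ b)
    (hB : ∀ n, 0 ≤ B.coeff n) (hB1 : B.eval 1 = 1) (hbL : ∀ l ≤ L, b ≤ B.coeff l)
    (hA : ∀ n, 0 ≤ A.coeff n) (hA1 : A.eval 1 = 1) (hM : 2 ≤ (L + 1) * maxCoeff A) :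
    maxCoeff (B * A) ≤ maxCoeff A - b := by
  refine maxCoeff_le fun n => ?_
  have hMn := maxCoeff_nonneg hA
  set M := maxCoeff A
  set N := max n L
  have hAZ : ∀ n, coeffZ A n ≤ M := by
    intro n
    rcases lt_or_ge n 0 with hn | hn
    · rw [coeffZ_of_neg _ hn]; exact hMn
    · lift n to ℕ using hn
      rw [coeffZ_natCast]; exact coeff_le_maxCoeff hA n
  have e1 : (B * A).coeff n = ∑ l ∈ range (N + 1), B.coeff l * coeffZ A (n - l) := by
    rw [coeff_mul, Nat.sum_antidiagonal_eq_sum_range_succ_mk]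
    have : ∀ l ∈ range n.succ, B.coeff l * A.coeff (n - l) = B.coeff l * coeffZ A (n - l) := by
      intro l hl
      have := mem_range.mp hl
      rw [← Int.ofNat_sub (by omega), coeffZ_natCast]
    rw [sum_congr rfl this]
    refine sum_subset (range_mono (by omega)) fun l _ hl => ?_
    rw [mem_range] at hl
    rw [coeffZ_of_neg _ (by omega), mul_zero]
  have e2 : ∑ l ∈ range (L + 1), coeffZ A (n - l) ≤ 1 := by
    rw [← hA1]
    refine le_trans ?_ (sum_range_coeff_le_eval_one hA (n + 1))
    have : ∑ l ∈ range (L + 1), coeffZ A (n - l) ≤ ∑ l ∈ range (N + 1), coeffZ A (n - l) := by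
      refine sum_le_sum_of_subset_of_nonneg (range_mono (by omega)) fun l _ _ => ?_
      unfold coeffZ; split_ifs
      · exact hA _
      · exact le_rfl
    refine this.trans (le_of_eq ?_)
    rw [← sum_range_reflect A.coeff]
    symm
    refine (sum_congr rfl fun l hl => ?_).trans
      (sum_subset (range_mono (show n + 1 ≤ N + 1 by omega)) fun l _ hl => ?_)
    · have := mem_range.mp hl
      rw [← coeffZ_natCast]; congr 1; omega
    · rw [mem_range] at hl
      rw [coeffZ_of_neg _ (by omega)]
  have e3 : ∑ l ∈ range (N + 1), B.coeff l * M ≤ M := by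
    rw [← sum_mul]
    have := sum_range_coeff_le_eval_one hB (N + 1)
    rw [hB1] at this
    nlinarith
  have e4 : b ≤ ∑ l ∈ range (N + 1), B.coeff l * (M - coeffZ A (n - l)) := by
    calc b = b * 1 := (mul_one b).symm
      _ ≤ b * ∑ l ∈ range (L + 1), (M - coeffZ A (n - l)) := by
          refine mul_le_mul_of_nonneg_left ?_ hb
          rw [sum_sub_distrib]
          simp only [sum_const, card_range, nsmul_eq_mul]
          push_cast
          linarith
      _ = ∑ l ∈ range (L + 1), b * (M - coeffZ A (n - l)) := by rw [mul_sum]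
      _ ≤ ∑ l ∈ range (L + 1), B.coeff l * (M - coeffZ A (n - l)) := by
          refine sum_le_sum fun l hl => mul_le_mul_of_nonneg_right (hbL l ?_) ?_
          · have := mem_range.mp hl; omega
          · linarith [hAZ (n - l)]
      _ ≤ _ := sum_le_sum_of_subset_of_nonneg (range_mono (by omega)) fun l _ _ =>
          mul_nonneg (hB _) (by linarith [hAZ (n - l)])
  simp only [mul_sub, sum_sub_distrib] at e4
  rw [e1]
  linarith

lemma maxCoeff_pow_antitone {R : ℝ[X]} (hR : ∀ n, 0 ≤ R.coeff n) (hR1 : R.eval 1 = 1) {t t' : ℕ}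
    (h : t ≤ t') : maxCoeff (R ^ t') ≤ maxCoeff (R ^ t) := by
  induction h with
  | refl => exact le_rfl
  | step _ ih =>
    rw [pow_succ']
    exact (maxCoeff_mul_le hR hR1 (coeff_pow_nonneg hR _)).trans ih

/-- While the maximum stays above δ > 2/L, each block of L further factors lowers it by at least
κ^L. It starts at most at 1, so fewer than K blocks can pass when K > κ^(-L). The bound depends on R
only through κ. -/
lemma exists_forall_maxCoeff_pow_lt {κ δ : ℝ} (hκ : 0 < κ) (hδ : 0 < δ) :
    ∃ T : ℕ, ∀ R : ℝ[X], (∀ n, 0 ≤ R.coeff n) → R.eval 1 = 1 → κ ≤ R.coeff 0 → κ ≤ R.coeff 1 →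
      ∀ t ≥ T, maxCoeff (R ^ t) < δ := by
  obtain ⟨L, hL⟩ := exists_nat_gt (2 / δ)
  obtain ⟨K, hK⟩ := exists_nat_gt (1 / κ ^ L)
  refine ⟨L * K, fun R hR hR1 h0 h1 t ht => ?_⟩
  have hκL : 0 < κ ^ L := pow_pos hκ L
  by_contra! hcon
  have hbig : ∀ t' ≤ L * K, δ ≤ maxCoeff (R ^ t') := fun t' ht' =>
    hcon.trans (maxCoeff_pow_antitone hR hR1 (ht'.trans ht))
  have hev : ∀ t, (R ^ t).eval 1 = 1 := fun t => by rw [eval_pow, hR1, one_pow]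
  have hdec : ∀ i ≤ K, maxCoeff (R ^ (L * i)) ≤ 1 - i * κ ^ L := by
    intro i
    induction i with
    | zero =>
      intro _
      refine maxCoeff_le fun n => ?_
      simp only [mul_zero, pow_zero, coeff_one]
      split_ifs <;> norm_num
    | succ i ih =>
      intro hi
      have h2 := maxCoeff_mul_le_sub hκL.le (coeff_pow_nonneg hR L) (hev L)
        (pow_le_coeff_pow hκ.le hR h0 h1 L) (coeff_pow_nonneg hR (L * i)) (hev _) (by
          have h3 := hbig (L * i) (Nat.mul_le_mul_left _ (by omega))
          have h4 : 2 < L * δ := by rwa [div_lt_iff₀ hδ] at hL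
          have : (0 : ℝ) ≤ L := Nat.cast_nonneg L
          nlinarith)
      rw [← pow_add, show L + L * i = L * (i + 1) by ring] at h2
      have h5 := ih (by omega)
      push_cast
      linarith
  have h6 := hdec K le_rfl
  have h7 := hbig (L * K) le_rfl
  rw [div_lt_iff₀ hκL] at hK
  linarith

/-- After T factors the maximum is small enough for `one_sub_mul_maxCoeff_le`, with T uniform over
all laws giving mass at least κ to 0 and to 1. -/
lemma exists_forall_one_sub_mul_maxCoeff_pow_le (d : ℕ) {κ η : ℝ} (hκ : 0 < κ) (hη : 0 < η) :
    ∃ T : ℕ, ∀ R : ℝ[X], IsPF2 (coeffZ R) → R.natDegree ≤ d → R.eval 1 = 1 →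
      κ ≤ R.coeff 0 → κ ≤ R.coeff 1 →
      ∀ t ≥ T, (1 - η) * maxCoeff (R ^ t) ≤ maxCoeff (R ^ (t + 1)) := by
  obtain ⟨T, hT⟩ := exists_forall_maxCoeff_pow_lt hκ (show 0 < η / (2 * d + 1) by positivity)
  refine ⟨T, fun R hPF hdeg h1 hk0 hk1 t ht => ?_⟩
  have hR : ∀ n, 0 ≤ R.coeff n := fun n => by simpa using hPF.1 n
  have h2 := hT R hR h1 hk0 hk1 t ht
  rw [pow_succ']
  refine one_sub_mul_maxCoeff_le hη hR hdeg h1 (hPF.pow t) (by rw [eval_pow, h1, one_pow]) ?_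
  rw [lt_div_iff₀ (by positivity)] at h2
  have := maxCoeff_nonneg (coeff_pow_nonneg hR t)
  nlinarith

end RegularSlices

/-! ### Exponential tilting and domination of coefficients. -/

namespace RegularSlices

/-- Polynomials of degree `d` with positive, log-concave coefficients. -/
structure LogConcavePoly (P : ℝ[X]) (d : ℕ) : Prop where
  natDegree_le : P.natDegree ≤ d
  coeff_pos : ∀ i ≤ d, 0 < P.coeff i
  coeff_mul_le_sq : ∀ i, i + 2 ≤ d → P.coeff i * P.coeff (i + 2) ≤ P.coeff (i + 1) ^ 2

lemma coeff_mul_pow_le_eval {Q : ℝ[X]} (hQ : ∀ n, 0 ≤ Q.coeff n) {x : ℝ} (hx : 0 ≤ x) (n : ℕ) :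
    Q.coeff n * x ^ n ≤ Q.eval x := by
  rw [eval_eq_sum_range' (lt_of_lt_of_le (Nat.lt_succ_self _)
    (le_max_right (n + 1) (Q.natDegree + 1)))]
  exact single_le_sum (f := fun i => Q.coeff i * x ^ i)
    (fun i _ => mul_nonneg (hQ i) (pow_nonneg hx i)) (mem_range.mpr (by omega))

lemma sum_range_coeff_mul_pow_le_eval {Q : ℝ[X]} (hQ : ∀ n, 0 ≤ Q.coeff n) {x : ℝ} (hx : 0 ≤ x)
    (n : ℕ) : ∑ i ∈ range n, Q.coeff i * x ^ i ≤ Q.eval x := by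
  rw [eval_eq_sum_range' (lt_of_lt_of_le (Nat.lt_succ_self _)
    (le_max_right n (Q.natDegree + 1)))]
  exact sum_le_sum_of_subset_of_nonneg (range_mono (by omega))
    fun i _ _ => mul_nonneg (hQ i) (pow_nonneg hx i)

namespace LogConcavePoly

variable {P : ℝ[X]} {d : ℕ}

lemma coeff_nonneg (hP : LogConcavePoly P d) (n : ℕ) : 0 ≤ P.coeff n := by
  rcases le_or_gt n d with h | h
  · exact (hP.coeff_pos n h).le
  · rw [coeff_eq_zero_of_natDegree_lt (lt_of_le_of_lt hP.natDegree_le h)]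

lemma eval_pos (hP : LogConcavePoly P d) {x : ℝ} (hx : 0 ≤ x) : 0 < P.eval x := by
  have := coeff_mul_pow_le_eval hP.coeff_nonneg hx 0
  have := hP.coeff_pos 0 (Nat.zero_le _)
  simp at *
  linarith

lemma eval_le_eval (hP : LogConcavePoly P d) {x y : ℝ} (hx : 0 ≤ x) (hxy : x ≤ y) :
    P.eval x ≤ P.eval y := by
  rw [eval_eq_sum_range, eval_eq_sum_range]
  exact sum_le_sum fun i _ =>
    mul_le_mul_of_nonneg_left (pow_le_pow_left₀ hx hxy i) (hP.coeff_nonneg i)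

lemma coeff_pow_pos (hP : LogConcavePoly P d) (m : ℕ) : ∀ j ≤ d * m, 0 < (P ^ m).coeff j := by
  induction m with
  | zero => intro j hj; obtain rfl : j = 0 := by simpa using hj
            simp
  | succ m ih =>
    have key : ∀ i l, i ≤ d → l ≤ d * m → 0 < (P ^ (m + 1)).coeff (l + i) := by
      intro i l hi hl
      rw [pow_succ, coeff_mul]
      refine lt_of_lt_of_le (mul_pos (ih l hl) (hP.coeff_pos i hi)) ?_
      exact single_le_sum (f := fun x : ℕ × ℕ => (P ^ m).coeff x.1 * P.coeff x.2)
        (fun x _ => mul_nonneg (coeff_pow_nonneg hP.coeff_nonneg _ _) (hP.coeff_nonneg _))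
        (show (l, i) ∈ antidiagonal (l + i) by simp)
    intro j hj
    rw [mul_add, mul_one] at hj
    rcases le_or_gt j (d * m) with h | h
    · exact key 0 j (Nat.zero_le _) h
    · have := key (j - d * m) (d * m) (by omega) le_rfl
      rwa [Nat.add_sub_cancel' h.le] at this

end LogConcavePoly

/-- The distribution on `{0, …, d}` with weights proportional to `pᵢ xⁱ`, as a polynomial. -/
noncomputable def tilt (P : ℝ[X]) (x : ℝ) : ℝ[X] := C (P.eval x)⁻¹ * P.comp (C x * X)

lemma coeff_tilt_pow (P : ℝ[X]) (x : ℝ) (t n : ℕ) :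
    ((tilt P x) ^ t).coeff n = (P ^ t).coeff n * x ^ n / (P.eval x) ^ t := by
  rw [tilt, mul_pow, ← C_pow, ← pow_comp, coeff_C_mul, comp_C_mul_X_coeff, inv_pow]
  field_simp

lemma coeff_tilt (P : ℝ[X]) (x : ℝ) (n : ℕ) :
    (tilt P x).coeff n = P.coeff n * x ^ n / P.eval x := by
  simpa using coeff_tilt_pow P x 1 n

lemma eval_one_tilt {P : ℝ[X]} {x : ℝ} (h : P.eval x ≠ 0) : (tilt P x).eval 1 = 1 := by
  simp [tilt, eval_comp, inv_mul_cancel₀ h]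

lemma LogConcavePoly.tilt {P : ℝ[X]} {d : ℕ} (hP : LogConcavePoly P d) {x : ℝ} (hx : 0 < x) :
    LogConcavePoly (tilt P x) d := by
  have hpos := hP.eval_pos hx.le
  refine ⟨?_, fun i hi => ?_, fun i hi => ?_⟩
  · rw [natDegree_le_iff_coeff_eq_zero]
    intro n hn
    rw [coeff_tilt, coeff_eq_zero_of_natDegree_lt (lt_of_le_of_lt hP.natDegree_le hn)]
    simp
  · rw [coeff_tilt]
    have := hP.coeff_pos i hi
    positivity
  · simp only [coeff_tilt]
    have := hP.coeff_mul_le_sq i hi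
    rw [div_mul_div_comm, div_pow, ← pow_two (P.eval x)]
    gcongr
    calc P.coeff i * x ^ i * (P.coeff (i + 2) * x ^ (i + 2))
        = (P.coeff i * P.coeff (i + 2)) * (x ^ (i + 1)) ^ 2 := by ring
      _ ≤ P.coeff (i + 1) ^ 2 * (x ^ (i + 1)) ^ 2 := by gcongr
      _ = _ := by ring

/-- Uniformity over the unbounded range x ≥ l₀ needs two regimes. For large x the tilted law is
nearly a point mass at d, so each convolution is almost a shift. For bounded x the masses at 0 and 1
are bounded below, and the flatness of large powers applies. -/
lemma exists_forall_exp_mul_maxCoeff_tilt_le {P : ℝ[X]} {d : ℕ} (hd : 1 ≤ d)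
    (hP : LogConcavePoly P d) {c l₀ : ℝ} (hc : 0 < c) (hl₀ : 0 < l₀) :
    ∃ N : ℕ, ∀ x ≥ l₀, ∀ t s : ℕ, N ≤ t + s →
      Real.exp (-c * s) * maxCoeff (tilt P x ^ t) ≤ maxCoeff (tilt P x ^ (t + s)) := by
  have htend : Filter.Tendsto (fun x : ℝ => P.coeff d * x ^ d / P.eval x) Filter.atTop
      (nhds 1) := by
    have hdeg : P.natDegree = d := le_antisymm hP.natDegree_le
      (le_natDegree_of_ne_zero (hP.coeff_pos d le_rfl).ne')
    have h := P.isEquivalent_atTop_lead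
    have h2 := h.symm
    rw [Asymptotics.isEquivalent_iff_tendsto_one] at h2
    · simpa [Pi.div_def, leadingCoeff, hdeg] using h2
    · filter_upwards [Filter.eventually_ge_atTop 0] with x hx using (hP.eval_pos hx).ne'
  have hexp1 : Real.exp (-c) < 1 := Real.exp_lt_one_iff.mpr (by linarith)
  obtain ⟨Λ₀, hΛ₀⟩ := Filter.eventually_atTop.mp (htend.eventually_const_le hexp1)
  set Λ := max Λ₀ l₀
  have hΛpos : 0 < Λ := lt_of_lt_of_le hl₀ (le_max_right _ _)
  set κ := min (P.coeff 0) (P.coeff 1 * l₀) / P.eval Λ with hκdef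
  have hκ : 0 < κ := div_pos (lt_min (hP.coeff_pos 0 (by omega))
    (mul_pos (hP.coeff_pos 1 hd) hl₀)) (hP.eval_pos hΛpos.le)
  obtain ⟨T, hT⟩ := exists_forall_one_sub_mul_maxCoeff_pow_le d hκ
    (show 0 < 1 - Real.exp (-(c / 2)) by
      have := Real.exp_lt_one_iff.mpr (show -(c / 2) < 0 by linarith); linarith)
  -- The steps below lose only the rate c/2; N makes the spare half pay for the factor κ^T lost when
  -- t < T.
  obtain ⟨N, hN⟩ := exists_nat_gt (T + 2 * (-Real.log (κ ^ T)) / c)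
  refine ⟨max N T, fun x hx t s hts => ?_⟩
  have hx0 : 0 < x := lt_of_lt_of_le hl₀ hx
  have hPx := hP.eval_pos hx0.le
  have hR := hP.tilt hx0
  have hR1 := eval_one_tilt hPx.ne'
  set R := RegularSlices.tilt P x with hRdef
  rcases le_or_gt Λ x with hxΛ | hxΛ
  -- The coefficient of R^(t+1) at d + j, with j a mode of R^t, already suffices, since R has mass
  -- at least exp(-c) at d.
  · have hstep : ∀ t, Real.exp (-c) * maxCoeff (R ^ t) ≤ maxCoeff (R ^ (t + 1)) := by
      intro t
      obtain ⟨j, -, hj⟩ := exists_coeff_eq_maxCoeff (R ^ t)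
      have h1 : Real.exp (-c) ≤ R.coeff d := by
        rw [hRdef, coeff_tilt]
        exact hΛ₀ x ((le_max_left _ _).trans hxΛ)
      refine le_trans ?_ (coeff_le_maxCoeff (coeff_pow_nonneg hR.coeff_nonneg (t + 1)) (d + j))
      rw [← hj, pow_succ', coeff_mul]
      refine (mul_le_mul_of_nonneg_right h1 (coeff_pow_nonneg hR.coeff_nonneg _ _)).trans ?_
      exact single_le_sum (f := fun x : ℕ × ℕ => R.coeff x.1 * (R ^ t).coeff x.2)
        (fun x _ => mul_nonneg (hR.coeff_nonneg _) (coeff_pow_nonneg hR.coeff_nonneg _ _))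
        (show (d, j) ∈ antidiagonal (d + j) by simp)
    clear hts
    induction s with
    | zero => simp
    | succ s ih =>
      refine le_trans ?_ (hstep (t + s))
      rw [show -c * ((s + 1 : ℕ) : ℝ) = -c + -c * s by push_cast; ring, Real.exp_add, mul_assoc]
      exact mul_le_mul_of_nonneg_left ih (Real.exp_pos _).le
  · have hk : ∀ y, min (P.coeff 0) (P.coeff 1 * l₀) ≤ y → κ ≤ y / P.eval x := by
      intro y hy
      have h0 : 0 < min (P.coeff 0) (P.coeff 1 * l₀) := lt_min (hP.coeff_pos 0 (by omega))
        (mul_pos (hP.coeff_pos 1 hd) hl₀)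
      exact div_le_div₀ (h0.le.trans hy) hy hPx (hP.eval_le_eval hx0.le hxΛ.le)
    have hk0 : κ ≤ R.coeff 0 := by
      rw [hRdef, coeff_tilt]; exact hk _ (by simp)
    have hk1 : κ ≤ R.coeff 1 := by
      rw [hRdef, coeff_tilt]
      refine hk _ ((min_le_right _ _).trans ?_)
      rw [pow_one]
      exact mul_le_mul_of_nonneg_left hx (hP.coeff_nonneg 1)
    have hstep : ∀ t ≥ T, Real.exp (-(c / 2)) * maxCoeff (R ^ t) ≤ maxCoeff (R ^ (t + 1)) := by
      intro t ht
      have := hT R (isPF2_of_sq hR.natDegree_le hR.coeff_pos hR.coeff_mul_le_sq)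
        hR.natDegree_le hR1 hk0 hk1 t ht
      simpa using this
    have hmany : ∀ t ≥ T, ∀ s : ℕ,
        Real.exp (-(c / 2) * s) * maxCoeff (R ^ t) ≤ maxCoeff (R ^ (t + s)) := by
      intro t ht s
      induction s with
      | zero => simp
      | succ s ih =>
        refine le_trans ?_ (hstep (t + s) (by omega))
        rw [show -(c / 2) * ((s + 1 : ℕ) : ℝ) = -(c / 2) + -(c / 2) * s by push_cast; ring,
          Real.exp_add, mul_assoc]
        exact mul_le_mul_of_nonneg_left ih (Real.exp_pos _).le
    rcases le_or_gt T t with ht | ht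
    · refine le_trans (mul_le_mul_of_nonneg_right (Real.exp_le_exp.mpr ?_)
        (maxCoeff_nonneg (coeff_pow_nonneg hR.coeff_nonneg t))) (hmany t ht s)
      have : (0 : ℝ) ≤ s := Nat.cast_nonneg s
      nlinarith
    · have h1 := hmany T le_rfl (t + s - T)
      rw [show T + (t + s - T) = t + s by omega] at h1
      refine le_trans ?_ h1
      have h2 : κ ^ T ≤ maxCoeff (R ^ T) :=
        (pow_le_coeff_pow hκ.le hR.coeff_nonneg hk0 hk1 T 0 (Nat.zero_le _)).trans
          (coeff_le_maxCoeff (coeff_pow_nonneg hR.coeff_nonneg T) 0)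
      have h3 : maxCoeff (R ^ t) ≤ 1 := by
        refine (maxCoeff_pow_antitone hR.coeff_nonneg hR1 (Nat.zero_le t)).trans
          (maxCoeff_le fun n => ?_)
        rw [pow_zero, coeff_one]
        split_ifs <;> norm_num
      -- Here t < T gives s ≥ t + s - T, and (c/2)(t + s - T) exceeds -log κ^T by the choice of N.
      have h4 : Real.exp (-c * s) ≤ Real.exp (-(c / 2) * (t + s - T : ℕ)) * κ ^ T := by
        rw [← Real.exp_log (pow_pos hκ T), ← Real.exp_add, Real.exp_le_exp]
        have hts' : ((t + s - T : ℕ) : ℝ) = t + s - T := by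
          rw [Nat.cast_sub (by omega)]; push_cast; ring
        have hNts : (N : ℝ) ≤ t + s := by exact_mod_cast (le_max_left _ _).trans hts
        have hlt : T + 2 * (-Real.log (κ ^ T)) / c < t + s := hN.trans_le hNts
        have h5 : 2 * (-Real.log (κ ^ T)) / c < t + s - T := by linarith
        rw [div_lt_iff₀ hc] at h5
        have h6 : (t : ℝ) ≤ T := by exact_mod_cast ht.le
        rw [hts']
        nlinarith
      calc Real.exp (-c * s) * maxCoeff (R ^ t) ≤ Real.exp (-c * s) * 1 :=
            mul_le_mul_of_nonneg_left h3 (Real.exp_pos _).le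
        _ ≤ Real.exp (-(c / 2) * (t + s - T : ℕ)) * κ ^ T := by rw [mul_one]; exact h4
        _ ≤ _ := mul_le_mul_of_nonneg_left h2 (Real.exp_pos _).le

/-- Tilting by `x = aₖ₋₁ / aₖ` makes `k` a mode of a log-concave sequence `a`. -/
lemma coeff_mul_pow_le_of_isPF2 {A : ℝ[X]} (hA : IsPF2 (coeffZ A)) {k : ℕ}
    (hk : 0 < A.coeff (k + 1)) (j : ℕ) :
    A.coeff j * (A.coeff k / A.coeff (k + 1)) ^ j ≤
      A.coeff (k + 1) * (A.coeff k / A.coeff (k + 1)) ^ (k + 1) := by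
  have hA0 : ∀ n, 0 ≤ A.coeff n := fun n => by simpa using hA.1 n
  have hN : ∀ w x y z : ℕ, w ≤ x → w ≤ y → w + z = x + y →
      A.coeff w * A.coeff z ≤ A.coeff x * A.coeff y := by
    intro w x y z h1 h2 h3
    have := hA.2 w x y z (by omega) (by omega) (by omega)
    simpa using this
  set x := A.coeff k / A.coeff (k + 1) with hx
  have hx0 : 0 ≤ x := div_nonneg (hA0 _) hk.le
  have hup : ∀ j, j ≤ k → A.coeff j * x ^ j ≤ A.coeff (j + 1) * x ^ (j + 1) := by
    intro j hj
    have h1 := hN j (j + 1) k (k + 1) (by omega) hj (by omega)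
    have h2 : A.coeff j ≤ A.coeff (j + 1) * x := by
      rw [hx, ← mul_div_assoc, le_div_iff₀ hk]; exact h1
    calc A.coeff j * x ^ j ≤ A.coeff (j + 1) * x * x ^ j :=
          mul_le_mul_of_nonneg_right h2 (pow_nonneg hx0 j)
      _ = _ := by ring
  have hdown : ∀ j, k + 1 ≤ j → A.coeff (j + 1) * x ^ (j + 1) ≤ A.coeff j * x ^ j := by
    intro j hj
    have h1 := hN k (k + 1) j (j + 1) (by omega) (by omega) (by omega)
    have h2 : A.coeff (j + 1) * x ≤ A.coeff j := by
      rw [hx, ← mul_div_assoc, div_le_iff₀ hk]; linarith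
    calc A.coeff (j + 1) * x ^ (j + 1) = A.coeff (j + 1) * x * x ^ j := by ring
      _ ≤ _ := mul_le_mul_of_nonneg_right h2 (pow_nonneg hx0 j)
  rcases le_total j (k + 1) with h | h
  · refine Nat.decreasingInduction' (P := fun j => A.coeff j * x ^ j ≤
      A.coeff (k + 1) * x ^ (k + 1)) (fun i hi _ ih => (hup i (by omega)).trans ih) h le_rfl
  · induction j, h using Nat.le_induction with
    | base => exact le_rfl
    | succ j hj ih => exact (hdown j hj).trans ih

/-- The left side is a coefficient of the derivative m P^(m-1) P', and P' ≤ K P coefficientwise. It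
bounds the tilt a_k / a_(k+1) below by (k + 1)/(Km), which is where k > εn enters. -/
lemma exists_succ_mul_coeff_pow_le {P : ℝ[X]} {d : ℕ} (hP : LogConcavePoly P d) :
    ∃ K : ℝ, 0 < K ∧ ∀ m k : ℕ,
      (k + 1) * (P ^ m).coeff (k + 1) ≤ K * m * (P ^ m).coeff k := by
  have hnn : ∀ i, 0 ≤ (i + 1) * P.coeff (i + 1) / P.coeff i := fun i =>
    div_nonneg (mul_nonneg (by positivity) (hP.coeff_nonneg _)) (hP.coeff_nonneg _)
  set K := ∑ i ∈ range (d + 1), (i + 1) * P.coeff (i + 1) / P.coeff i + 1 with hK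
  have hK0 : 0 < K := by
    have := sum_nonneg fun i (_ : i ∈ range (d + 1)) => hnn i
    linarith
  have hP' : ∀ i, P.derivative.coeff i ≤ K * P.coeff i := by
    intro i
    rw [coeff_derivative]
    rcases le_or_gt i d with h | h
    · have hp := hP.coeff_pos i h
      rw [← div_le_iff₀ hp, mul_comm]
      have := single_le_sum (f := fun i : ℕ => (i + 1) * P.coeff (i + 1) / P.coeff i)
        (fun i _ => hnn i) (mem_range.mpr (Nat.lt_succ_of_le h))
      linarith
    · rw [coeff_eq_zero_of_natDegree_lt (lt_of_le_of_lt hP.natDegree_le (by omega : d < i + 1)),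
        zero_mul]
      exact mul_nonneg hK0.le (hP.coeff_nonneg i)
  refine ⟨K, hK0, fun m k => ?_⟩
  rcases m with _ | m
  · simp [coeff_one]
  have h1 : (k + 1) * (P ^ (m + 1)).coeff (k + 1) = (P ^ (m + 1)).derivative.coeff k := by
    rw [coeff_derivative]; ring
  rw [h1, derivative_pow_succ, mul_assoc, coeff_C_mul, pow_succ, coeff_mul, coeff_mul,
    mul_comm K, mul_assoc]
  push_cast
  refine mul_le_mul_of_nonneg_left ?_ (by positivity)
  rw [mul_sum]
  refine sum_le_sum fun x _ => ?_
  calc (P ^ m).coeff x.1 * P.derivative.coeff x.2 ≤ (P ^ m).coeff x.1 * (K * P.coeff x.2) :=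
        mul_le_mul_of_nonneg_left (hP' _) (coeff_pow_nonneg hP.coeff_nonneg _ _)
    _ = _ := by ring

/-- If `Q` is exponentially smaller than `P ^ s` on `[l₀, ∞)`, then the coefficients of
`P ^ t * Q` are dominated by those of `P ^ (t + s)`, away from the lowest ones. -/
theorem exists_forall_coeff_pow_mul_le {P : ℝ[X]} {d : ℕ} (hd : 1 ≤ d) (hP : LogConcavePoly P d)
    {ε : ℝ} (hε : 0 < ε) :
    ∃ l₀ : ℝ, 0 < l₀ ∧ ∀ c > 0, ∃ N : ℕ, ∀ t s : ℕ, N ≤ t + s →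
      ∀ Q : ℝ[X], (∀ n, 0 ≤ Q.coeff n) →
      (∀ x ≥ l₀, Q.eval x ≤ P.eval x ^ s * Real.exp (-c * s)) →
      ∀ k : ℕ, ε * (t + s : ℕ) < k → (P ^ t * Q).coeff k ≤ (P ^ (t + s)).coeff k := by
  obtain ⟨K, hK, hder⟩ := exists_succ_mul_coeff_pow_le hP
  refine ⟨ε / K, div_pos hε hK, fun c hc => ?_⟩
  obtain ⟨N, hN⟩ := exists_forall_exp_mul_maxCoeff_tilt_le hd hP hc (div_pos hε hK)
  refine ⟨N, fun t s hts Q hQ hgap k hk => ?_⟩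
  have hPt := fun t => coeff_pow_nonneg hP.coeff_nonneg t
  have hnn := coeff_mul_nonneg (hPt t) hQ
  rcases le_or_gt k (d * (t + s)) with hkd | hkd
  · obtain ⟨k, rfl⟩ : ∃ k', k = k' + 1 := by
      refine Nat.exists_eq_succ_of_ne_zero ?_
      rintro rfl
      have : 0 ≤ ε * ((t + s : ℕ) : ℝ) := by positivity
      simp at hk
      push_cast at this
      linarith
    set A := P ^ (t + s) with hA
    have hAk : 0 < A.coeff (k + 1) := hP.coeff_pow_pos _ _ hkd
    have hAk' : 0 < A.coeff k := hP.coeff_pow_pos _ _ (by omega)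
    have hPF : IsPF2 (coeffZ A) :=
      (isPF2_of_sq hP.natDegree_le hP.coeff_pos hP.coeff_mul_le_sq).pow _
    have hmode := coeff_mul_pow_le_of_isPF2 hPF hAk
    -- This tilt makes k + 1 a mode, so the largest coefficient of the tilted power is the one under
    -- comparison.
    set x := A.coeff k / A.coeff (k + 1) with hx
    have hx0 : 0 < x := div_pos hAk' hAk
    have hxl : ε / K ≤ x := by
      rw [hx, div_le_div_iff₀ hK hAk]
      have h1 := hder (t + s) k
      have hm : 0 < ((t + s : ℕ) : ℝ) := by
        rcases Nat.eq_zero_or_pos (t + s) with h | h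
        · rw [h] at hkd; simp at hkd
        · exact_mod_cast h
      refine le_of_mul_le_mul_right ?_ hm
      push_cast at hk h1 ⊢
      nlinarith
    have hPx := hP.eval_pos hx0.le
    have h1 := hN x hxl t s hts
    have hmax : maxCoeff (tilt P x ^ (t + s)) ≤
        A.coeff (k + 1) * x ^ (k + 1) / P.eval x ^ (t + s) := by
      refine maxCoeff_le fun n => ?_
      rw [coeff_tilt_pow]
      exact div_le_div_of_nonneg_right (hmode n) (pow_nonneg hPx.le _)
    have hTt := coeff_pow_nonneg (hP.tilt hx0).coeff_nonneg t
    have hμ0 := maxCoeff_nonneg hTt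
    have hle : (P ^ t * Q).coeff (k + 1) * x ^ (k + 1) ≤
        P.eval x ^ t * maxCoeff (tilt P x ^ t) * Q.eval x := by
      rw [mul_comm (P ^ t), coeff_mul, Nat.sum_antidiagonal_eq_sum_range_succ_mk, sum_mul]
      refine le_trans (sum_le_sum fun i hi => ?_)
        ((mul_sum _ _ _).symm.le.trans (mul_le_mul_of_nonneg_left
          (sum_range_coeff_mul_pow_le_eval hQ hx0.le (k + 1).succ)
            (mul_nonneg (pow_nonneg hPx.le _) hμ0)))
      have hik : i ≤ k + 1 := Nat.lt_succ_iff.mp (mem_range.mp hi)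
      have h2 : (P ^ t).coeff (k + 1 - i) * x ^ (k + 1 - i) ≤
          P.eval x ^ t * maxCoeff (tilt P x ^ t) := by
        have := coeff_le_maxCoeff hTt (k + 1 - i)
        rw [coeff_tilt_pow, div_le_iff₀ (pow_pos hPx t)] at this
        linarith
      calc Q.coeff i * (P ^ t).coeff (k + 1 - i) * x ^ (k + 1)
          = ((P ^ t).coeff (k + 1 - i) * x ^ (k + 1 - i)) * (Q.coeff i * x ^ i) := by
            rw [show x ^ (k + 1) = x ^ (k + 1 - i) * x ^ i by
              rw [← pow_add, Nat.sub_add_cancel hik]]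
            ring
        _ ≤ _ := mul_le_mul_of_nonneg_right h2 (mul_nonneg (hQ i) (pow_nonneg hx0.le i))
    refine le_of_mul_le_mul_right (hle.trans ?_) (pow_pos hx0 (k + 1))
    calc P.eval x ^ t * maxCoeff (tilt P x ^ t) * Q.eval x
        ≤ P.eval x ^ t * maxCoeff (tilt P x ^ t) * (P.eval x ^ s * Real.exp (-c * s)) :=
          mul_le_mul_of_nonneg_left (hgap x hxl) (mul_nonneg (pow_nonneg hPx.le _) hμ0)
      _ = P.eval x ^ (t + s) * (Real.exp (-c * s) * maxCoeff (tilt P x ^ t)) := by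
          rw [pow_add]; ring
      _ ≤ P.eval x ^ (t + s) * (A.coeff (k + 1) * x ^ (k + 1) / P.eval x ^ (t + s)) :=
          mul_le_mul_of_nonneg_left (h1.trans hmax) (pow_nonneg hPx.le _)
      _ = _ := mul_div_cancel₀ _ (pow_pos hPx _).ne'
  -- Beyond the degree of P^(t+s) the left coefficient must vanish: otherwise P^t * Q would grow at
  -- least like x^k, while it is at most P(x)^(t+s), of lower degree.
  · refine le_trans ?_ (hPt _ k)
    by_contra! hpos
    have hbound : ∀ x ≥ max (ε / K) 1, (P ^ t * Q).coeff k * x ≤ P.eval 1 ^ (t + s) := by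
      intro x hx
      have hx1 : 1 ≤ x := (le_max_right _ _).trans hx
      have hx0 : 0 < x := by linarith
      have hPx := hP.eval_pos hx0.le
      have h1 := coeff_mul_pow_le_eval hnn hx0.le k
      have h2 : Q.eval x ≤ P.eval x ^ s := by
        refine (hgap x ((le_max_left _ _).trans hx)).trans ?_
        refine mul_le_of_le_one_right (pow_nonneg hPx.le _) (Real.exp_le_one_iff.mpr ?_)
        have : (0 : ℝ) ≤ s := Nat.cast_nonneg s
        nlinarith
      have h3 : P.eval x ≤ P.eval 1 * x ^ d := by
        rw [eval_eq_sum_range' (Nat.lt_succ_of_le hP.natDegree_le),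
          eval_eq_sum_range' (Nat.lt_succ_of_le hP.natDegree_le), sum_mul]
        refine sum_le_sum fun i hi => ?_
        rw [one_pow, mul_one]
        exact mul_le_mul_of_nonneg_left
          (pow_le_pow_right₀ hx1 (Nat.lt_succ_iff.mp (mem_range.mp hi))) (hP.coeff_nonneg i)
      have h4 : (P ^ t * Q).eval x ≤ P.eval 1 ^ (t + s) * x ^ (d * (t + s)) := by
        rw [eval_mul, eval_pow, pow_mul, ← mul_pow]
        calc P.eval x ^ t * Q.eval x ≤ P.eval x ^ t * P.eval x ^ s :=
              mul_le_mul_of_nonneg_left h2 (pow_nonneg hPx.le _)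
          _ = P.eval x ^ (t + s) := (pow_add _ _ _).symm
          _ ≤ _ := pow_le_pow_left₀ hPx.le h3 _
      refine le_of_mul_le_mul_right ?_ (pow_pos hx0 (d * (t + s)))
      refine le_trans ?_ (h1.trans h4)
      rw [mul_assoc, ← pow_succ']
      exact mul_le_mul_of_nonneg_left (pow_le_pow_right₀ hx1 hkd) hpos.le
    have h5 := hbound (max (max (ε / K) 1) ((P.eval 1 ^ (t + s) + 1) / (P ^ t * Q).coeff k))
      (le_max_left _ _)
    have h6 := mul_le_mul_of_nonneg_left (le_max_right (max (ε / K) 1)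
      ((P.eval 1 ^ (t + s) + 1) / (P ^ t * Q).coeff k)) hpos.le
    rw [mul_div_cancel₀ _ hpos.ne'] at h6
    linarith

end RegularSlices

/-! ### Integrating logarithmic derivatives; generating polynomials and finite energy. -/

namespace RegularSlices

/-- The function log Q - s log P vanishes at 0, never increases, and has slope at most -cs on [a,
b]. The drop acquired there persists for all larger x. -/
lemma eval_le_of_derivative_le {P Q : ℝ[X]} {s : ℕ} {a b c : ℝ} (ha : 0 < a) (hab : a ≤ b)
    (hP : ∀ x, 0 ≤ x → 0 < P.eval x) (hQ : ∀ x, 0 ≤ x → 0 < Q.eval x)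
    (hP0 : P.eval 0 = 1) (hQ0 : Q.eval 0 = 1)
    (h1 : ∀ x, 0 < x → Q.derivative.eval x * P.eval x ≤ s * P.derivative.eval x * Q.eval x)
    (h2 : ∀ x, a ≤ x → x ≤ b → Q.derivative.eval x * P.eval x + c * s * (Q.eval x * P.eval x) ≤
      s * P.derivative.eval x * Q.eval x) :
    ∀ x ≥ b, Q.eval x ≤ P.eval x ^ s * Real.exp (-(c * (b - a)) * s) := by
  set φ : ℝ → ℝ := fun x => Real.log (Q.eval x) - s * Real.log (P.eval x) with hφ
  have hφd : ∀ x, 0 ≤ x → HasDerivAt φ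
      (Q.derivative.eval x / Q.eval x - s * (P.derivative.eval x / P.eval x)) x := fun x hx =>
    ((Q.hasDerivAt x).log (hQ x hx).ne').sub (((P.hasDerivAt x).log (hP x hx).ne').const_mul _)
  have hanti : AntitoneOn φ (Set.Ici 0) := by
    refine antitoneOn_of_deriv_nonpos (convex_Ici 0)
      (fun x hx => (hφd x hx).continuousAt.continuousWithinAt)
      (fun x hx => (hφd x (interior_subset hx)).differentiableAt.differentiableWithinAt) ?_
    intro x hx
    rw [interior_Ici, Set.mem_Ioi] at hx
    rw [(hφd x hx.le).deriv, sub_nonpos, ← mul_div_assoc, div_le_div_iff₀ (hQ x hx.le) (hP x hx.le)]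
    exact h1 x hx
  have hanti2 : AntitoneOn (fun x => φ x + c * s * x) (Set.Icc a b) := by
    have hd : ∀ x, 0 ≤ x → HasDerivAt (fun x => φ x + c * s * x)
        (Q.derivative.eval x / Q.eval x - s * (P.derivative.eval x / P.eval x) + c * s * 1) x :=
      fun x hx => (hφd x hx).add ((hasDerivAt_id x).const_mul _)
    refine antitoneOn_of_deriv_nonpos (convex_Icc a b)
      (fun x hx => (hd x (ha.le.trans hx.1)).continuousAt.continuousWithinAt)
      (fun x hx => (hd x (ha.le.trans
        (interior_subset hx).1)).differentiableAt.differentiableWithinAt) ?_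
    intro x hx
    have hx' := interior_subset hx
    have hx0 : 0 ≤ x := ha.le.trans hx'.1
    have hQx := hQ x hx0
    have hPx := hP x hx0
    rw [(hd x hx0).deriv]
    have h3 := h2 x hx'.1 hx'.2
    have h4 : Q.derivative.eval x / Q.eval x - s * (P.derivative.eval x / P.eval x) + c * s * 1 =
        (Q.derivative.eval x * P.eval x + c * s * (Q.eval x * P.eval x) -
          s * P.derivative.eval x * Q.eval x) / (Q.eval x * P.eval x) := by
      field_simp
      ring
    rw [h4]
    exact div_nonpos_of_nonpos_of_nonneg (by linarith) (mul_pos hQx hPx).le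
  intro x hx
  have hb0 : 0 ≤ b := ha.le.trans hab
  have hx0 : 0 ≤ x := hb0.trans hx
  have e1 := hanti (Set.mem_Ici.mpr hb0) (Set.mem_Ici.mpr hx0) hx
  have e2 := hanti2 (Set.left_mem_Icc.mpr hab) (Set.right_mem_Icc.mpr hab) hab
  have e3 := hanti (Set.mem_Ici.mpr le_rfl) (Set.mem_Ici.mpr ha.le) ha.le
  have e4 : φ 0 = 0 := by simp [hφ, hP0, hQ0]
  have e5 : Real.log (Q.eval x) ≤ s * Real.log (P.eval x) + -(c * (b - a)) * s := by
    simp only [hφ] at *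
    linarith
  rw [← Real.log_pow] at e5
  calc Q.eval x = Real.exp (Real.log (Q.eval x)) := (Real.exp_log (hQ x hx0)).symm
    _ ≤ Real.exp (Real.log (P.eval x ^ s) + -(c * (b - a)) * s) := Real.exp_le_exp.mpr e5
    _ = _ := by rw [Real.exp_add, Real.exp_log (pow_pos (hP x hx0) s)]

section GenPoly

variable {E : Type*}

/-- The generating polynomial of a family of finite sets by size. -/
noncomputable def genPoly (F : Finset (Finset E)) : ℝ[X] := ∑ I ∈ F, X ^ #I

lemma eval_genPoly (F : Finset (Finset E)) (x : ℝ) : (genPoly F).eval x = ∑ I ∈ F, x ^ #I := by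
  simp [genPoly, eval_finsetSum]

lemma mul_eval_derivative_genPoly (F : Finset (Finset E)) (x : ℝ) :
    x * (genPoly F).derivative.eval x = ∑ I ∈ F, #I * x ^ #I := by
  simp only [genPoly, derivative_sum, eval_finsetSum, mul_sum]
  refine sum_congr rfl fun I _ => ?_
  rcases Nat.eq_zero_or_pos #I with h | h
  · simp [h]
  · obtain ⟨n, hn⟩ : ∃ n, #I = n + 1 := ⟨#I - 1, by omega⟩
    rw [hn]
    simp
    ring

lemma coeff_genPoly (F : Finset (Finset E)) (k : ℕ) :
    (genPoly F).coeff k = #{I ∈ F | #I = k} := by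
  simp only [genPoly, finsetSum_coeff, coeff_X_pow]
  rw [sum_boole]
  simp [eq_comm]

lemma coeff_genPoly_nonneg (F : Finset (Finset E)) (k : ℕ) : 0 ≤ (genPoly F).coeff k := by
  rw [coeff_genPoly]; positivity

/-- Finite energy: rewriting the members of a family on a bounded set costs a bounded factor. -/
lemma sum_pow_card_le_of_modify [DecidableEq E] {𝓐 𝓑 : Finset (Finset E)} {B E₀ : Finset E}
    (hE : E₀ ⊆ B) (h : ∀ M ∈ 𝓐, (M \ B) ∪ E₀ ∈ 𝓑) {a b x : ℝ} (ha : 0 < a) (ha1 : a ≤ 1)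
    (hb : 1 ≤ b) (hax : a ≤ x) (hxb : x ≤ b) {K : ℕ} (hK : #B ≤ K) :
    ∑ M ∈ 𝓐, x ^ #M ≤ (2 * b / a) ^ K * ∑ J ∈ 𝓑, x ^ #J := by
  have hx : 0 < x := ha.trans_le hax
  have hb0 : 0 < b := one_pos.trans_le hb
  rw [← sum_fiberwise_of_maps_to h, mul_sum]
  refine sum_le_sum fun J _ => ?_
  -- On a fibre the part outside B is determined by J, so only the trace on B is free.
  have hcard : #{M ∈ 𝓐 | M \ B ∪ E₀ = J} ≤ 2 ^ K := by
    refine le_trans ?_ (Nat.pow_le_pow_right two_pos hK)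
    rw [← card_powerset]
    refine card_le_card_of_injOn (fun M => M ∩ B)
      (fun M _ => mem_coe.mpr (mem_powerset.mpr inter_subset_right)) ?_
    intro M hM M' hM' hMM
    simp only [coe_filter, Set.mem_ofPred_eq] at hM hM'
    have h1 : M \ B = M' \ B := by
      have hd : ∀ N : Finset E, (N \ B ∪ E₀) \ B = N \ B := by
        intro N; ext e
        simp only [mem_sdiff, mem_union]
        have := @hE e
        tauto
      rw [← hd M, ← hd M', hM.2, hM'.2]
    have hMM : M ∩ B = M' ∩ B := hMM
    rw [← sdiff_union_inter M B, ← sdiff_union_inter M' B, h1, hMM]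
  have hterm : ∀ M ∈ ({M ∈ 𝓐 | M \ B ∪ E₀ = J} : Finset (Finset E)),
      x ^ #M ≤ (b / a) ^ K * x ^ #J := by
    intro M hM
    have hMJ := (mem_filter.mp hM).2
    have hdis : Disjoint (M \ B) E₀ := disjoint_of_subset_right hE sdiff_disjoint
    have hJ : #J = #(M \ B) + #E₀ := by rw [← hMJ, card_union_of_disjoint hdis]
    have hM' : #M = #(M \ B) + #(M ∩ B) := (card_sdiff_add_card_inter M B).symm
    have p1 : x ^ #(M ∩ B) ≤ b ^ K :=
      (pow_le_pow_left₀ hx.le hxb _).trans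
        (pow_le_pow_right₀ hb ((card_le_card inter_subset_right).trans hK))
    have p2 : a ^ K ≤ x ^ #E₀ :=
      (pow_le_pow_of_le_one ha.le ha1 ((card_le_card hE).trans hK)).trans
        (pow_le_pow_left₀ ha.le hax _)
    rw [hJ, hM', pow_add, pow_add, div_pow, div_mul_eq_mul_div, le_div_iff₀ (pow_pos ha K)]
    have p3 := pow_pos hx #(M \ B)
    calc x ^ #(M \ B) * x ^ #(M ∩ B) * a ^ K ≤ x ^ #(M \ B) * b ^ K * x ^ #E₀ := by gcongr
      _ = _ := by ring
  calc ∑ M ∈ 𝓐 with M \ B ∪ E₀ = J, x ^ #M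
      ≤ #{M ∈ 𝓐 | M \ B ∪ E₀ = J} • ((b / a) ^ K * x ^ #J) := sum_le_card_nsmul _ _ _ hterm
    _ ≤ (2 : ℝ) ^ K * ((b / a) ^ K * x ^ #J) := by
        rw [nsmul_eq_mul]
        refine mul_le_mul_of_nonneg_right (by exact_mod_cast hcard) (by positivity)
    _ = _ := by rw [← mul_assoc, ← mul_pow, mul_div_assoc]

end GenPoly

end RegularSlices

/-! ### Local views for independent sets. -/

namespace RegularSlices

variable {V : Type*}

open Classical in
/-- The independent sets of `G` contained in `S`. -/
noncomputable def indFam (G : SimpleGraph V) (S : Finset V) : Finset (Finset V) :=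
  {I ∈ S.powerset | ∀ u ∈ I, ∀ w ∈ I, ¬ G.Adj u w}

lemma mem_indFam {G : SimpleGraph V} {S I : Finset V} :
    I ∈ indFam G S ↔ I ⊆ S ∧ ∀ u ∈ I, ∀ w ∈ I, ¬ G.Adj u w := by
  simp [indFam]

lemma empty_mem_indFam (G : SimpleGraph V) (S : Finset V) : ∅ ∈ indFam G S := by
  simp [mem_indFam]

section Local

/-- Symmetrised Chebyshev inequality for a nonincreasing sequence `g` on `{1, …, d}`. -/
lemma chebyshev_le_sum {d : ℕ} (hd : 1 ≤ d) {w g : ℕ → ℝ} (hw : ∀ k, 0 ≤ w k)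
    (hg : ∀ k l, 1 ≤ k → k ≤ l → l ≤ d → g l ≤ g k) :
    w 1 * w d * (g 1 - g d) * (d - 1) ≤
      ∑ k ∈ Icc 1 d, g k * w k * (∑ l ∈ Icc 1 d, l * w l - (∑ l ∈ Icc 1 d, w l) * k) := by
  set F : ℕ → ℕ → ℝ := fun k l => w k * w l * (g k - g l) * (l - k) with hF
  have hFnn : ∀ k ∈ Icc 1 d, ∀ l ∈ Icc 1 d, 0 ≤ F k l := by
    intro k hk l hl
    rw [mem_Icc] at hk hl
    simp only [hF, mul_assoc]
    refine mul_nonneg (hw k) (mul_nonneg (hw l) ?_)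
    rcases le_total k l with h | h
    · have := hg k l hk.1 h hl.2
      have h' : (k : ℝ) ≤ l := by exact_mod_cast h
      exact mul_nonneg (by linarith) (by linarith)
    · have := hg l k hl.1 h hk.2
      have h' : (l : ℝ) ≤ k := by exact_mod_cast h
      exact mul_nonneg_of_nonpos_of_nonpos (by linarith) (by linarith)
  have e1 : ∑ k ∈ Icc 1 d, g k * w k * (∑ l ∈ Icc 1 d, l * w l - (∑ l ∈ Icc 1 d, w l) * k) =
      ∑ k ∈ Icc 1 d, ∑ l ∈ Icc 1 d, g k * w k * w l * (l - k) := by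
    refine sum_congr rfl fun k _ => ?_
    rw [sum_mul, ← sum_sub_distrib, mul_sum]
    exact sum_congr rfl fun l _ => by ring
  have e2 : ∑ k ∈ Icc 1 d, ∑ l ∈ Icc 1 d, F k l =
      2 * ∑ k ∈ Icc 1 d, ∑ l ∈ Icc 1 d, g k * w k * w l * (l - k) := by
    rw [two_mul]
    nth_rewrite 3 [sum_comm]
    rw [← sum_add_distrib]
    refine sum_congr rfl fun k _ => ?_
    rw [← sum_add_distrib]
    exact sum_congr rfl fun l _ => by simp only [hF]; ring
  rw [e1]
  rcases hd.eq_or_lt with rfl | hd'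
  · have := sum_nonneg fun k hk => sum_nonneg fun l hl => hFnn k hk l hl
    rw [e2] at this
    simp only [Nat.cast_one, sub_self, mul_zero]
    linarith
  have h1 : (1 : ℕ) ∈ Icc 1 d := by simp [hd]
  have h2 : d ∈ Icc 1 d := by simp [hd]
  -- All terms are nonnegative; the two extreme pairs are kept because they measure how far g is
  -- from constant.
  have e3 : F 1 d + F d 1 ≤ ∑ k ∈ Icc 1 d, ∑ l ∈ Icc 1 d, F k l := by
    calc F 1 d + F d 1 ≤ ∑ l ∈ Icc 1 d, F 1 l + ∑ l ∈ Icc 1 d, F d l :=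
          add_le_add (single_le_sum (f := F 1) (hFnn 1 h1) h2)
            (single_le_sum (f := F d) (hFnn d h2) h1)
      _ = ∑ k ∈ {1, d}, ∑ l ∈ Icc 1 d, F k l := by rw [sum_pair hd'.ne]
      _ ≤ _ := sum_le_sum_of_subset_of_nonneg (by
          intro k hk; rw [mem_insert, mem_singleton] at hk
          rcases hk with rfl | rfl <;> assumption)
          fun k hk _ => sum_nonneg fun l hl => hFnn k hk l hl
  simp only [hF, Nat.cast_one] at e2 e3
  linarith

/-- Local LYM inequality for the independent sets contained in `F`. -/
lemma card_indFam_succ_mul_le (G : SimpleGraph V) (F : Finset V) (k : ℕ) :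
    #{T ∈ indFam G F | #T = k + 1} * (k + 1) ≤ #{T ∈ indFam G F | #T = k} * (#F - k) := by
  classical
  refine card_mul_le_card_mul (fun T' T => T ⊆ T') (fun T' hT' => ?_) (fun T hT => ?_)
  · obtain ⟨hT', hc⟩ := mem_filter.mp hT'
    rw [mem_indFam] at hT'
    rw [← hc]
    refine card_le_card_of_injOn (fun w => T'.erase w) (fun w hw => ?_) ?_
    · rw [mem_coe, mem_bipartiteAbove, mem_filter, mem_indFam]
      have hw : w ∈ T' := hw
      refine ⟨⟨⟨(erase_subset _ _).trans hT'.1, fun u hu v hv =>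
        hT'.2 u (mem_of_mem_erase hu) v (mem_of_mem_erase hv)⟩, ?_⟩, erase_subset _ _⟩
      rw [card_erase_of_mem hw]; omega
    · intro w hw w' hw' h
      exact erase_injOn T' hw hw' h
  · obtain ⟨hT, hc⟩ := mem_filter.mp hT
    rw [mem_indFam] at hT
    rw [← hc, ← card_sdiff_of_subset hT.1]
    refine (card_le_card (t := (F \ T).image fun w => insert w T) fun T' hT' => ?_).trans
      card_image_le
    rw [mem_bipartiteBelow, mem_filter, mem_indFam] at hT'
    obtain ⟨⟨hI, hc'⟩, hs⟩ := hT'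
    obtain ⟨w, hw, rfl⟩ : ∃ w, w ∉ T ∧ insert w T = T' :=
      exists_eq_insert_iff.mpr ⟨hs, by omega⟩ |>.imp fun w h => h
    exact mem_image.mpr ⟨w, mem_sdiff.mpr ⟨hI.1 (mem_insert_self _ _), hw⟩, rfl⟩

lemma sum_Icc_one_eq_sum_range (f : ℕ → ℝ) (d : ℕ) :
    ∑ k ∈ Icc 1 d, f k = ∑ k ∈ range d, f (k + 1) := by
  rw [range_eq_Ico, sum_Ico_add' f 0 d 1]
  refine sum_congr ?_ fun _ _ => rfl
  ext k; simp only [mem_Icc, mem_Ico]; omega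

lemma sum_Icc_choose_mul_pow (d : ℕ) (x : ℝ) :
    ∑ k ∈ Icc 1 d, (d.choose k : ℝ) * x ^ k = (1 + x) ^ d - 1 := by
  rw [add_comm 1 x, add_pow, sum_range_succ', sum_Icc_one_eq_sum_range]
  simp [mul_comm]

lemma sum_Icc_mul_choose_mul_pow (d : ℕ) (x : ℝ) :
    ∑ k ∈ Icc 1 d, (k : ℝ) * ((d.choose k : ℝ) * x ^ k) = d * x * (1 + x) ^ (d - 1) := by
  rcases d with _ | d
  · simp
  rw [add_comm 1 x, Nat.add_sub_cancel, add_pow, sum_Icc_one_eq_sum_range, mul_sum]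
  refine sum_congr rfl fun k _ => ?_
  have h : ((d + 1 : ℕ) : ℝ) * d.choose k = (d + 1).choose (k + 1) * (k + 1 : ℕ) := by
    exact_mod_cast Nat.add_one_mul_choose_eq d k
  rw [one_pow, mul_one, pow_succ]
  calc ((k + 1 : ℕ) : ℝ) * (((d + 1).choose (k + 1) : ℝ) * (x ^ k * x))
      = ((d + 1).choose (k + 1) * (k + 1 : ℕ)) * (x ^ k * x) := by ring
    _ = _ := by rw [← h]; ring

/-- The dual inequality for the local view `F` of a vertex. -/
lemma local_view_ind {d : ℕ} (hd : 1 ≤ d) (G : SimpleGraph V) {F : Finset V} (hF : #F ≤ d)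
    {x : ℝ} (hx : 0 < x) :
    x ^ (d + 1) * (d - 1) * (#F - d * #{T ∈ indFam G F | #T = d}) ≤
      ∑ T ∈ indFam G F, x ^ #T * (d * x * (1 + x) ^ (d - 1) - ((1 + x) ^ d - 1) * #T) -
        d * x * (1 + x) ^ (d - 1) := by
  classical
  set Θ := d * x * (1 + x) ^ (d - 1) with hΘ
  set W := (1 + x) ^ d - 1 with hW
  set f : ℕ → ℕ := fun k => #{T ∈ indFam G F | #T = k} with hf
  have hf0 : f 0 = 1 := by
    have : ({T ∈ indFam G F | #T = 0} : Finset (Finset V)) = {∅} := by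
      ext T
      simp only [mem_filter, card_eq_zero, mem_singleton]
      exact ⟨fun h => h.2, fun h => ⟨h ▸ empty_mem_indFam G F, h⟩⟩
    simp only [hf, this, card_singleton]
  have hf1 : f 1 = #F := by
    have : ({T ∈ indFam G F | #T = 1} : Finset (Finset V)) = F.map ⟨_, singleton_injective⟩ := by
      ext T
      simp only [mem_filter, mem_map, Function.Embedding.coeFn_mk, mem_indFam, card_eq_one]
      constructor
      · rintro ⟨h, u, rfl⟩
        exact ⟨u, singleton_subset_iff.mp h.1, rfl⟩
      · rintro ⟨u, hu, rfl⟩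
        refine ⟨⟨singleton_subset_iff.mpr hu, ?_⟩, u, rfl⟩
        simp
    simp only [hf, this, card_map]
  have e1 : ∑ T ∈ indFam G F, x ^ #T * (Θ - W * #T) - Θ =
      ∑ k ∈ Icc 1 d, f k * x ^ k * (Θ - W * k) := by
    have hmaps : ∀ T ∈ indFam G F, #T ∈ range (d + 1) := fun T hT =>
      mem_range.mpr (Nat.lt_succ_of_le ((card_le_card (mem_indFam.mp hT).1).trans hF))
    have hfib : ∀ k ∈ range (d + 1),
        ∑ T ∈ indFam G F with #T = k, x ^ #T * (Θ - W * #T) = f k * (x ^ k * (Θ - W * k)) := by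
      intro k _
      rw [sum_congr rfl (g := fun _ => x ^ k * (Θ - W * k)) fun T hT => by
        rw [(mem_filter.mp hT).2]]
      rw [sum_const, nsmul_eq_mul]
    rw [← sum_fiberwise_of_maps_to hmaps, sum_congr rfl hfib, sum_range_succ',
      sum_Icc_one_eq_sum_range, hf0]
    simp [mul_assoc]
  -- Local LYM, normalised by binomials of d rather than of #F, which is legitimate because #F ≤ d.
  have hmono : ∀ k l, 1 ≤ k → k ≤ l → l ≤ d →
      (f l : ℝ) / d.choose l ≤ (f k : ℝ) / d.choose k := by
    intro k l _ hkl
    induction l, hkl using Nat.le_induction with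
    | base => intro _; exact le_rfl
    | succ l hl ih =>
      intro hld
      refine le_trans ?_ (ih (by omega))
      have c1 : (0 : ℝ) < d.choose l := by exact_mod_cast Nat.choose_pos (by omega)
      have c2 : (0 : ℝ) < d.choose (l + 1) := by exact_mod_cast Nat.choose_pos hld
      rw [div_le_div_iff₀ c2 c1]
      have h1 : f (l + 1) * (l + 1) ≤ f l * (d - l) :=
        (card_indFam_succ_mul_le G F l).trans (Nat.mul_le_mul_left _ (by omega))
      have h2 := Nat.choose_succ_right_eq d l
      have h3 : f (l + 1) * d.choose l * (l + 1) ≤ f l * d.choose (l + 1) * (l + 1) := by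
        calc f (l + 1) * d.choose l * (l + 1) = f (l + 1) * (l + 1) * d.choose l := by ring
          _ ≤ f l * (d - l) * d.choose l := Nat.mul_le_mul_right _ h1
          _ = f l * (d.choose l * (d - l)) := by ring
          _ = _ := by rw [← h2]; ring
      exact_mod_cast Nat.le_of_mul_le_mul_right h3 (Nat.succ_pos l)
  -- With these weights Σ w = W and Σ k w = Θ, so the right side of Chebyshev is exactly the slack.
  have key := chebyshev_le_sum hd (w := fun k => d.choose k * x ^ k)
    (g := fun k => (f k : ℝ) / d.choose k) (fun k => by positivity) hmono
  rw [sum_Icc_choose_mul_pow, sum_Icc_mul_choose_mul_pow, ← hW, ← hΘ] at key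
  rw [e1]
  have e2 : ∑ k ∈ Icc 1 d, (f k : ℝ) * x ^ k * (Θ - W * k) =
      ∑ k ∈ Icc 1 d, (f k : ℝ) / d.choose k * (d.choose k * x ^ k) * (Θ - W * k) := by
    refine sum_congr rfl fun k hk => ?_
    have c1 : (0 : ℝ) < d.choose k := by exact_mod_cast Nat.choose_pos (mem_Icc.mp hk).2
    rw [← mul_assoc, div_mul_cancel₀ _ c1.ne']
  rw [e2]
  refine le_trans (le_of_eq ?_) key
  have hd0 : (d : ℝ) ≠ 0 := by positivity
  simp only [Nat.choose_one_right, Nat.choose_self, hf1, Nat.cast_one, div_one]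
  simp only [hf]
  field_simp
  ring

/-- A local view is trivial if it is empty or consists of `d` pairwise non-adjacent vertices. -/
lemma card_indFam_eq_of_card_eq {d : ℕ} (G : SimpleGraph V) {F : Finset V} (hF : #F ≤ d)
    (h : #{T ∈ indFam G F | #T = d} ≠ 0) :
    #{T ∈ indFam G F | #T = d} = 1 ∧ #F = d ∧ F ∈ indFam G F := by
  classical
  have hT : ∀ T ∈ ({T ∈ indFam G F | #T = d} : Finset (Finset V)), T = F := by
    intro T hT
    obtain ⟨h1, h2⟩ := mem_filter.mp hT
    exact eq_of_subset_of_card_le (mem_indFam.mp h1).1 (by omega)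
  obtain ⟨T, hT'⟩ := card_ne_zero.mp h
  obtain rfl := hT T hT'
  obtain ⟨h1, h2⟩ := mem_filter.mp hT'
  refine ⟨card_eq_one.mpr ⟨T, ?_⟩, h2, h1⟩
  ext T'
  rw [mem_singleton]
  exact ⟨hT T', fun h => h ▸ hT'⟩

lemma local_view_ind_nonneg {d : ℕ} (hd : 1 ≤ d) (G : SimpleGraph V) {F : Finset V} (hF : #F ≤ d)
    {x : ℝ} (hx : 0 < x) :
    0 ≤ ∑ T ∈ indFam G F, x ^ #T * (d * x * (1 + x) ^ (d - 1) - ((1 + x) ^ d - 1) * #T) -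
        d * x * (1 + x) ^ (d - 1) := by
  refine le_trans ?_ (local_view_ind hd G hF hx)
  have hd' : (1 : ℝ) ≤ d := by exact_mod_cast hd
  refine mul_nonneg (mul_nonneg (by positivity) (by linarith)) ?_
  by_cases h : #{T ∈ indFam G F | #T = d} = 0
  · rw [h]; simp
  · obtain ⟨h1, h2, -⟩ := card_indFam_eq_of_card_eq G hF h
    rw [h1, h2]; simp

lemma local_view_ind_slack {d : ℕ} (hd : 1 ≤ d) (G : SimpleGraph V) {F : Finset V} (hF : #F ≤ d)
    {x : ℝ} (hx : 0 < x) (hne : F.Nonempty) (hnt : ¬ (#F = d ∧ F ∈ indFam G F)) :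
    x ^ (d + 1) * (d - 1) ≤
      ∑ T ∈ indFam G F, x ^ #T * (d * x * (1 + x) ^ (d - 1) - ((1 + x) ^ d - 1) * #T) -
        d * x * (1 + x) ^ (d - 1) := by
  refine le_trans ?_ (local_view_ind hd G hF hx)
  have hd' : (1 : ℝ) ≤ d := by exact_mod_cast hd
  refine le_mul_of_one_le_right (mul_nonneg (by positivity) (by linarith)) ?_
  have h : #{T ∈ indFam G F | #T = d} = 0 := by
    by_contra h
    exact hnt (card_indFam_eq_of_card_eq G hF h).2
  rw [h]
  have : (1 : ℝ) ≤ #F := by exact_mod_cast hne.card_pos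
  simpa using this

end Local

end RegularSlices

/-! ### The occupancy inequality and its stability for independent sets. -/

namespace RegularSlices

variable {V : Type*}

/-- A set of vertices that no edge leaves. -/
def Closed (G : SimpleGraph V) (S : Finset V) : Prop := ∀ v ∈ S, ∀ w, G.Adj v w → w ∈ S

/-- All neighbours of `v` have the same neighbourhood. In a `d`-regular graph this says that the
component of `v` is a copy of `K_{d,d}`. -/
def InKdd (G : SimpleGraph V) (v : V) : Prop :=
  ∀ w w', G.Adj v w → G.Adj v w' → ∀ u, G.Adj w u → G.Adj w' u

/-- The independence polynomial of `K_{d,d}`. -/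
noncomputable def indPoly (d : ℕ) : ℝ[X] := 2 * (1 + X) ^ d - 1

lemma eval_indPoly (d : ℕ) (x : ℝ) : (indPoly d).eval x = 2 * (1 + x) ^ d - 1 := by
  simp [indPoly]

lemma eval_derivative_indPoly (d : ℕ) (x : ℝ) :
    (indPoly d).derivative.eval x = 2 * d * (1 + x) ^ (d - 1) := by
  simp [indPoly, derivative_pow]
  ring

variable [Fintype V] [DecidableEq V] {G : SimpleGraph V} [DecidableRel G.Adj]

/-- The neighbours of `v` without neighbours in `J`. -/
def uncov (G : SimpleGraph V) [DecidableRel G.Adj] (v : V) (J : Finset V) : Finset V :=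
  {w ∈ G.neighborFinset v | ∀ y ∈ J, ¬ G.Adj w y}

lemma mem_uncov {v w : V} {J : Finset V} :
    w ∈ uncov G v J ↔ G.Adj v w ∧ ∀ y ∈ J, ¬ G.Adj w y := by
  simp [uncov]

/-- Spatial Markov property: condition on the trace J of I outside the closed neighbourhood of v.
Either v is added to J, or any independent subset of the neighbours left unblocked by J is. -/
lemma sum_indFam_eq {S : Finset V} (hS : Closed G S) {v : V} (hv : v ∈ S) (f : Finset V → ℝ) :
    ∑ I ∈ indFam G S, f I = ∑ J ∈ indFam G (S \ insert v (G.neighborFinset v)),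
      (f (insert v J) + ∑ T ∈ indFam G (uncov G v J), f (J ∪ T)) := by
  rw [← sum_filter_add_sum_filter_not _ (fun I => v ∈ I), sum_add_distrib]
  congr 1
  · refine sum_bij' (fun I _ => I.erase v) (fun J _ => insert v J) ?_ ?_ ?_ ?_ ?_
    · intro I hI
      obtain ⟨hI, hvI⟩ := mem_filter.mp hI
      rw [mem_indFam] at hI ⊢
      refine ⟨fun w hw => ?_, fun u hu w hw => hI.2 u (mem_of_mem_erase hu) w
        (mem_of_mem_erase hw)⟩
      obtain ⟨hwv, hwI⟩ := mem_erase.mp hw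
      simp only [mem_sdiff, mem_insert, SimpleGraph.mem_neighborFinset, not_or]
      exact ⟨hI.1 hwI, hwv, hI.2 v hvI w hwI⟩
    · intro J hJ
      rw [mem_indFam] at hJ
      have hJ' : ∀ w ∈ J, ¬ G.Adj v w := fun w hw => by
        have := hJ.1 hw
        simp only [mem_sdiff, mem_insert, SimpleGraph.mem_neighborFinset, not_or] at this
        exact this.2.2
      rw [mem_filter, mem_indFam]
      refine ⟨⟨insert_subset hv (hJ.1.trans sdiff_subset), ?_⟩, mem_insert_self _ _⟩
      intro u hu w hw
      rcases mem_insert.mp hu with hu | hu <;> rcases mem_insert.mp hw with hw | hw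
      · rw [hu, hw]; exact G.irrefl
      · rw [hu]; exact hJ' w hw
      · rw [hw]; exact fun h => hJ' u hu h.symm
      · exact hJ.2 u hu w hw
    · intro I hI
      exact insert_erase (mem_filter.mp hI).2
    · intro J hJ
      refine erase_insert fun h => ?_
      have := (mem_indFam.mp hJ).1 h
      simp at this
    · intro I hI
      rw [insert_erase (mem_filter.mp hI).2]
  · rw [sum_sigma']
    refine sum_bij' (fun I _ => (⟨I \ G.neighborFinset v, I ∩ G.neighborFinset v⟩ :
      (_ : Finset V) × Finset V)) (fun p _ => p.1 ∪ p.2) ?_ ?_ ?_ ?_ ?_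
    · intro I hI
      obtain ⟨hI, hvI⟩ := mem_filter.mp hI
      rw [mem_indFam] at hI
      rw [mem_sigma, mem_indFam, mem_indFam]
      refine ⟨⟨fun w hw => ?_, fun u hu w hw => hI.2 u (mem_sdiff.mp hu).1 w (mem_sdiff.mp hw).1⟩,
        fun w hw => ?_, fun u hu w hw => hI.2 u (mem_inter.mp hu).1 w (mem_inter.mp hw).1⟩
      · obtain ⟨h1, h2⟩ := mem_sdiff.mp hw
        rw [mem_sdiff, mem_insert]
        refine ⟨hI.1 h1, ?_⟩
        rintro (rfl | h)
        · exact hvI h1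
        · exact h2 h
      · obtain ⟨h1, h2⟩ := mem_inter.mp hw
        rw [SimpleGraph.mem_neighborFinset] at h2
        exact mem_uncov.mpr ⟨h2, fun y hy => hI.2 w h1 y (mem_sdiff.mp hy).1⟩
    · rintro ⟨J, T⟩ hp
      rw [mem_sigma, mem_indFam, mem_indFam] at hp
      obtain ⟨⟨hJ1, hJ2⟩, hT1, hT2⟩ := hp
      simp only at hJ1 hJ2 hT1 hT2 ⊢
      rw [mem_filter, mem_indFam]
      refine ⟨⟨union_subset (hJ1.trans sdiff_subset) fun w hw =>
        hS v hv w (mem_uncov.mp (hT1 hw)).1, ?_⟩, ?_⟩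
      · intro u hu w hw
        rcases mem_union.mp hu with hu | hu <;> rcases mem_union.mp hw with hw | hw
        · exact hJ2 u hu w hw
        · exact fun h => (mem_uncov.mp (hT1 hw)).2 u hu h.symm
        · exact (mem_uncov.mp (hT1 hu)).2 w hw
        · exact hT2 u hu w hw
      · rw [mem_union]
        rintro (h | h)
        · have := hJ1 h
          simp at this
        · exact G.irrefl (mem_uncov.mp (hT1 h)).1
    · intro I _
      exact sdiff_union_inter I _
    · rintro ⟨J, T⟩ hp
      rw [mem_sigma, mem_indFam, mem_indFam] at hp
      obtain ⟨⟨hJ1, -⟩, hT1, -⟩ := hp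
      simp only at hJ1 hT1 ⊢
      have hJN : ∀ w ∈ J, w ∉ G.neighborFinset v := fun w hw h => by
        have := hJ1 hw
        rw [mem_sdiff, mem_insert] at this
        exact this.2 (Or.inr h)
      have hTN : ∀ w ∈ T, w ∈ G.neighborFinset v := fun w hw => by
        rw [SimpleGraph.mem_neighborFinset]
        exact (mem_uncov.mp (hT1 hw)).1
      have e1 : (J ∪ T) \ G.neighborFinset v = J := by
        ext w; rw [mem_sdiff, mem_union]
        have := hJN w; have := hTN w
        tauto
      have e2 : (J ∪ T) ∩ G.neighborFinset v = T := by
        ext w; rw [mem_inter, mem_union]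
        have := hJN w; have := hTN w
        tauto
      rw [e1, e2]
    · intro I _
      rw [sdiff_union_inter]

/-- The occupancy identity for independent sets: the defect in the occupancy inequality is the sum
of the slacks of the local views. -/
lemma ind_occupancy_identity {d : ℕ} (hreg : G.IsRegularOfDegree d) {S : Finset V}
    (hS : Closed G S) {x : ℝ} (hx : 0 < x) (hd : 1 ≤ d) :
    d * x * ((1 + x) ^ (d - 1) * #S * (genPoly (indFam G S)).eval x -
        (genPoly (indFam G S)).derivative.eval x * (indPoly d).eval x) =
      ∑ v ∈ S, ∑ J ∈ indFam G (S \ insert v (G.neighborFinset v)), x ^ #J *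
        (∑ T ∈ indFam G (uncov G v J),
          x ^ #T * (d * x * (1 + x) ^ (d - 1) - ((1 + x) ^ d - 1) * #T) -
            d * x * (1 + x) ^ (d - 1)) := by
  set Θ := d * x * (1 + x) ^ (d - 1) with hΘ
  set W := (1 + x) ^ d - 1 with hW
  -- The multiplier Θ + Θ/x is chosen so that the sets containing v contribute exactly -Θ x^#J.
  have hv : ∀ v ∈ S, ∑ J ∈ indFam G (S \ insert v (G.neighborFinset v)), x ^ #J *
        (∑ T ∈ indFam G (uncov G v J), x ^ #T * (Θ - W * #T) - Θ) =
      ∑ I ∈ indFam G S, x ^ #I *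
        (Θ - W * #(I ∩ G.neighborFinset v) - (Θ + Θ / x) * if v ∈ I then 1 else 0) := by
    intro v hv
    rw [sum_indFam_eq hS hv]
    refine sum_congr rfl fun J hJ => ?_
    have hJ1 := (mem_indFam.mp hJ).1
    have hJv : v ∉ J := fun h => by simpa using hJ1 h
    have hJN : Disjoint J (G.neighborFinset v) := disjoint_left.mpr fun w hw h => by
      have := hJ1 hw
      rw [mem_sdiff, mem_insert] at this
      exact this.2 (Or.inr h)
    have e1 : insert v J ∩ G.neighborFinset v = ∅ := by
      rw [insert_inter_of_notMem (by simp), disjoint_iff_inter_eq_empty.mp hJN]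
    rw [e1, card_insert_of_notMem hJv, if_pos (mem_insert_self _ _), mul_sub, mul_sum]
    have e2 : ∀ T ∈ indFam G (uncov G v J), x ^ #(J ∪ T) *
        (Θ - W * #((J ∪ T) ∩ G.neighborFinset v) - (Θ + Θ / x) * if v ∈ J ∪ T then 1 else 0) =
        x ^ #J * (x ^ #T * (Θ - W * #T)) := by
      intro T hT
      have hTN : T ⊆ G.neighborFinset v := fun w hw => by
        rw [SimpleGraph.mem_neighborFinset]
        exact (mem_uncov.mp ((mem_indFam.mp hT).1 hw)).1
      have hvT : v ∉ J ∪ T := by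
        rw [mem_union]
        rintro (h | h)
        · exact hJv h
        · simpa using hTN h
      rw [if_neg hvT, union_inter_distrib_right, disjoint_iff_inter_eq_empty.mp hJN,
        empty_union, inter_eq_left.mpr hTN, card_union_of_disjoint (disjoint_of_subset_right hTN hJN),
        pow_add]
      ring
    rw [sum_congr rfl e2]
    simp only [card_empty, Nat.cast_zero, mul_zero, sub_zero, mul_one, pow_succ]
    field_simp
    ring
  rw [sum_congr rfl hv, sum_comm]
  have hI : ∀ I ∈ indFam G S, ∑ v ∈ S, x ^ #I *
        (Θ - W * #(I ∩ G.neighborFinset v) - (Θ + Θ / x) * if v ∈ I then 1 else 0) =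
      Θ * #S * x ^ #I - (W * d + (Θ + Θ / x)) * (#I * x ^ #I) := by
    intro I hI
    have hIS := (mem_indFam.mp hI).1
    -- Double counting: each vertex of I is a neighbour of exactly d vertices, all in S because S is
    -- closed.
    have e1 : ∑ v ∈ S, (#(I ∩ G.neighborFinset v) : ℝ) = d * #I := by
      have : ∑ v ∈ S, #(I ∩ G.neighborFinset v) = ∑ w ∈ I, d := by
        have h1 : ∀ v ∈ S, #(I ∩ G.neighborFinset v) = ∑ w ∈ I, if G.Adj v w then 1 else 0 := by
          intro v _
          rw [sum_boole]
          simp only [Nat.cast_id]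
          congr 1
          ext w; simp
        rw [sum_congr rfl h1, sum_comm]
        refine sum_congr rfl fun w hw => ?_
        rw [sum_boole, ← hreg w, ← SimpleGraph.card_neighborFinset_eq_degree]
        simp only [Nat.cast_id]
        congr 1
        ext v
        simp only [mem_filter, SimpleGraph.mem_neighborFinset]
        exact ⟨fun h => h.2.symm, fun h => ⟨hS w (hIS hw) v h, h.symm⟩⟩
      rw [sum_const, smul_eq_mul] at this
      exact_mod_cast this.trans (mul_comm _ _)
    have e2 : ∑ v ∈ S, (if v ∈ I then (1 : ℝ) else 0) = #I := by
      rw [sum_boole]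
      congr 2
      ext v; rw [mem_filter]
      exact ⟨fun h => h.2, fun h => ⟨hIS h, h⟩⟩
    rw [← mul_sum, sum_sub_distrib, sum_sub_distrib, sum_const, nsmul_eq_mul, ← mul_sum,
      ← mul_sum, e1, e2]
    ring
  rw [sum_congr rfl hI, sum_sub_distrib, ← mul_sum, ← mul_sum, ← mul_eval_derivative_genPoly,
    ← eval_genPoly, eval_indPoly]
  -- The total multiplier collapses: Wd + Θ + Θ/x = d (2(1 + x)^d - 1), which is d times `indPoly d`
  -- at x.
  obtain ⟨e, rfl⟩ : ∃ e, d = e + 1 := ⟨d - 1, by omega⟩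
  rw [hΘ, hW, Nat.add_sub_cancel, pow_succ]
  field_simp
  ring

lemma genPoly_indFam_derivative_le {d : ℕ} (hd : 1 ≤ d) (hreg : G.IsRegularOfDegree d)
    {S : Finset V} (hS : Closed G S) {s : ℕ} (hs : #S = 2 * d * s) {x : ℝ} (hx : 0 < x) :
    (genPoly (indFam G S)).derivative.eval x * (indPoly d).eval x ≤
      s * (indPoly d).derivative.eval x * (genPoly (indFam G S)).eval x := by
  have h := ind_occupancy_identity hreg hS hx hd
  have h2 : 0 ≤ d * x * ((1 + x) ^ (d - 1) * #S * (genPoly (indFam G S)).eval x -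
        (genPoly (indFam G S)).derivative.eval x * (indPoly d).eval x) := by
    rw [h]
    refine sum_nonneg fun v _ => sum_nonneg fun J _ => mul_nonneg (by positivity) ?_
    refine local_view_ind_nonneg hd G ?_ hx
    rw [← hreg v, ← SimpleGraph.card_neighborFinset_eq_degree]
    exact card_le_card (filter_subset _ _)
  have h3 := nonneg_of_mul_nonneg_right h2 (by positivity)
  rw [eval_derivative_indPoly]
  rw [hs] at h3
  push_cast at h3
  linarith

lemma card_biUnion_neighborFinset_le {d : ℕ} (hreg : G.IsRegularOfDegree d) (A : Finset V) :
    #(A.biUnion fun w => G.neighborFinset w) ≤ #A * d :=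
  card_biUnion_le_card_mul _ _ _ fun w _ => by
    rw [SimpleGraph.card_neighborFinset_eq_degree, hreg w]

/-- If `v` is not in a copy of `K_{d,d}`, its local view is nontrivial with probability bounded
below. -/
lemma sum_nontrivial_view_ge {d : ℕ} (hreg : G.IsRegularOfDegree d) {S : Finset V}
    (hS : Closed G S) {v : V} (hv : v ∈ S) (hK : ¬ InKdd G v) {a b x : ℝ} (ha : 0 < a)
    (ha1 : a ≤ 1) (hb : 1 ≤ b) (hax : a ≤ x) (hxb : x ≤ b) :
    ∑ I ∈ indFam G S, x ^ #I ≤ (2 * b / a) ^ (d * d + 2 * d + 2) *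
      ∑ J ∈ indFam G (S \ insert v (G.neighborFinset v)) with ((uncov G v J).Nonempty ∧
        ¬ (#(uncov G v J) = d ∧ uncov G v J ∈ indFam G (uncov G v J))), x ^ #J := by
  unfold InKdd at hK
  push Not at hK
  obtain ⟨w, w', hw, hw', u, hwu, hw'u⟩ := hK
  have huv : u ≠ v := fun h => hw'u (h ▸ hw'.symm)
  have huS : u ∈ S := hS w (hS v hv w hw) u hwu
  -- Here w, w' are neighbours of v, and u is adjacent to w but not to w'. Clearing B frees all of
  -- N(v); if u is not adjacent to v, it is put back in order to block w.
  set B : Finset V := insert v (G.neighborFinset v) ∪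
    ((G.neighborFinset v).biUnion fun w => G.neighborFinset w) ∪ insert u (G.neighborFinset u)
    with hB
  set E₀ : Finset V := if G.Adj v u then ∅ else {u} with hE₀
  have hE₀u : ∀ y ∈ E₀, y = u ∧ ¬ G.Adj v u := by
    intro y hy
    rw [hE₀] at hy
    split_ifs at hy with h
    · simp at hy
    · exact ⟨mem_singleton.mp hy, h⟩
  have hBv : ∀ y, y ∉ B → y ≠ v ∧ ¬ G.Adj v y ∧ (∀ z, G.Adj v z → ¬ G.Adj z y) ∧ y ≠ u ∧
      ¬ G.Adj u y := by
    intro y hy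
    simp only [hB, mem_union, mem_insert, SimpleGraph.mem_neighborFinset, mem_biUnion, not_or,
      not_exists, not_and] at hy
    exact ⟨hy.1.1.1, hy.1.1.2, hy.1.2, hy.2.1, hy.2.2⟩
  refine sum_pow_card_le_of_modify (B := B) (E₀ := E₀) ?_ ?_ ha ha1 hb hax hxb ?_
  · intro y hy
    rw [(hE₀u y hy).1, hB]
    simp
  · intro I hI
    rw [mem_indFam] at hI
    set J := I \ B ∪ E₀ with hJ
    have hJm : ∀ y ∈ J, (y ∈ I ∧ y ∉ B) ∨ (y = u ∧ ¬ G.Adj v u) := by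
      intro y hy
      rcases mem_union.mp hy with h | h
      · exact Or.inl (mem_sdiff.mp h)
      · exact Or.inr (hE₀u y h)
    have hJw' : w' ∈ uncov G v J := by
      refine mem_uncov.mpr ⟨hw', fun y hy => ?_⟩
      rcases hJm y hy with h | h
      · exact (hBv y h.2).2.2.1 w' hw'
      · rw [h.1]; exact hw'u
    rw [mem_filter, mem_indFam]
    refine ⟨⟨fun y hy => ?_, fun y hy z hz => ?_⟩, ⟨w', hJw'⟩, ?_⟩
    · rw [mem_sdiff, mem_insert, SimpleGraph.mem_neighborFinset, not_or]
      rcases hJm y hy with h | h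
      · exact ⟨hI.1 h.1, (hBv y h.2).1, (hBv y h.2).2.1⟩
      · rw [h.1]; exact ⟨huS, huv, h.2⟩
    · rcases hJm y hy with h | h <;> rcases hJm z hz with h' | h'
      · exact hI.2 y h.1 z h'.1
      · rw [h'.1]; exact fun h3 => (hBv y h.2).2.2.2.2 h3.symm
      · rw [h.1]; exact (hBv z h'.2).2.2.2.2
      · rw [h.1, h'.1]; exact G.irrefl
    -- If v ~ u, the full view contains the edge wu and is not independent. If not, u blocks w, so
    -- the view has fewer than d vertices.
    · rintro ⟨hc, hind⟩
      have huncov : uncov G v J = G.neighborFinset v := by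
        refine eq_of_subset_of_card_le (filter_subset _ _) ?_
        rw [hc, SimpleGraph.card_neighborFinset_eq_degree, hreg v]
      have hwu' : w ∈ uncov G v J := by
        rw [huncov, SimpleGraph.mem_neighborFinset]; exact hw
      by_cases hvu : G.Adj v u
      · have huu' : u ∈ uncov G v J := by
          rw [huncov, SimpleGraph.mem_neighborFinset]; exact hvu
        exact (mem_indFam.mp hind).2 w hwu' u huu' hwu
      · have huJ : u ∈ J := by
          rw [hJ, mem_union, hE₀, if_neg hvu]; simp
        exact (mem_uncov.mp hwu').2 u huJ hwu
  · have hN : ∀ z, #(insert z (G.neighborFinset z)) ≤ d + 1 := fun z => by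
      refine (card_insert_le _ _).trans ?_
      rw [SimpleGraph.card_neighborFinset_eq_degree, hreg z]
    have h1 := hN v
    have h2 := hN u
    have h3 := card_biUnion_neighborFinset_le hreg (G.neighborFinset v)
    rw [SimpleGraph.card_neighborFinset_eq_degree, hreg v] at h3
    have h4 := card_union_le (insert v (G.neighborFinset v) ∪
      ((G.neighborFinset v).biUnion fun w => G.neighborFinset w)) (insert u (G.neighborFinset u))
    have h5 := card_union_le (insert v (G.neighborFinset v))
      ((G.neighborFinset v).biUnion fun w => G.neighborFinset w)
    rw [hB]
    omega

/-- Stability of the occupancy inequality for independent sets. -/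
lemma exists_genPoly_indFam_derivative_add_le {d : ℕ} (hd : 2 ≤ d) {a b : ℝ} (ha : 0 < a)
    (hab : a ≤ b) : ∃ c > 0, ∀ {V : Type*} [Fintype V] [DecidableEq V] (G : SimpleGraph V)
      [DecidableRel G.Adj], G.IsRegularOfDegree d → ∀ S : Finset V, Closed G S →
      (∀ v ∈ S, ¬ InKdd G v) → ∀ s : ℕ, #S = 2 * d * s → ∀ x, a ≤ x → x ≤ b →
      (genPoly (indFam G S)).derivative.eval x * (indPoly d).eval x +
        c * s * ((genPoly (indFam G S)).eval x * (indPoly d).eval x) ≤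
      s * (indPoly d).derivative.eval x * (genPoly (indFam G S)).eval x := by
  have hb : 0 < b := ha.trans_le hab
  set K := (2 * max b 1 / min a 1) ^ (d * d + 2 * d + 2) with hK
  have hK0 : 0 < K := by positivity
  have hd' : (2 : ℝ) ≤ d := by exact_mod_cast hd
  -- Each vertex contributes slack at least x^(d+1) (d - 1) Z/K. Summing over 2ds vertices, dividing
  -- by dx and bounding P(x) by 2(1 + b)^d gives this constant.
  refine ⟨2 * a ^ d * (d - 1) / (K * (2 * (1 + b) ^ d)), div_pos (by
    have : (0 : ℝ) < d - 1 := by linarith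
    positivity) (by positivity), ?_⟩
  intro V _ _ G _ hreg S hS hnK s hs x hax hxb
  have hx : 0 < x := ha.trans_le hax
  have h := ind_occupancy_identity hreg hS hx (by omega)
  set Z := (genPoly (indFam G S)).eval x with hZ
  have hZ0 : 0 ≤ Z := by
    rw [hZ, eval_genPoly]; exact sum_nonneg fun _ _ => by positivity
  have hcardN : ∀ v J, #(uncov G v J) ≤ d := fun v J => by
    rw [← hreg v, ← SimpleGraph.card_neighborFinset_eq_degree]
    exact card_le_card (filter_subset _ _)
  have hlow : #S * (x ^ (d + 1) * (d - 1) * (Z / K)) ≤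
      d * x * ((1 + x) ^ (d - 1) * #S * Z -
        (genPoly (indFam G S)).derivative.eval x * (indPoly d).eval x) := by
    rw [h, ← nsmul_eq_mul, ← sum_const]
    refine sum_le_sum fun v hv => ?_
    have hfe := sum_nontrivial_view_ge hreg hS hv (hnK v hv) (a := min a 1) (b := max b 1)
      (lt_min ha one_pos) (min_le_right _ _) (le_max_right _ _) ((min_le_left _ _).trans hax)
      (hxb.trans (le_max_left _ _))
    rw [← hK, ← eval_genPoly, ← hZ] at hfe
    have hfe' : Z / K ≤ _ := (div_le_iff₀' hK0).mpr hfe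
    calc x ^ (d + 1) * (d - 1) * (Z / K) ≤ x ^ (d + 1) * (d - 1) * _ :=
          mul_le_mul_of_nonneg_left hfe' (mul_nonneg (by positivity) (by linarith))
      _ = _ := mul_sum _ _ _
      _ ≤ _ := sum_le_sum fun J hJ => by
          have hJ' := (mem_filter.mp hJ).2
          rw [mul_comm]
          exact mul_le_mul_of_nonneg_left
            (local_view_ind_slack (by omega) G (hcardN v J) hx hJ'.1 hJ'.2) (by positivity)
      _ ≤ _ := sum_le_sum_of_subset_of_nonneg (filter_subset _ _) fun J _ _ =>
          mul_nonneg (by positivity) (local_view_ind_nonneg (by omega) G (hcardN v J) hx)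
  have hs' : (#S : ℝ) = 2 * d * s := by rw [hs]; push_cast; ring
  rw [hs', pow_succ] at hlow
  have hdx : 0 < d * x := by positivity
  have h1 : 2 * s * (x ^ d * (d - 1) * (Z / K)) ≤ (1 + x) ^ (d - 1) * (2 * d * s) * Z -
        (genPoly (indFam G S)).derivative.eval x * (indPoly d).eval x := by
    refine le_of_mul_le_mul_left ?_ hdx
    linarith
  rw [eval_derivative_indPoly]
  have hP : (indPoly d).eval x ≤ 2 * (1 + b) ^ d := by
    rw [eval_indPoly]
    have : (1 + x) ^ d ≤ (1 + b) ^ d := pow_le_pow_left₀ (by linarith) (by linarith) d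
    linarith
  have h2 : 2 * a ^ d * (d - 1) / (K * (2 * (1 + b) ^ d)) * s * (Z * (indPoly d).eval x) ≤
      2 * s * (x ^ d * (d - 1) * (Z / K)) := by
    have hd1 : (0 : ℝ) ≤ d - 1 := by linarith
    calc 2 * a ^ d * (d - 1) / (K * (2 * (1 + b) ^ d)) * s * (Z * (indPoly d).eval x)
        ≤ 2 * x ^ d * (d - 1) / (K * (2 * (1 + b) ^ d)) * s * (Z * (2 * (1 + b) ^ d)) := by
          have hP0 : 0 ≤ (indPoly d).eval x := by
            rw [eval_indPoly]
            have : 1 ≤ (1 + x) ^ d := one_le_pow₀ (by linarith)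
            linarith
          have := mul_nonneg hZ0 hP0
          gcongr
      _ = _ := by field_simp
  linarith

end RegularSlices

/-! ### The matching polynomial of K_{d,d} and the dual sequence. -/

namespace RegularSlices

/-- The matching polynomial `∑ m_k X^k` of `K_{d,d}`. -/
noncomputable def matPoly (d : ℕ) : ℝ[X] :=
  ∑ k ∈ range (d + 1), C ((d.choose k : ℝ) ^ 2 * k.factorial) * X ^ k

lemma coeff_matPoly (d k : ℕ) : (matPoly d).coeff k = (d.choose k : ℝ) ^ 2 * k.factorial := by
  simp only [matPoly, finsetSum_coeff, coeff_C_mul_X_pow]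
  rw [sum_ite_eq (range (d + 1)) k]
  split_ifs with h
  · rfl
  · rw [Nat.choose_eq_zero_of_lt (by rw [mem_range] at h; omega)]
    simp

lemma eval_matPoly (d : ℕ) (x : ℝ) :
    (matPoly d).eval x = ∑ k ∈ range (d + 1), (d.choose k : ℝ) ^ 2 * k.factorial * x ^ k := by
  simp [matPoly, eval_finsetSum]

lemma derivative_matPoly (e : ℕ) :
    (matPoly (e + 1)).derivative = C (((e + 1 : ℕ) : ℝ) ^ 2) * matPoly e := by
  ext k
  rw [coeff_derivative, coeff_C_mul, coeff_matPoly, coeff_matPoly, Nat.factorial_succ]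
  have h : ((e + 1 : ℕ) : ℝ) * e.choose k = (e + 1).choose (k + 1) * (k + 1 : ℕ) := by
    exact_mod_cast Nat.add_one_mul_choose_eq e k
  rw [← mul_assoc, ← mul_pow, h]
  push_cast
  ring

lemma eval_matPoly_pos (d : ℕ) {x : ℝ} (hx : 0 ≤ x) : 0 < (matPoly d).eval x := by
  rw [eval_matPoly, sum_range_succ']
  have : 0 ≤ ∑ k ∈ range d, (d.choose (k + 1) : ℝ) ^ 2 * (k + 1).factorial * x ^ (k + 1) :=
    sum_nonneg fun _ _ => by positivity
  simp
  linarith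

/-- Weights of the local views of an edge of `K_{e+1,e+1}`: the weighted number of matchings of
`K_{e,e}` leaving `i` vertices on each side uncovered. -/
noncomputable def viewWeight (e : ℕ) (x : ℝ) (i : ℕ) : ℝ :=
  (e.choose i : ℝ) ^ 2 * (e - i).factorial * x ^ (e - i)

lemma viewWeight_pos {e i : ℕ} (hi : i ≤ e) {x : ℝ} (hx : 0 < x) : 0 < viewWeight e x i := by
  have : 0 < e.choose i := Nat.choose_pos hi
  unfold viewWeight
  positivity

lemma sum_viewWeight_mul (e : ℕ) (x : ℝ) (g : ℕ → ℝ) :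
    ∑ i ∈ range (e + 1), viewWeight e x i * g i =
      ∑ k ∈ range (e + 1), (e.choose k : ℝ) ^ 2 * k.factorial * x ^ k * g (e - k) := by
  rw [← sum_range_reflect]
  refine sum_congr rfl fun k hk => ?_
  have hk : k ≤ e := Nat.lt_succ_iff.mp (mem_range.mp hk)
  rw [Nat.add_sub_cancel, viewWeight, Nat.choose_symm hk, Nat.sub_sub_self hk]

/-- Pascal's rule squared, with the cross term absorbed by (k + 1) C(e, k + 1) = (e - k) C(e, k).
The local factor becomes linear in i: the x² i² of two further edges is traded for x(e - i). -/
lemma eval_matPoly_succ (e : ℕ) (x : ℝ) :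
    (matPoly (e + 1)).eval x =
      ∑ i ∈ range (e + 1), viewWeight e x i * (1 + x * (e + 1 + i)) := by
  rw [sum_viewWeight_mul, eval_matPoly, sum_range_succ']
  have h1 : ∀ k ∈ range (e + 1), ((e + 1).choose (k + 1) : ℝ) ^ 2 * (k + 1).factorial * x ^ (k + 1)
      = (e.choose (k + 1) : ℝ) ^ 2 * (k + 1).factorial * x ^ (k + 1) +
        (e.choose k : ℝ) ^ 2 * k.factorial * x ^ k * (x * (e + 1 + (e - k : ℕ))) := by
    intro k hk
    have hk : k ≤ e := Nat.lt_succ_iff.mp (mem_range.mp hk)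
    have h2 : (e.choose (k + 1) : ℝ) * (k + 1) = e.choose k * (e - k) := by
      have := Nat.choose_succ_right_eq e k
      rw [← Nat.cast_sub hk]
      exact_mod_cast this
    rw [Nat.choose_succ_succ', Nat.factorial_succ, Nat.cast_sub hk, pow_succ]
    push_cast
    linear_combination (2 * (e.choose k : ℝ) * k.factorial * x ^ k * x) * h2
  rw [sum_congr rfl h1, sum_add_distrib]
  have h3 : ∑ k ∈ range (e + 1), (e.choose (k + 1) : ℝ) ^ 2 * (k + 1).factorial * x ^ (k + 1) +
      (((e + 1).choose 0 : ℕ) : ℝ) ^ 2 * (Nat.factorial 0) * x ^ 0 =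
      ∑ k ∈ range (e + 1), (e.choose k : ℝ) ^ 2 * k.factorial * x ^ k := by
    have := sum_range_succ' (fun k => (e.choose k : ℝ) ^ 2 * k.factorial * x ^ k) (e + 1)
    rw [sum_range_succ] at this
    simp only [Nat.choose_succ_self, Nat.choose_zero_right] at this ⊢
    rw [← this, Nat.cast_zero]
    ring
  rw [add_right_comm, h3, ← sum_add_distrib]
  exact sum_congr rfl fun k _ => by ring

/-- The edge occupancy of `K_{e+1,e+1}`. -/
noncomputable def edgeOcc (e : ℕ) (x : ℝ) : ℝ := x * (matPoly e).eval x / (matPoly (e + 1)).eval x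

lemma edgeOcc_pos (e : ℕ) {x : ℝ} (hx : 0 < x) : 0 < edgeOcc e x :=
  div_pos (mul_pos hx (eval_matPoly_pos e hx.le)) (eval_matPoly_pos _ hx.le)

/-- The inhomogeneous term of the dual recurrence, strictly decreasing in i when x > 0. -/
noncomputable def dualForce (e : ℕ) (x : ℝ) (i : ℕ) : ℝ := x - edgeOcc e x * (1 + x * (e + 1 + i))

/-- The compatibility condition for the dual recurrence: the occupancy of K_{d,d} is the value for
which its solution closes up at i = e. -/
lemma sum_viewWeight_mul_dualForce (e : ℕ) {x : ℝ} (hx : 0 < x) :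
    ∑ i ∈ range (e + 1), viewWeight e x i * dualForce e x i = 0 := by
  have h1 : ∑ i ∈ range (e + 1), viewWeight e x i = (matPoly e).eval x := by
    have := sum_viewWeight_mul e x fun _ => 1
    simp only [mul_one] at this
    rw [this, eval_matPoly]
  have h2 : ∑ i ∈ range (e + 1), viewWeight e x i * dualForce e x i =
      x * ∑ i ∈ range (e + 1), viewWeight e x i -
        edgeOcc e x * ∑ i ∈ range (e + 1), viewWeight e x i * (1 + x * (e + 1 + i)) := by
    rw [mul_sum, mul_sum, ← sum_sub_distrib]
    exact sum_congr rfl fun i _ => by unfold dualForce; ring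
  rw [h2, h1, ← eval_matPoly_succ, edgeOcc, div_mul_cancel₀ _ (eval_matPoly_pos _ hx.le).ne',
    sub_self]

/-- The dual variables of the linear program for matchings (up to a linear term). -/
noncomputable def dualSeq (e : ℕ) (x : ℝ) (i : ℕ) : ℝ :=
  (∑ j ∈ range i, viewWeight e x j * dualForce e x j) / (i * x * viewWeight e x i)

@[simp] lemma dualSeq_zero (e : ℕ) (x : ℝ) : dualSeq e x 0 = 0 := by simp [dualSeq]

lemma mul_viewWeight_succ {e i : ℕ} (hi : i < e) (x : ℝ) :
    viewWeight e x (i + 1) * ((i + 1) ^ 2 * x) = (e - i) * viewWeight e x i := by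
  obtain ⟨k, rfl⟩ : ∃ k, e = i + 1 + k := ⟨e - (i + 1), by omega⟩
  have h2 : ((i + 1 + k).choose (i + 1) : ℝ) * (i + 1) = (i + 1 + k).choose i * (k + 1) := by
    have := Nat.choose_succ_right_eq (i + 1 + k) i
    rw [show i + 1 + k - i = k + 1 by omega] at this
    exact_mod_cast this
  unfold viewWeight
  rw [show i + 1 + k - (i + 1) = k by omega, show i + 1 + k - i = k + 1 by omega,
    Nat.factorial_succ]
  push_cast
  calc ((i + 1 + k).choose (i + 1) : ℝ) ^ 2 * k.factorial * x ^ k * ((i + 1) ^ 2 * x)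
      = (((i + 1 + k).choose (i + 1) : ℝ) * (i + 1)) ^ 2 * k.factorial * x ^ k * x := by ring
    _ = _ := by rw [h2]; ring

lemma mul_dualSeq {e i : ℕ} (hi : i ≤ e) {x : ℝ} (hx : 0 < x) :
    i * x * viewWeight e x i * dualSeq e x i =
      ∑ j ∈ range i, viewWeight e x j * dualForce e x j := by
  rcases Nat.eq_zero_or_pos i with rfl | h
  · simp
  · have := viewWeight_pos hi hx
    rw [dualSeq, mul_div_cancel₀]
    positivity

/-- Summation by parts with weights obeying a first-order relation (`mul_viewWeight_succ`). At i = e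
the undefined next term has coefficient 0, and the identity is the vanishing of the full sum. -/
lemma dualSeq_rec {e i : ℕ} (hi : i ≤ e) {x : ℝ} (hx : 0 < x) :
    (e - i) * dualSeq e x (i + 1) = (i + 1) * (dualForce e x i + i * x * dualSeq e x i) := by
  have hw := viewWeight_pos hi hx
  have h1 := mul_dualSeq hi hx
  rcases hi.lt_or_eq with h | rfl
  · have h2 := mul_dualSeq (show i + 1 ≤ e from h) hx
    rw [sum_range_succ, ← h1] at h2
    have h3 := mul_viewWeight_succ h x
    push_cast at h2
    refine mul_left_cancel₀ hw.ne' ?_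
    linear_combination (i + 1 : ℝ) * h2 - dualSeq e x (i + 1) * h3
  · have h2 := sum_viewWeight_mul_dualForce i hx
    rw [sum_range_succ, ← h1] at h2
    refine mul_left_cancel₀ hw.ne' ?_
    linear_combination -(i + 1 : ℝ) * h2

/-- A solution of the dual recurrence is strictly increasing. -/
lemma lt_succ_of_rec {e : ℕ} (he : 1 ≤ e) {x α : ℝ} (hx : 0 < x) (hα : 0 < α) {y : ℕ → ℝ}
    (h0 : y 0 = 0) (hrec : ∀ i ≤ e, ((e : ℝ) - i) * y (i + 1) =
      (i + 1) * (x - α * (1 + x * (e + 1 + i)) + i * x * y i)) :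
    ∀ i < e, y i < y (i + 1) := by
  set f : ℕ → ℝ := fun i => x - α * (1 + x * (e + 1 + i)) with hf
  have hfanti : ∀ i j, i < j → f j < f i := by
    intro i j hij
    have : (i : ℝ) < j := by exact_mod_cast hij
    have := mul_lt_mul_of_pos_left this (mul_pos hα hx)
    simp only [hf]
    linarith
  have hrec' : ∀ i ≤ e, ((e : ℝ) - i) * y (i + 1) = (i + 1) * (f i + i * x * y i) := hrec
  -- The recurrence at i = e acts as a terminal boundary condition; both contradictions below come
  -- from running to this end.
  have hend : f e + e * x * y e = 0 := by
    have := hrec' e le_rfl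
    rw [sub_self, zero_mul] at this
    rcases mul_eq_zero.mp this.symm with h | h
    · exact absurd h (by positivity)
    · exact h
  -- A nonpositive value after the force has turned nonpositive would persist up to e, making the
  -- boundary expression negative.
  have hprop : ∀ i < e, f i ≤ 0 → 0 < y (i + 1) := by
    intro i hi hfi
    by_contra! hy
    have hall : ∀ j, i + 1 ≤ j → j ≤ e → y j ≤ 0 := by
      intro j hj
      induction j, hj using Nat.le_induction with
      | base => exact fun _ => hy
      | succ j hj ih =>
        intro hje
        have h1 := ih (by omega)
        have h2 := hrec' j (by omega)
        have h3 := hfanti i j (by omega)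
        have h4 : (0 : ℝ) < (e : ℝ) - j := by
          have : (j : ℝ) < e := by exact_mod_cast hje
          linarith
        have h5 : f j + j * x * y j ≤ 0 := by
          have : j * x * y j ≤ 0 := mul_nonpos_of_nonneg_of_nonpos (by positivity) h1
          linarith
        have h6 : ((e : ℝ) - j) * y (j + 1) ≤ 0 := by
          rw [h2]; exact mul_nonpos_of_nonneg_of_nonpos (by positivity) h5
        by_contra! h7
        exact absurd (mul_pos h4 h7) (not_lt.mpr h6)
    have h1 := hall e (by omega) le_rfl
    have h2 := hfanti i e hi
    have : e * x * y e ≤ 0 := mul_nonpos_of_nonneg_of_nonpos (by positivity) h1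
    linarith
  have hpos : ∀ i < e, 0 < y (i + 1) := by
    intro i
    induction i with
    | zero =>
      intro hi
      by_contra! hcon
      have h1 := hrec' 0 (Nat.zero_le _)
      simp only [Nat.cast_zero, sub_zero, zero_mul, add_zero, zero_add, one_mul] at h1
      have h2 : f 0 ≤ 0 := by
        rw [← h1]; exact mul_nonpos_of_nonneg_of_nonpos (by positivity) hcon
      exact absurd (hprop 0 hi h2) (not_lt.mpr hcon)
    | succ i ih =>
      intro hi
      by_contra! hcon
      have h1 := hrec' (i + 1) (by omega)
      have h4 : (0 : ℝ) ≤ (e : ℝ) - (i + 1 : ℕ) := by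
        have : ((i + 1 : ℕ) : ℝ) ≤ e := by exact_mod_cast hi.le
        linarith
      have h2 : f (i + 1) ≤ 0 := by
        have h5 := mul_nonpos_of_nonneg_of_nonpos h4 hcon
        rw [h1] at h5
        have h6 : f (i + 1) + (i + 1 : ℕ) * x * y (i + 1) ≤ 0 := by
          by_contra! h7
          exact absurd (mul_pos (show (0 : ℝ) < (i + 1 : ℕ) + 1 by positivity) h7) (not_lt.mpr h5)
        have h7 : 0 ≤ ((i + 1 : ℕ) : ℝ) * x * y (i + 1) :=
          mul_nonneg (by positivity) (ih (by omega)).le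
        linarith
      exact absurd (hprop (i + 1) hi h2) (not_lt.mpr hcon)
  -- Differencing the recurrence yields one for the increments of y, driven by ψ; κ arises from 1/(i
  -- + 1) changing to 1/(i + 2).
  set κ : ℕ → ℝ := fun i => (e + 1) / ((i + 1) * (i + 2)) with hκ
  set ψ : ℕ → ℝ := fun i => (x + κ i) * y (i + 1) - α * x with hψ
  have hdiff : ∀ i, i + 1 ≤ e → ((e : ℝ) - (i + 1 : ℕ)) / (i + 2) * (y (i + 2) - y (i + 1)) =
      i * x * (y (i + 1) - y i) + ψ i := by
    intro i hi
    have h1 := hrec i (by omega)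
    have h2 := hrec (i + 1) hi
    have e1 : y (i + 2) * ((e : ℝ) - (i + 1 : ℕ)) / (i + 2) =
        x - α * (1 + x * (e + 1 + (i + 1 : ℕ))) + (i + 1 : ℕ) * x * y (i + 1) := by
      rw [div_eq_iff (by positivity)]
      push_cast at h2 ⊢
      linear_combination h2
    have e2 : y (i + 1) * ((e : ℝ) - i) / (i + 1) = x - α * (1 + x * (e + 1 + i)) + i * x * y i := by
      rw [div_eq_iff (by positivity)]
      linear_combination h1
    have e3 : ((e : ℝ) - (i + 1 : ℕ)) / (i + 2) * (y (i + 2) - y (i + 1)) =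
        y (i + 2) * ((e : ℝ) - (i + 1 : ℕ)) / (i + 2) - y (i + 1) * ((e : ℝ) - i) / (i + 1)
          + κ i * y (i + 1) := by
      simp only [hκ]
      field_simp
      push_cast
      ring
    rw [e3, e1, e2]
    simp only [hψ]
    push_cast
    ring
  have hκanti : ∀ i, κ (i + 1) < κ i := by
    intro i
    simp only [hκ]
    refine div_lt_div_of_pos_left (by positivity) (by positivity) ?_
    push_cast
    have : (0 : ℝ) ≤ i := Nat.cast_nonneg i
    nlinarith
  intro i
  induction i with
  | zero => intro hi; rw [h0]; exact hpos 0 hi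
  | succ i ih =>
    intro hi
    by_contra! hcon
    have hi0 := ih (by omega)
    have hstart : ψ i ≤ 0 := by
      have h1 := hdiff i (by omega)
      have h2 : ((e : ℝ) - (i + 1 : ℕ)) / (i + 2) * (y (i + 2) - y (i + 1)) ≤ 0 := by
        refine mul_nonpos_of_nonneg_of_nonpos (div_nonneg ?_ (by positivity)) (by linarith)
        have : ((i + 1 : ℕ) : ℝ) ≤ e := by exact_mod_cast hi.le
        linarith
      have h3 : 0 ≤ i * x * (y (i + 1) - y i) := mul_nonneg (by positivity) (by linarith)
      linarith
    -- Once an increment is nonpositive with ψ ≤ 0, the decrease of κ and positivity of y push ψ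
    -- strictly below 0, so the failure propagates.
    have hstep : ∀ j, j + 1 < e → ψ j ≤ 0 → y (j + 2) ≤ y (j + 1) →
        ψ (j + 1) < 0 ∧ ((e : ℝ) - (j + 2 : ℕ)) / (j + 3) * (y (j + 3) - y (j + 2)) < 0 := by
      intro j hj hψj hyj
      have h1 := hdiff (j + 1) (by omega)
      have hy2 := hpos (j + 1) hj
      have hκ0 : 0 < κ j := by simp only [hκ]; positivity
      have h2 : ψ (j + 1) < ψ j := by
        simp only [hψ]
        have e1 : (x + κ (j + 1)) * y (j + 2) < (x + κ j) * y (j + 2) :=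
          mul_lt_mul_of_pos_right (by linarith [hκanti j]) hy2
        have e2 : (x + κ j) * y (j + 2) ≤ (x + κ j) * y (j + 1) :=
          mul_le_mul_of_nonneg_left hyj (by linarith)
        linarith
      refine ⟨by linarith, ?_⟩
      have h3 : ((j + 1 : ℕ) : ℝ) * x * (y (j + 2) - y (j + 1)) ≤ 0 :=
        mul_nonpos_of_nonneg_of_nonpos (by positivity) (by linarith)
      have h4 : ((j + 1 : ℕ) : ℝ) + 2 = j + 3 := by push_cast; ring
      rw [h4] at h1
      calc _ = _ := h1
        _ < 0 := by
          change ((j + 1 : ℕ) : ℝ) * x * (y (j + 2) - y (j + 1)) + ψ (j + 1) < 0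
          linarith
    have hall : ∀ j, i ≤ j → j + 1 < e → ψ j ≤ 0 ∧ y (j + 2) ≤ y (j + 1) := by
      intro j hj
      induction j, hj using Nat.le_induction with
      | base => exact fun _ => ⟨hstart, hcon⟩
      | succ j hj ihj =>
        intro hje
        obtain ⟨h1, h2⟩ := ihj (by omega)
        obtain ⟨h3, h4⟩ := hstep j (by omega) h1 h2
        refine ⟨h3.le, ?_⟩
        by_contra! h5
        have h6 : (0 : ℝ) ≤ (e : ℝ) - (j + 2 : ℕ) := by
          have : ((j + 2 : ℕ) : ℝ) ≤ e := by exact_mod_cast hje.le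
          linarith
        have h7 : (0 : ℝ) ≤ ((e : ℝ) - (j + 2 : ℕ)) / (j + 3) * (y (j + 3) - y (j + 2)) :=
          mul_nonneg (div_nonneg h6 (by positivity)) (by
            have h5 : y (j + 2) < y (j + 3) := h5
            linarith)
        linarith
    -- At j = e - 2 the factor e - (j + 2) is zero, so the propagated strict inequality reads 0 < 0.
    obtain ⟨k, rfl⟩ : ∃ k, e = k + 2 := ⟨e - 2, by omega⟩
    obtain ⟨h1, h2⟩ := hall k (by omega) (by omega)
    obtain ⟨-, h4⟩ := hstep k (by omega) h1 h2
    rw [sub_self, zero_div, zero_mul] at h4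
    exact lt_irrefl _ h4

lemma dualSeq_lt_succ {e : ℕ} (he : 1 ≤ e) {x : ℝ} (hx : 0 < x) :
    ∀ i < e, dualSeq e x i < dualSeq e x (i + 1) :=
  lt_succ_of_rec he hx (edgeOcc_pos e hx) (dualSeq_zero e x) fun _ hi => dualSeq_rec hi hx

lemma continuousOn_dualSeq {e i : ℕ} (hi : i ≤ e) : ContinuousOn (fun x => dualSeq e x i)
    (Set.Ioi 0) := by
  rcases Nat.eq_zero_or_pos i with rfl | h
  · simp only [dualSeq_zero]; exact continuousOn_const
  have hw : ∀ j, Continuous fun x => viewWeight e x j := fun j => by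
    unfold viewWeight; fun_prop
  have ho : ContinuousOn (edgeOcc e) (Set.Ioi 0) := by
    unfold edgeOcc
    refine ContinuousOn.div (by fun_prop) (by fun_prop) fun x hx => ?_
    exact (eval_matPoly_pos _ (le_of_lt hx)).ne'
  unfold dualSeq dualForce
  refine ContinuousOn.div ?_ ?_ ?_
  · refine continuousOn_finsetSum _ fun j _ => (hw j).continuousOn.mul ?_
    exact continuousOn_id.sub (ho.mul (by fun_prop))
  · exact (Continuous.mul (by fun_prop) (hw i)).continuousOn
  · intro x hx
    have := viewWeight_pos hi hx
    have hx : 0 < x := hx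
    positivity

/-- The finitely many increments are positive and continuous in x, hence bounded below on a compact
interval. -/
lemma exists_forall_add_le_dualSeq_succ {e : ℕ} (he : 1 ≤ e) {a b : ℝ} (ha : 0 < a)
    (hab : a ≤ b) :
    ∃ ξ > 0, ∀ x, a ≤ x → x ≤ b → ∀ i < e, dualSeq e x i + ξ ≤ dualSeq e x (i + 1) := by
  have h1 : ∀ i : ℕ, ∃ ξ > 0, i < e → ∀ x, a ≤ x → x ≤ b →
      dualSeq e x i + ξ ≤ dualSeq e x (i + 1) := by
    intro i
    by_cases hi : i < e
    · have hsub : Set.Icc a b ⊆ Set.Ioi 0 := fun x hx => ha.trans_le hx.1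
      obtain ⟨x₀, hx₀, hmin⟩ := isCompact_Icc.exists_isMinOn (Set.nonempty_Icc.mpr hab)
        (((continuousOn_dualSeq (show i + 1 ≤ e from hi)).sub
          (continuousOn_dualSeq hi.le)).mono hsub)
      refine ⟨_, sub_pos.mpr (dualSeq_lt_succ he (hsub hx₀) i hi), fun _ x hxa hxb => ?_⟩
      have := hmin (Set.mem_Icc.mpr ⟨hxa, hxb⟩)
      simp only [Set.mem_ofPred_eq, Pi.sub_apply] at this
      linarith
    · exact ⟨1, one_pos, fun h => absurd h hi⟩
  choose ξ hξ h using h1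
  refine ⟨(range e).inf' ⟨0, mem_range.mpr he⟩ ξ, (lt_inf'_iff _).mpr fun i _ => hξ i, ?_⟩
  intro x hxa hxb i hi
  have h2 := h i hi x hxa hxb
  have h3 := inf'_le ξ (mem_range.mpr hi)
  linarith

end RegularSlices

/-! ### Matchings conditioned at a vertex and at an edge. -/

namespace RegularSlices

variable {V : Type*}

open Classical in
/-- The matchings of `G` inside `S`, as sets of edges. -/
noncomputable def matFam (G : SimpleGraph V) (S : Finset V) : Finset (Finset (Sym2 V)) :=
  {M ∈ S.sym2.powerset | (∀ e ∈ M, e ∈ G.edgeSet) ∧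
    ∀ e ∈ M, ∀ e' ∈ M, ∀ v, v ∈ e → v ∈ e' → e = e'}

/-- `v` is an endpoint of an edge in `M`. -/
def Cov (M : Finset (Sym2 V)) (v : V) : Prop := ∃ e ∈ M, v ∈ e

open Classical in
/-- The neighbours of `v` in `S` not covered by `M`. -/
noncomputable def freeNbrs (G : SimpleGraph V) (S : Finset V) (v : V) (M : Finset (Sym2 V)) :
    Finset V :=
  {y ∈ S | G.Adj v y ∧ ¬ Cov M y}

variable {G : SimpleGraph V} {S : Finset V}

lemma mem_matFam {M : Finset (Sym2 V)} :
    M ∈ matFam G S ↔ (∀ e ∈ M, e ∈ G.edgeSet ∧ ∀ v ∈ e, v ∈ S) ∧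
      ∀ e ∈ M, ∀ e' ∈ M, ∀ v, v ∈ e → v ∈ e' → e = e' := by
  simp only [matFam, mem_filter, mem_powerset, subset_iff, mem_sym2_iff]
  constructor
  · exact fun h => ⟨fun e he => ⟨h.2.1 e he, h.1 he⟩, h.2.2⟩
  · exact fun h => ⟨fun e he => (h.1 e he).2, fun e he => (h.1 e he).1, h.2⟩

lemma mem_freeNbrs {v y : V} {M : Finset (Sym2 V)} :
    y ∈ freeNbrs G S v M ↔ y ∈ S ∧ G.Adj v y ∧ ¬ Cov M y := by
  simp [freeNbrs]

lemma empty_mem_matFam (G : SimpleGraph V) (S : Finset V) : ∅ ∈ matFam G S := by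
  simp [mem_matFam]

variable [DecidableEq V]

lemma cov_insert {M : Finset (Sym2 V)} {e : Sym2 V} {v : V} :
    Cov (insert e M) v ↔ v ∈ e ∨ Cov M v := by
  simp [Cov]

lemma not_cov_of_mem_matFam_erase {v : V} {M : Finset (Sym2 V)} (hM : M ∈ matFam G (S.erase v)) :
    ¬ Cov M v := by
  rintro ⟨e, he, hv⟩
  exact (mem_erase.mp (((mem_matFam.mp hM).1 e he).2 v hv)).1 rfl

lemma filter_not_cov_matFam (v : V) [DecidablePred fun M => Cov M v] :
    {M ∈ matFam G S | ¬ Cov M v} = matFam G (S.erase v) := by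
  ext M
  rw [mem_filter]
  constructor
  · rintro ⟨hM, hc⟩
    rw [mem_matFam] at hM ⊢
    refine ⟨fun e he => ⟨(hM.1 e he).1, fun w hw => mem_erase.mpr ⟨?_, (hM.1 e he).2 w hw⟩⟩,
      hM.2⟩
    rintro rfl
    exact hc ⟨e, he, hw⟩
  · intro hM
    refine ⟨?_, not_cov_of_mem_matFam_erase hM⟩
    rw [mem_matFam] at hM ⊢
    exact ⟨fun e he => ⟨(hM.1 e he).1, fun w hw => mem_of_mem_erase ((hM.1 e he).2 w hw)⟩, hM.2⟩

/-- Splitting the matchings in `S` according to the partner of `v`. -/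
lemma sum_matFam_eq {v : V} (hv : v ∈ S) (f : Finset (Sym2 V) → ℝ) :
    ∑ M ∈ matFam G S, f M = ∑ M ∈ matFam G (S.erase v),
      (f M + ∑ y ∈ freeNbrs G (S.erase v) v M, f (insert s(v, y) M)) := by
  classical
  rw [← sum_filter_not_add_sum_filter _ (fun M => Cov M v), sum_add_distrib]
  congr 1
  · rw [filter_not_cov_matFam]
  · rw [sum_sigma']
    symm
    refine sum_bij (fun (p : (_ : Finset (Sym2 V)) × V) _ => insert s(v, p.2) p.1) ?_ ?_ ?_ ?_
    · rintro ⟨M, y⟩ hp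
      obtain ⟨hM, hy⟩ := mem_sigma.mp hp
      obtain ⟨hyS, hvy, hyc⟩ := mem_freeNbrs.mp hy
      have hvc := not_cov_of_mem_matFam_erase hM
      simp only at hM hyS hvy hyc hvc ⊢
      rw [mem_matFam] at hM
      rw [mem_filter, mem_matFam]
      refine ⟨⟨fun e he => ?_, fun e he e' he' w hw hw' => ?_⟩, s(v, y), mem_insert_self _ _, by simp⟩
      · rcases mem_insert.mp he with rfl | he
        · refine ⟨hvy, fun w hw => ?_⟩
          rcases Sym2.mem_iff.mp hw with rfl | rfl
          · exact hv
          · exact mem_of_mem_erase hyS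
        · exact ⟨(hM.1 e he).1, fun w hw => mem_of_mem_erase ((hM.1 e he).2 w hw)⟩
      · have hnew : ∀ g ∈ M, ∀ w ∈ g, w ∉ s(v, y) := by
          intro g hg w hwg hw
          rcases Sym2.mem_iff.mp hw with rfl | rfl
          · exact hvc ⟨g, hg, hwg⟩
          · exact hyc ⟨g, hg, hwg⟩
        rcases mem_insert.mp he with rfl | he <;> rcases mem_insert.mp he' with rfl | he'
        · rfl
        · exact absurd hw (hnew e' he' w hw')
        · exact absurd hw' (hnew e he w hw)
        · exact hM.2 e he e' he' w hw hw'
    · rintro ⟨M, y⟩ hp ⟨M', y'⟩ hp' h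
      obtain ⟨hM, -⟩ := mem_sigma.mp hp
      obtain ⟨hM', -⟩ := mem_sigma.mp hp'
      have hc := not_cov_of_mem_matFam_erase hM
      have hc' := not_cov_of_mem_matFam_erase hM'
      simp only at h hc hc'
      have hyy : y = y' := by
        have : s(v, y) ∈ insert s(v, y') M' := h ▸ mem_insert_self _ _
        rcases mem_insert.mp this with h1 | h1
        · exact Sym2.congr_right.mp h1
        · exact absurd ⟨_, h1, Sym2.mem_mk_left v y⟩ hc'
      subst hyy
      have hn : s(v, y) ∉ M := fun h1 => hc ⟨_, h1, Sym2.mem_mk_left v y⟩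
      have hn' : s(v, y) ∉ M' := fun h1 => hc' ⟨_, h1, Sym2.mem_mk_left v y⟩
      rw [← erase_insert hn, h, erase_insert hn']
    · intro M hM
      obtain ⟨hM, e, he, hve⟩ := mem_filter.mp hM
      rw [mem_matFam] at hM
      obtain ⟨y, rfl⟩ := hve
      have hvy : G.Adj v y := (hM.1 _ he).1
      have hM' : ∀ g ∈ M.erase s(v, y), ∀ w ∈ g, w ∉ s(v, y) := fun g hg w hwg hw =>
        (mem_erase.mp hg).1 (hM.2 g (mem_of_mem_erase hg) _ he w hwg hw)
      refine ⟨⟨M.erase s(v, y), y⟩, ?_, insert_erase he⟩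
      rw [mem_sigma, mem_matFam, mem_freeNbrs]
      refine ⟨⟨fun g hg => ⟨(hM.1 g (mem_of_mem_erase hg)).1, fun w hw => mem_erase.mpr
        ⟨?_, (hM.1 g (mem_of_mem_erase hg)).2 w hw⟩⟩, fun g hg g' hg' => hM.2 g
        (mem_of_mem_erase hg) g' (mem_of_mem_erase hg')⟩, mem_erase.mpr ⟨hvy.ne',
        (hM.1 _ he).2 y (Sym2.mem_mk_right v y)⟩, hvy, ?_⟩
      · rintro rfl
        exact hM' g hg w hw (Sym2.mem_mk_left w y)
      · rintro ⟨g, hg, hyg⟩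
        exact hM' g hg y hyg (Sym2.mem_mk_right v y)
    · intro _ _
      rfl

lemma card_insert_edge {v y : V} {M : Finset (Sym2 V)} (hM : ¬ Cov M v) :
    #(insert s(v, y) M) = #M + 1 :=
  card_insert_of_notMem fun h => hM ⟨_, h, Sym2.mem_mk_left v y⟩

/-- The weight of the matchings covering `v`. -/
lemma sum_matFam_ite_cov {v : V} (hv : v ∈ S) (x : ℝ) [DecidablePred fun M => Cov M v] :
    ∑ M ∈ matFam G S, (if Cov M v then x ^ #M else 0) =
      ∑ M ∈ matFam G (S.erase v), x ^ (#M + 1) * #(freeNbrs G (S.erase v) v M) := by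
  rw [sum_matFam_eq hv]
  refine sum_congr rfl fun M hM => ?_
  have hc := not_cov_of_mem_matFam_erase hM
  rw [if_neg hc, zero_add, sum_congr rfl (g := fun _ => x ^ (#M + 1)) fun y _ => by
    rw [if_pos (cov_insert.mpr (Or.inl (Sym2.mem_mk_left v y))), card_insert_edge hc]]
  rw [sum_const, nsmul_eq_mul, mul_comm]

lemma eval_genPoly_matFam {v : V} (hv : v ∈ S) (x : ℝ) :
    (genPoly (matFam G S)).eval x = ∑ M ∈ matFam G (S.erase v),
      x ^ #M * (1 + x * #(freeNbrs G (S.erase v) v M)) := by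
  rw [eval_genPoly, sum_matFam_eq hv]
  refine sum_congr rfl fun M hM => ?_
  have hc := not_cov_of_mem_matFam_erase hM
  rw [sum_congr rfl (g := fun _ => x ^ (#M + 1)) fun y _ => by rw [card_insert_edge hc]]
  rw [sum_const, nsmul_eq_mul, pow_succ]
  ring

/-- Each edge covers two vertices. -/
lemma sum_ite_cov {M : Finset (Sym2 V)} (hM : M ∈ matFam G S) [∀ v, Decidable (Cov M v)] :
    ∑ v ∈ S, (if Cov M v then 1 else 0) = 2 * #M := by
  rw [mem_matFam] at hM
  rw [sum_boole, Nat.cast_id, mul_comm, ← smul_eq_mul, ← sum_const]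
  have h : ({v ∈ S | Cov M v} : Finset V) = M.biUnion fun e => e.toFinset := by
    ext v
    simp only [mem_filter, mem_biUnion, Sym2.mem_toFinset]
    constructor
    · rintro ⟨-, e, he, hv⟩; exact ⟨e, he, hv⟩
    · rintro ⟨e, he, hv⟩; exact ⟨(hM.1 e he).2 v hv, e, he, hv⟩
  rw [h, card_biUnion]
  · refine sum_congr rfl fun e he => Sym2.card_toFinset_of_not_isDiag e ?_
    exact G.not_isDiag_of_mem_edgeSet (hM.1 e he).1
  · intro e he e' he' hne
    rw [Function.onFun, disjoint_left]
    intro v hv hv'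
    exact hne (hM.2 e he e' he' v (Sym2.mem_toFinset.mp hv) (Sym2.mem_toFinset.mp hv'))

section Pair

variable {v u : V}

lemma freeNbrs_erase_eq_insert (hu : u ∈ S.erase v) (hvu : G.Adj v u) {J : Finset (Sym2 V)}
    (hJ : J ∈ matFam G ((S.erase v).erase u)) :
    freeNbrs G (S.erase v) v J = insert u (freeNbrs G ((S.erase v).erase u) v J) := by
  have hc := not_cov_of_mem_matFam_erase hJ
  ext y
  rw [mem_insert, mem_freeNbrs, mem_freeNbrs, mem_erase (a := y) (b := u)]
  by_cases h : y = u
  · subst h; simp [hu, hvu, hc]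
  · simp [h]

lemma freeNbrs_insert_edge {J : Finset (Sym2 V)} {y : V} :
    freeNbrs G (S.erase v) v (insert s(u, y) J) =
      (freeNbrs G ((S.erase v).erase u) v J).erase y := by
  ext z
  rw [mem_erase, mem_freeNbrs, mem_freeNbrs, mem_erase (a := z) (b := u), cov_insert,
    Sym2.mem_iff]
  tauto

lemma card_freeNbrs_erase (hu : u ∈ S.erase v) (hvu : G.Adj v u) {J : Finset (Sym2 V)}
    (hJ : J ∈ matFam G ((S.erase v).erase u)) :
    #(freeNbrs G (S.erase v) v J) = #(freeNbrs G ((S.erase v).erase u) v J) + 1 := by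
  rw [freeNbrs_erase_eq_insert hu hvu hJ, card_insert_of_notMem]
  rw [mem_freeNbrs]
  simp

/-- Expansion over the matchings avoiding an edge `vu` of a sum over the matchings avoiding `v`
of a function of the number of free neighbours of `v` and of whether `u` is covered. -/
lemma sum_matFam_erase_eq (hu : u ∈ S.erase v) (hvu : G.Adj v u) (x : ℝ) (g h : ℕ → ℝ)
    [∀ M, Decidable (Cov M u)] :
    ∑ M ∈ matFam G (S.erase v), x ^ #M *
        (if Cov M u then h #(freeNbrs G (S.erase v) v M) else g #(freeNbrs G (S.erase v) v M)) =
      ∑ J ∈ matFam G ((S.erase v).erase u), x ^ #J *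
        (g (#(freeNbrs G ((S.erase v).erase u) v J) + 1) +
          x * ((#(freeNbrs G ((S.erase v).erase u) u J) -
              #(freeNbrs G ((S.erase v).erase u) u J ∩ freeNbrs G ((S.erase v).erase u) v J) : ℝ) *
              h #(freeNbrs G ((S.erase v).erase u) v J) +
            #(freeNbrs G ((S.erase v).erase u) u J ∩ freeNbrs G ((S.erase v).erase u) v J) *
              h (#(freeNbrs G ((S.erase v).erase u) v J) - 1))) := by
  rw [sum_matFam_eq hu]
  refine sum_congr rfl fun J hJ => ?_
  have hc := not_cov_of_mem_matFam_erase hJ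
  rw [if_neg hc, card_freeNbrs_erase hu hvu hJ, mul_add]
  congr 1
  set A := freeNbrs G ((S.erase v).erase u) u J
  set B := freeNbrs G ((S.erase v).erase u) v J with hB
  have e1 : ∀ y ∈ A, x ^ #(insert s(u, y) J) *
      (if Cov (insert s(u, y) J) u then h #(freeNbrs G (S.erase v) v (insert s(u, y) J))
        else g #(freeNbrs G (S.erase v) v (insert s(u, y) J))) =
      x ^ #J * x * (if y ∈ B then h (#B - 1) else h #B) := by
    intro y _
    rw [if_pos (cov_insert.mpr (Or.inl (Sym2.mem_mk_left u y))), card_insert_edge hc,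
      freeNbrs_insert_edge, ← hB, pow_succ]
    split_ifs with h1
    · rw [card_erase_of_mem h1]
    · rw [erase_eq_of_notMem h1]
  rw [sum_congr rfl e1, ← mul_sum, mul_assoc, sum_ite]
  congr 2
  rw [filter_mem_eq_inter, sum_const, sum_const, nsmul_eq_mul, nsmul_eq_mul, add_comm]
  congr 2
  have := card_filter_add_card_filter_not (s := A) (fun y => y ∈ B)
  rw [filter_mem_eq_inter] at this
  have : (#A : ℝ) = #(A ∩ B) + #{y ∈ A | y ∉ B} := by exact_mod_cast this.symm
  linarith

end Pair

end RegularSlices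

/-! ### Dual constraints and the occupancy identity for matchings. -/

namespace RegularSlices

/-- The dual variables, multiplied by the number of free neighbours. -/
noncomputable def dualVar (e : ℕ) (x : ℝ) (t : ℕ) : ℝ := edgeOcc e x * x * t + dualSeq e x t

/-- The contribution of one endpoint of an edge to the dual constraint, for a local view with `a`
free neighbours of the other endpoint, `b` of this one, and `k` common ones. -/
noncomputable def sideTerm (e : ℕ) (x : ℝ) (a b k : ℕ) : ℝ :=
  ((e + 1 : ℕ) - (b + 1 : ℕ)) * (dualVar e x (b + 1) / (b + 1 : ℕ)) +
    x * ((a - k : ℝ) * -dualVar e x b + k * -dualVar e x (b - 1))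

/-- The slack of a local view in the dual constraint. -/
noncomputable def viewSlack (e : ℕ) (x : ℝ) (a b k : ℕ) : ℝ :=
  x / 2 * ((b - a) * (dualSeq e x b - dualSeq e x a) +
    k * ((dualSeq e x b - dualSeq e x (b - 1)) + (dualSeq e x a - dualSeq e x (a - 1))))

/-- The recurrence for `dualSeq` cancels everything that does not pair the two endpoints. What
remains compares their dual values, plus a correction for each common free neighbour. -/
lemma local_view_mat {e : ℕ} {x : ℝ} (hx : 0 < x) {a b k : ℕ} (ha : a ≤ e) (hb : b ≤ e)
    (hka : k ≤ a) (hkb : k ≤ b) :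
    edgeOcc e x * ((1 + x * (b + 1 : ℕ)) +
      x * ((a - k : ℝ) * (1 + x * b) + k * (1 + x * (b - 1 : ℕ)))) +
      (sideTerm e x a b k + sideTerm e x b a k) / 2 - x = viewSlack e x a b k := by
  have hmain : ∀ b ≤ e, ((e + 1 : ℕ) - (b + 1 : ℕ) : ℝ) * (dualVar e x (b + 1) / (b + 1 : ℕ)) =
      (e - b) * (edgeOcc e x * x) + dualForce e x b + b * x * dualSeq e x b := by
    intro b hb
    have h := dualSeq_rec hb hx
    unfold dualVar
    rw [← mul_div_assoc, div_eq_iff (by positivity)]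
    push_cast
    linear_combination h
  unfold sideTerm
  rw [hmain a ha, hmain b hb]
  unfold viewSlack dualVar dualForce
  rcases Nat.eq_zero_or_pos k with rfl | hk
  · push_cast
    ring
  · obtain ⟨a, rfl⟩ : ∃ a', a = a' + 1 := ⟨a - 1, by omega⟩
    obtain ⟨b, rfl⟩ : ∃ b', b = b' + 1 := ⟨b - 1, by omega⟩
    simp only [Nat.add_sub_cancel]
    push_cast
    ring

lemma dualSeq_add_mul_le {e : ℕ} {x ξ : ℝ}
    (hξ : ∀ i < e, dualSeq e x i + ξ ≤ dualSeq e x (i + 1)) {a b : ℕ} (hab : a ≤ b) (hb : b ≤ e) :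
    dualSeq e x a + ξ * (b - a) ≤ dualSeq e x b := by
  induction b, hab using Nat.le_induction with
  | base => simp
  | succ b hab ih =>
    have h1 := ih (by omega)
    have h2 := hξ b (by omega)
    push_cast
    linarith

/-- Monotonicity makes both parts of the slack nonnegative, and a uniform increment ξ quantifies
them: only views with equal counts and no common free neighbour can be tight. -/
lemma le_viewSlack {e : ℕ} {x ξ : ℝ} (hx : 0 < x)
    (hξ : ∀ i < e, dualSeq e x i + ξ ≤ dualSeq e x (i + 1)) {a b k : ℕ} (ha : a ≤ e) (hb : b ≤ e)
    (hka : k ≤ a) (hkb : k ≤ b) :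
    x / 2 * ξ * ((b - a) ^ 2 + 2 * k) ≤ viewSlack e x a b k := by
  have h1 : ξ * (b - a) ^ 2 ≤ ((b : ℝ) - a) * (dualSeq e x b - dualSeq e x a) := by
    rcases le_total a b with h | h
    · have h2 := dualSeq_add_mul_le hξ h hb
      have h3 : (a : ℝ) ≤ b := by exact_mod_cast h
      nlinarith
    · have h2 := dualSeq_add_mul_le hξ h ha
      have h3 : (b : ℝ) ≤ a := by exact_mod_cast h
      nlinarith
  have h2 : ∀ c, k ≤ c → c ≤ e → k * ξ ≤ k * (dualSeq e x c - dualSeq e x (c - 1)) := by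
    intro c hkc hc
    rcases Nat.eq_zero_or_pos k with rfl | hk
    · simp
    · have h3 := hξ (c - 1) (by omega)
      rw [Nat.sub_add_cancel (by omega)] at h3
      exact mul_le_mul_of_nonneg_left (by linarith) (by positivity)
  have h3 := h2 a hka ha
  have h4 := h2 b hkb hb
  unfold viewSlack
  rw [mul_assoc]
  refine mul_le_mul_of_nonneg_left ?_ (by positivity)
  linarith

section ViewSum

variable {V : Type*} [DecidableEq V] {G : SimpleGraph V}

/-- The matchings avoiding both endpoints of the edge `vu`, weighted by a function of the local
view. -/
noncomputable def viewSum (G : SimpleGraph V) (S : Finset V) (x : ℝ) (F : ℕ → ℕ → ℕ → ℝ)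
    (v u : V) : ℝ :=
  ∑ J ∈ matFam G ((S.erase v).erase u), x ^ #J *
    F #(freeNbrs G ((S.erase v).erase u) u J) #(freeNbrs G ((S.erase v).erase u) v J)
      #(freeNbrs G ((S.erase v).erase u) u J ∩ freeNbrs G ((S.erase v).erase u) v J)

lemma viewSum_swap (S : Finset V) (x : ℝ) (F : ℕ → ℕ → ℕ → ℝ) (v u : V) :
    viewSum G S x F u v = viewSum G S x (fun a b k => F b a k) v u := by
  unfold viewSum
  rw [erase_right_comm]
  exact sum_congr rfl fun J _ => by rw [inter_comm]

end ViewSum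

lemma sum_neighborFinset_comm {V : Type*} [Fintype V] {G : SimpleGraph V} [DecidableRel G.Adj]
    {S : Finset V} (hS : Closed G S) (f : V → V → ℝ) :
    ∑ v ∈ S, ∑ u ∈ G.neighborFinset v, f v u = ∑ v ∈ S, ∑ u ∈ G.neighborFinset v, f u v := by
  have h : ∀ f : V → V → ℝ, ∑ v ∈ S, ∑ u ∈ G.neighborFinset v, f v u =
      ∑ v ∈ S, ∑ u ∈ S, if G.Adj v u then f v u else 0 := by
    intro f
    refine sum_congr rfl fun v hv => ?_
    rw [← sum_filter]
    refine sum_congr ?_ fun _ _ => rfl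
    ext u
    rw [mem_filter, SimpleGraph.mem_neighborFinset]
    exact ⟨fun h => ⟨hS v hv u h, h⟩, fun h => h.2⟩
  rw [h, h, sum_comm]
  simp only [G.adj_comm]

variable {V : Type*} [Fintype V] [DecidableEq V] {G : SimpleGraph V} [DecidableRel G.Adj]

lemma card_freeNbrs_le {e : ℕ} (hreg : G.IsRegularOfDegree (e + 1)) {S : Finset V} {u v : V}
    (huv : G.Adj u v) (hv : v ∉ S) (J : Finset (Sym2 V)) : #(freeNbrs G S u J) ≤ e := by
  have h : freeNbrs G S u J ⊆ (G.neighborFinset u).erase v := by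
    intro y hy
    rw [mem_freeNbrs] at hy
    rw [mem_erase, SimpleGraph.mem_neighborFinset]
    exact ⟨fun h => hv (h ▸ hy.1), hy.2.1⟩
  have h2 := card_le_card h
  rwa [card_erase_of_mem ((G.mem_neighborFinset u v).mpr huv),
    SimpleGraph.card_neighborFinset_eq_degree, hreg u, Nat.add_sub_cancel] at h2

lemma filter_not_cov_neighborFinset {S : Finset V} (hS : Closed G S) {v : V} (hv : v ∈ S)
    (M : Finset (Sym2 V)) [DecidablePred (Cov M)] :
    {u ∈ G.neighborFinset v | ¬ Cov M u} = freeNbrs G (S.erase v) v M := by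
  ext u
  rw [mem_filter, mem_freeNbrs, mem_erase, SimpleGraph.mem_neighborFinset]
  exact ⟨fun h => ⟨⟨h.1.ne', hS v hv u h.1⟩, h⟩, fun h => h.2⟩

/-- The dual terms encode a consistency relation: given a matching M avoiding v with U free
neighbours of v, the U free ones each get (d - U) y/U and the d - U covered ones each get -y, where
d = e + 1. If U = 0, then y = 0. -/
lemma sum_viewSum_sideTerm {e : ℕ} (hreg : G.IsRegularOfDegree (e + 1)) {S : Finset V}
    (hS : Closed G S) {x : ℝ} {v : V} (hv : v ∈ S) :
    ∑ u ∈ G.neighborFinset v, viewSum G S x (sideTerm e x) v u = 0 := by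
  classical
  set g : ℕ → ℝ := fun U => ((e + 1 : ℕ) - U : ℝ) * (dualVar e x U / U) with hg
  set h : ℕ → ℝ := fun U => -dualVar e x U with hh
  have h1 : ∀ u ∈ G.neighborFinset v, viewSum G S x (sideTerm e x) v u =
      ∑ M ∈ matFam G (S.erase v), x ^ #M * (if Cov M u then h #(freeNbrs G (S.erase v) v M)
        else g #(freeNbrs G (S.erase v) v M)) := by
    intro u hu
    rw [SimpleGraph.mem_neighborFinset] at hu
    rw [sum_matFam_erase_eq (mem_erase.mpr ⟨hu.ne', hS v hv u hu⟩) hu x g h]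
    rfl
  rw [sum_congr rfl h1, sum_comm]
  refine sum_eq_zero fun M _ => ?_
  rw [← mul_sum, sum_ite, sum_const, sum_const, filter_not_cov_neighborFinset hS hv]
  have h2 := card_filter_add_card_filter_not (s := G.neighborFinset v) (fun u => Cov M u)
  rw [filter_not_cov_neighborFinset hS hv, SimpleGraph.card_neighborFinset_eq_degree, hreg v] at h2
  set U := #(freeNbrs G (S.erase v) v M)
  have h3 : (#{u ∈ G.neighborFinset v | Cov M u} : ℝ) = (e + 1 : ℕ) - U := by
    rw [← h2]; push_cast; ring
  rw [nsmul_eq_mul, nsmul_eq_mul, h3]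
  simp only [hg, hh]
  rcases Nat.eq_zero_or_pos U with h0 | h0
  · rw [h0]; simp [dualVar]
  · field_simp
    ring

/-- The occupancy identity for matchings: the defect in the occupancy inequality is the sum of the
slacks of the local views. -/
lemma mat_occupancy_identity {e : ℕ} (hreg : G.IsRegularOfDegree (e + 1)) {S : Finset V}
    (hS : Closed G S) {x : ℝ} (hx : 0 < x) :
    ∑ v ∈ S, ∑ u ∈ G.neighborFinset v, viewSum G S x (viewSlack e x) v u =
      edgeOcc e x * (e + 1) * #S * (genPoly (matFam G S)).eval x -
        2 * (x * (genPoly (matFam G S)).derivative.eval x) := by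
  classical
  set Z := (genPoly (matFam G S)).eval x with hZ
  have hsplit : ∀ v ∈ S, ∀ u ∈ G.neighborFinset v, viewSum G S x (viewSlack e x) v u =
      edgeOcc e x * Z + (viewSum G S x (sideTerm e x) v u +
        viewSum G S x (sideTerm e x) u v) / 2 - viewSum G S x (fun _ _ _ => x) v u := by
    intro v hv u hu
    rw [SimpleGraph.mem_neighborFinset] at hu
    have huS : u ∈ S.erase v := mem_erase.mpr ⟨hu.ne', hS v hv u hu⟩
    -- The partition function is expanded over the local views of this edge, so that the slack
    -- identity applies view by view.
    have hZ' := sum_matFam_erase_eq huS hu x (fun U => 1 + x * U) (fun U => 1 + x * U)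
    simp only [ite_self] at hZ'
    rw [hZ, eval_genPoly_matFam hv, hZ', viewSum_swap S x (sideTerm e x) v u]
    unfold viewSum
    rw [← sum_add_distrib, sum_div, mul_sum, ← sum_add_distrib, ← sum_sub_distrib]
    refine sum_congr rfl fun J _ => ?_
    have hle1 := card_freeNbrs_le hreg hu.symm
      (show v ∉ (S.erase v).erase u by simp) J
    have hle2 := card_freeNbrs_le hreg hu
      (show u ∉ (S.erase v).erase u by simp) J
    rw [← local_view_mat hx hle1 hle2 (card_le_card inter_subset_left)
      (card_le_card inter_subset_right)]
    ring
  -- The constant view function x is the weight of adding the edge vu itself; over all u this counts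
  -- the matchings covering v.
  have hocc : ∀ v ∈ S, ∑ u ∈ G.neighborFinset v, viewSum G S x (fun _ _ _ => x) v u =
      ∑ M ∈ matFam G S, if Cov M v then x ^ #M else 0 := by
    intro v hv
    have h1 : ∀ u ∈ G.neighborFinset v, viewSum G S x (fun _ _ _ => x) v u =
        ∑ M ∈ matFam G (S.erase v), x ^ #M * (if Cov M u then 0 else x) := by
      intro u hu
      rw [SimpleGraph.mem_neighborFinset] at hu
      have := sum_matFam_erase_eq (mem_erase.mpr ⟨hu.ne', hS v hv u hu⟩) hu x
        (fun _ => x) (fun _ => 0)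
      rw [this]
      simp [viewSum]
    rw [sum_matFam_ite_cov hv, sum_congr rfl h1, sum_comm]
    refine sum_congr rfl fun M _ => ?_
    rw [← mul_sum, sum_ite, filter_not_cov_neighborFinset hS hv, sum_const, sum_const,
      smul_zero, zero_add, nsmul_eq_mul, pow_succ]
    ring
  have htot : ∑ v ∈ S, ∑ M ∈ matFam G S, (if Cov M v then x ^ #M else 0) =
      2 * (x * (genPoly (matFam G S)).derivative.eval x) := by
    rw [sum_comm, mul_eval_derivative_genPoly, mul_sum]
    refine sum_congr rfl fun M hM => ?_
    have h1 := sum_ite_cov hM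
    have h2 : ∑ v ∈ S, (if Cov M v then x ^ #M else 0) =
        x ^ #M * ((∑ v ∈ S, if Cov M v then 1 else 0 : ℕ) : ℝ) := by
      push_cast
      rw [mul_sum]
      exact sum_congr rfl fun v _ => by split_ifs <;> simp
    rw [h2, h1]
    push_cast
    ring
  have hside : ∑ v ∈ S, ∑ u ∈ G.neighborFinset v, viewSum G S x (sideTerm e x) v u = 0 :=
    sum_eq_zero fun v hv => sum_viewSum_sideTerm hreg hS hv
  have hside' : ∑ v ∈ S, ∑ u ∈ G.neighborFinset v, viewSum G S x (sideTerm e x) u v = 0 := by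
    rw [← sum_neighborFinset_comm hS fun v u => viewSum G S x (sideTerm e x) v u, hside]
  have hconst : ∑ v ∈ S, ∑ u ∈ G.neighborFinset v, edgeOcc e x * Z =
      edgeOcc e x * (e + 1) * #S * Z := by
    have : ∀ v ∈ S, ∑ u ∈ G.neighborFinset v, edgeOcc e x * Z =
        (e + 1 : ℕ) * (edgeOcc e x * Z) := fun v _ => by
      rw [sum_const, nsmul_eq_mul, SimpleGraph.card_neighborFinset_eq_degree, hreg v]
    rw [sum_congr rfl this, sum_const, nsmul_eq_mul]
    push_cast
    ring
  calc ∑ v ∈ S, ∑ u ∈ G.neighborFinset v, viewSum G S x (viewSlack e x) v u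
      = ∑ v ∈ S, ∑ u ∈ G.neighborFinset v, edgeOcc e x * Z +
        (∑ v ∈ S, ∑ u ∈ G.neighborFinset v, viewSum G S x (sideTerm e x) v u +
          ∑ v ∈ S, ∑ u ∈ G.neighborFinset v, viewSum G S x (sideTerm e x) u v) / 2 -
        ∑ v ∈ S, ∑ u ∈ G.neighborFinset v, viewSum G S x (fun _ _ _ => x) v u := by
        rw [← sum_add_distrib, sum_div, ← sum_add_distrib, ← sum_sub_distrib]
        refine sum_congr rfl fun v hv => ?_
        rw [← sum_add_distrib, sum_div, ← sum_add_distrib, ← sum_sub_distrib]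
        exact sum_congr rfl (hsplit v hv)
    _ = _ := by
        rw [hside, hside', hconst, sum_congr rfl hocc, htot]
        ring

end RegularSlices

/-! ### The occupancy inequality and its stability for matchings. -/

namespace RegularSlices

variable {V : Type*} [Fintype V] [DecidableEq V] {G : SimpleGraph V} [DecidableRel G.Adj]

lemma le_viewSum_viewSlack {e : ℕ} (hreg : G.IsRegularOfDegree (e + 1)) {S : Finset V} {x ξ : ℝ}
    (hx : 0 < x) (hξ : ∀ i < e, dualSeq e x i + ξ ≤ dualSeq e x (i + 1)) {v u : V}
    (hvu : G.Adj v u) :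
    viewSum G S x (fun a b k => x / 2 * ξ * ((b - a) ^ 2 + 2 * k)) v u ≤
      viewSum G S x (viewSlack e x) v u := by
  refine sum_le_sum fun J _ => mul_le_mul_of_nonneg_left ?_ (by positivity)
  exact le_viewSlack hx hξ
    (card_freeNbrs_le hreg hvu.symm (show v ∉ (S.erase v).erase u by simp) J)
    (card_freeNbrs_le hreg hvu (show u ∉ (S.erase v).erase u by simp) J)
    (card_le_card inter_subset_left) (card_le_card inter_subset_right)

lemma viewSum_viewSlack_nonneg {e : ℕ} (he : 1 ≤ e) (hreg : G.IsRegularOfDegree (e + 1))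
    {S : Finset V} {x : ℝ} (hx : 0 < x) {v u : V} (hvu : G.Adj v u) :
    0 ≤ viewSum G S x (viewSlack e x) v u := by
  refine le_trans (le_of_eq ?_) (le_viewSum_viewSlack hreg hx (ξ := 0) (fun i hi => by
    rw [add_zero]; exact (dualSeq_lt_succ he hx i hi).le) hvu)
  simp [viewSum]

/-- The occupancy identity in terms of the matching polynomial of `K_{d,d}`. -/
lemma sum_viewSum_viewSlack_mul_eval {e : ℕ} (hreg : G.IsRegularOfDegree (e + 1)) {S : Finset V}
    (hS : Closed G S) {s : ℕ} (hs : #S = 2 * (e + 1) * s) {x : ℝ} (hx : 0 < x) :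
    (∑ v ∈ S, ∑ u ∈ G.neighborFinset v, viewSum G S x (viewSlack e x) v u) *
        (matPoly (e + 1)).eval x =
      2 * x * (s * (matPoly (e + 1)).derivative.eval x * (genPoly (matFam G S)).eval x -
        (genPoly (matFam G S)).derivative.eval x * (matPoly (e + 1)).eval x) := by
  have hP := eval_matPoly_pos (e + 1) hx.le
  rw [mat_occupancy_identity hreg hS hx, derivative_matPoly, hs, edgeOcc, eval_mul, eval_C]
  field_simp
  push_cast
  ring

lemma genPoly_matFam_derivative_le {e : ℕ} (he : 1 ≤ e) (hreg : G.IsRegularOfDegree (e + 1))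
    {S : Finset V} (hS : Closed G S) {s : ℕ} (hs : #S = 2 * (e + 1) * s) {x : ℝ} (hx : 0 < x) :
    (genPoly (matFam G S)).derivative.eval x * (matPoly (e + 1)).eval x ≤
      s * (matPoly (e + 1)).derivative.eval x * (genPoly (matFam G S)).eval x := by
  have h := sum_viewSum_viewSlack_mul_eval hreg hS hs hx
  have h2 : 0 ≤ ∑ v ∈ S, ∑ u ∈ G.neighborFinset v, viewSum G S x (viewSlack e x) v u :=
    sum_nonneg fun v _ => sum_nonneg fun u hu =>
      viewSum_viewSlack_nonneg he hreg hx ((G.mem_neighborFinset v u).mp hu)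
  have h3 := mul_nonneg h2 (eval_matPoly_pos (e + 1) hx.le).le
  rw [h] at h3
  have := nonneg_of_mul_nonneg_right h3 (by positivity)
  linarith

/-- If `v` is not in a copy of `K_{d,d}`, some edge at `v` has a nontrivial local view with
probability bounded below. -/
lemma exists_sum_nontrivial_edge_view_ge {e : ℕ} (hreg : G.IsRegularOfDegree (e + 1))
    {S : Finset V} (hS : Closed G S) {v : V} (hv : v ∈ S) (hK : ¬ InKdd G v) {a b x : ℝ}
    (ha : 0 < a) (ha1 : a ≤ 1) (hb : 1 ≤ b) (hax : a ≤ x) (hxb : x ≤ b) :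
    ∃ u, G.Adj v u ∧ (genPoly (matFam G S)).eval x ≤
      (2 * b / a) ^ ((2 * e + 6) * (e + 1)) *
        viewSum G S x (fun a b k => ((b - a) ^ 2 + 2 * k)) v u := by
  unfold InKdd at hK
  push Not at hK
  obtain ⟨w, w', hw, hw', u, hwu, hw'u⟩ := hK
  have hx : 0 < x := ha.trans_le hax
  have huv : u ≠ v := fun h => hw'u (h ▸ hw'.symm)
  have hww' : w ≠ w' := fun h => hw'u (h ▸ hwu)
  have hwS : w ∈ S := hS v hv w hw
  have huS : u ∈ S := hS w hwS u hwu
  have hw'S : w' ∈ S := hS v hv w' hw'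
  refine ⟨w', hw', ?_⟩
  -- The edge examined is vw'. All matching edges meeting T are deleted, and the edge wu is inserted
  -- unless w ~ w'.
  set T : Finset V := {w, u} ∪ (insert v (G.neighborFinset v) ∪ insert w' (G.neighborFinset w'))
    with hT
  set B : Finset (Sym2 V) := T.biUnion fun z => G.incidenceFinset z with hB
  set E₀ : Finset (Sym2 V) := if G.Adj w w' then ∅ else {s(w, u)} with hE₀
  have hE₀m : ∀ g ∈ E₀, g = s(w, u) ∧ ¬ G.Adj w w' := by
    intro g hg
    rw [hE₀] at hg
    split_ifs at hg with h
    · simp at hg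
    · exact ⟨mem_singleton.mp hg, h⟩
  have hBm : ∀ g ∈ G.edgeSet, g ∉ B → ∀ z ∈ T, z ∉ g := by
    intro g hg hgB z hz hzg
    refine hgB (mem_biUnion.mpr ⟨z, hz, ?_⟩)
    rw [SimpleGraph.mem_incidenceFinset]
    exact ⟨hg, hzg⟩
  have hwT : w ∈ T := by simp [hT]
  have huT : u ∈ T := by simp [hT]
  have hvT : v ∈ T := by simp [hT]
  have hw'T : w' ∈ T := by simp [hT]
  have hNw'T : ∀ y, G.Adj w' y → y ∈ T := fun y hy => by simp [hT, hy]
  rw [eval_genPoly]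
  set S₂ := (S.erase v).erase w' with hS₂
  have hfe := sum_pow_card_le_of_modify (𝓐 := matFam G S)
    (𝓑 := {J ∈ matFam G S₂ | #(freeNbrs G S₂ w' J) ≠ #(freeNbrs G S₂ v J) ∨
      1 ≤ #(freeNbrs G S₂ w' J ∩ freeNbrs G S₂ v J)})
    (B := B) (E₀ := E₀) (K := (2 * e + 6) * (e + 1)) ?_ ?_ ha ha1 hb hax hxb ?_
  · refine hfe.trans (mul_le_mul_of_nonneg_left ?_ (by positivity))
    unfold viewSum
    rw [← hS₂]
    refine le_trans (sum_le_sum fun J hJ => ?_)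
      (sum_le_sum_of_subset_of_nonneg (filter_subset _ _) fun J _ _ => by positivity)
    refine le_mul_of_one_le_right (by positivity) ?_
    rcases (mem_filter.mp hJ).2 with h | h
    · have h1 : (1 : ℝ) ≤ ((#(freeNbrs G S₂ v J) : ℝ) - #(freeNbrs G S₂ w' J)) ^ 2 := by
        have h2 : (1 : ℤ) ≤ ((#(freeNbrs G S₂ v J) : ℤ) - #(freeNbrs G S₂ w' J)) ^ 2 := by
          have h3 : (#(freeNbrs G S₂ v J) : ℤ) - #(freeNbrs G S₂ w' J) ≠ 0 := by omega
          have := sq_pos_of_ne_zero h3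
          omega
        exact_mod_cast h2
      have : (0 : ℝ) ≤ 2 * #(freeNbrs G S₂ w' J ∩ freeNbrs G S₂ v J) := by positivity
      linarith
    · have h1 : (1 : ℝ) ≤ #(freeNbrs G S₂ w' J ∩ freeNbrs G S₂ v J) := by exact_mod_cast h
      have := sq_nonneg ((#(freeNbrs G S₂ v J) : ℝ) - #(freeNbrs G S₂ w' J))
      linarith
  · intro g hg
    rw [(hE₀m g hg).1]
    refine mem_biUnion.mpr ⟨w, hwT, ?_⟩
    rw [SimpleGraph.mem_incidenceFinset]
    exact ⟨hwu, Sym2.mem_mk_left w u⟩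
  · intro M hM
    rw [mem_matFam] at hM
    set J := M \ B ∪ E₀ with hJ
    have hJm : ∀ g ∈ J, (g ∈ M ∧ ∀ z ∈ T, z ∉ g) ∨ (g = s(w, u) ∧ ¬ G.Adj w w') := by
      intro g hg
      rcases mem_union.mp hg with h | h
      · obtain ⟨h1, h2⟩ := mem_sdiff.mp h
        exact Or.inl ⟨h1, hBm g (hM.1 g h1).1 h2⟩
      · exact Or.inr (hE₀m g h)
    have hJmat : J ∈ matFam G S₂ := by
      rw [mem_matFam]
      refine ⟨fun g hg => ?_, fun g hg g' hg' z hz hz' => ?_⟩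
      · rcases hJm g hg with ⟨h1, h2⟩ | ⟨rfl, h2⟩
        · refine ⟨(hM.1 g h1).1, fun z hz => mem_erase.mpr ⟨?_, mem_erase.mpr
            ⟨?_, (hM.1 g h1).2 z hz⟩⟩⟩
          · rintro rfl; exact h2 z hw'T hz
          · rintro rfl; exact h2 z hvT hz
        · refine ⟨hwu, fun z hz => ?_⟩
          rcases Sym2.mem_iff.mp hz with rfl | rfl
          · exact mem_erase.mpr ⟨hww', mem_erase.mpr ⟨hw.ne', hwS⟩⟩
          · refine mem_erase.mpr ⟨?_, mem_erase.mpr ⟨huv, huS⟩⟩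
            rintro rfl
            exact h2 hwu
      · have hwuT : ∀ z ∈ s(w, u), z ∈ T := by
          intro z hz
          rcases Sym2.mem_iff.mp hz with h | h
          · rw [h]; exact hwT
          · rw [h]; exact huT
        rcases hJm g hg with ⟨h1, h2⟩ | ⟨h1, h2⟩ <;> rcases hJm g' hg' with ⟨h3, h4⟩ | ⟨h3, h4⟩
        · exact hM.2 g h1 g' h3 z hz hz'
        · exact absurd hz (h2 z (hwuT z (h3 ▸ hz')))
        · exact absurd hz' (h4 z (hwuT z (h1 ▸ hz)))
        · rw [h1, h3]
    rw [mem_filter]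
    refine ⟨hJmat, ?_⟩
    -- If w ~ w', then w is a common free neighbour. Otherwise w' has all its e other neighbours
    -- free, while v has lost w to the edge wu, so the two counts differ.
    by_cases hadj : G.Adj w w'
    · right
      rw [Nat.one_le_iff_ne_zero, ← pos_iff_ne_zero, card_pos]
      have hnc : ¬ Cov J w := by
        rintro ⟨g, hg, hwg⟩
        rcases hJm g hg with ⟨-, h2⟩ | ⟨-, h2⟩
        · exact h2 w hwT hwg
        · exact h2 hadj
      have hwS₂ : w ∈ S₂ := mem_erase.mpr ⟨hww', mem_erase.mpr ⟨hw.ne', hwS⟩⟩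
      exact ⟨w, mem_inter.mpr ⟨mem_freeNbrs.mpr ⟨hwS₂, hadj.symm, hnc⟩,
        mem_freeNbrs.mpr ⟨hwS₂, hw, hnc⟩⟩⟩
    · left
      have h1 : (G.neighborFinset w').erase v ⊆ freeNbrs G S₂ w' J := by
        intro y hy
        rw [mem_erase, SimpleGraph.mem_neighborFinset] at hy
        refine mem_freeNbrs.mpr ⟨mem_erase.mpr ⟨hy.2.ne', mem_erase.mpr ⟨hy.1, hS w' hw'S y hy.2⟩⟩,
          hy.2, ?_⟩
        rintro ⟨g, hg, hyg⟩
        rcases hJm g hg with ⟨-, h2⟩ | ⟨rfl, -⟩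
        · exact h2 y (hNw'T y hy.2) hyg
        · rcases Sym2.mem_iff.mp hyg with rfl | rfl
          · exact hadj hy.2.symm
          · exact hw'u hy.2
      have h2 : freeNbrs G S₂ v J ⊆ ((G.neighborFinset v).erase w').erase w := by
        intro y hy
        obtain ⟨hy1, hy2, hy3⟩ := mem_freeNbrs.mp hy
        refine mem_erase.mpr ⟨?_, mem_erase.mpr ⟨(mem_erase.mp hy1).1,
          (G.mem_neighborFinset v y).mpr hy2⟩⟩
        rintro rfl
        refine hy3 ⟨s(y, u), ?_, Sym2.mem_mk_left y u⟩
        rw [hJ, mem_union, hE₀, if_neg hadj]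
        simp
      have h3 := card_le_card h1
      have h4 := card_le_card h2
      have hNw : w ∈ (G.neighborFinset v).erase w' :=
        mem_erase.mpr ⟨hww', (G.mem_neighborFinset v w).mpr hw⟩
      have hpos : 0 < #((G.neighborFinset v).erase w') := card_pos.mpr ⟨w, hNw⟩
      rw [card_erase_of_mem ((G.mem_neighborFinset w' v).mpr hw'.symm),
        SimpleGraph.card_neighborFinset_eq_degree, hreg w'] at h3
      rw [card_erase_of_mem hNw] at h4
      rw [card_erase_of_mem ((G.mem_neighborFinset v w').mpr hw'),
        SimpleGraph.card_neighborFinset_eq_degree, hreg v] at h4 hpos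
      omega
  · have hN : ∀ z, #(insert z (G.neighborFinset z)) ≤ e + 2 := fun z => by
      refine (card_insert_le _ _).trans ?_
      rw [SimpleGraph.card_neighborFinset_eq_degree, hreg z]
    have h1 := hN v
    have h2 := hN w'
    have h3 := card_union_le ({w, u} : Finset V)
      (insert v (G.neighborFinset v) ∪ insert w' (G.neighborFinset w'))
    have h4 := card_union_le (insert v (G.neighborFinset v)) (insert w' (G.neighborFinset w'))
    have h5 : #({w, u} : Finset V) ≤ 2 := card_le_two
    have h6 : #T ≤ 2 * e + 6 := by rw [hT]; omega
    refine (card_biUnion_le_card_mul T _ (e + 1) fun z _ => ?_).trans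
      (Nat.mul_le_mul_right _ h6)
    rw [SimpleGraph.card_incidenceFinset_eq_degree, hreg z]

/-- Stability of the occupancy inequality for matchings. -/
lemma exists_genPoly_matFam_derivative_add_le {e : ℕ} (he : 1 ≤ e) {a b : ℝ} (ha : 0 < a)
    (hab : a ≤ b) : ∃ c > 0, ∀ {V : Type*} [Fintype V] [DecidableEq V] (G : SimpleGraph V)
      [DecidableRel G.Adj], G.IsRegularOfDegree (e + 1) → ∀ S : Finset V, Closed G S →
      (∀ v ∈ S, ¬ InKdd G v) → ∀ s : ℕ, #S = 2 * (e + 1) * s → ∀ x, a ≤ x → x ≤ b →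
      (genPoly (matFam G S)).derivative.eval x * (matPoly (e + 1)).eval x +
        c * s * ((genPoly (matFam G S)).eval x * (matPoly (e + 1)).eval x) ≤
      s * (matPoly (e + 1)).derivative.eval x * (genPoly (matFam G S)).eval x := by
  have hb : 0 < b := ha.trans_le hab
  set K := (2 * max b 1 / min a 1) ^ ((2 * e + 6) * (e + 1)) with hK
  have hK0 : 0 < K := by positivity
  obtain ⟨ξ, hξ0, hξ⟩ := exists_forall_add_le_dualSeq_succ he ha hab
  -- One good edge at each of the 2(e + 1)s vertices yields slack (x/2) ξ Z/K; the identity is then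
  -- divided by 2x.
  refine ⟨(e + 1) * ξ / (2 * K), by positivity, ?_⟩
  intro V _ _ G _ hreg S hS hnK s hs x hax hxb
  have hx : 0 < x := ha.trans_le hax
  have hid := sum_viewSum_viewSlack_mul_eval hreg hS hs hx
  have hP := eval_matPoly_pos (e + 1) hx.le
  set Z := (genPoly (matFam G S)).eval x with hZ
  have hlow : #S * (x / 2 * ξ * (Z / K)) ≤
      ∑ v ∈ S, ∑ u ∈ G.neighborFinset v, viewSum G S x (viewSlack e x) v u := by
    rw [← nsmul_eq_mul, ← sum_const]
    refine sum_le_sum fun v hv => ?_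
    obtain ⟨u, hvu, hfe⟩ := exists_sum_nontrivial_edge_view_ge hreg hS hv (hnK v hv)
      (a := min a 1) (b := max b 1) (lt_min ha one_pos) (min_le_right _ _) (le_max_right _ _)
      ((min_le_left _ _).trans hax) (hxb.trans (le_max_left _ _))
    rw [← hK, ← hZ, ← div_le_iff₀' hK0] at hfe
    calc x / 2 * ξ * (Z / K) ≤ x / 2 * ξ * _ := mul_le_mul_of_nonneg_left hfe (by positivity)
      _ = viewSum G S x (fun a b k => x / 2 * ξ * ((b - a) ^ 2 + 2 * k)) v u := by
          unfold viewSum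
          rw [mul_sum]
          exact sum_congr rfl fun J _ => by ring
      _ ≤ viewSum G S x (viewSlack e x) v u :=
          le_viewSum_viewSlack hreg hx (hξ x hax hxb) hvu
      _ ≤ _ := single_le_sum (f := fun u => viewSum G S x (viewSlack e x) v u)
          (fun u hu => viewSum_viewSlack_nonneg he hreg hx ((G.mem_neighborFinset v u).mp hu))
          ((G.mem_neighborFinset v u).mpr hvu)
  have h1 := mul_le_mul_of_nonneg_right hlow hP.le
  rw [hid, hs] at h1
  have h2 : 2 * x * ((e + 1) * ξ / (2 * K) * s * (Z * (matPoly (e + 1)).eval x)) =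
      ((2 * (e + 1) * s : ℕ) : ℝ) * (x / 2 * ξ * (Z / K)) * (matPoly (e + 1)).eval x := by
    push_cast
    field_simp
  rw [← h2] at h1
  have := le_of_mul_le_mul_left h1 (by positivity)
  linarith

end RegularSlices

/-! ### Log-concavity, products over closed sets, and splitting off the K_{d,d} components. -/

namespace RegularSlices

variable {V : Type*} {G : SimpleGraph V}

section Choose

/-- The factors i + 2 and i + 1 are kept because the factorials in `matPoly` cost exactly the ratio
(i + 2)/(i + 1). -/
lemma choose_mul_choose_mul_le (d i : ℕ) (h : i + 2 ≤ d) :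
    (d.choose i : ℝ) * d.choose (i + 2) * (i + 2) ≤ (d.choose (i + 1) : ℝ) ^ 2 * (i + 1) := by
  have h1 : (d.choose (i + 1) : ℝ) * (i + 1) = d.choose i * (d - i) := by
    rw [← Nat.cast_sub (by omega)]
    exact_mod_cast Nat.choose_succ_right_eq d i
  have h2 : (d.choose (i + 2) : ℝ) * (i + 2) = d.choose (i + 1) * (d - i - 1) := by
    have := Nat.choose_succ_right_eq d (i + 1)
    have h3 : ((d - (i + 1) : ℕ) : ℝ) = d - i - 1 := by
      rw [Nat.cast_sub (by omega)]; push_cast; ring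
    rw [← h3]
    exact_mod_cast this
  have hd : (0 : ℝ) < d - i := by
    have : ((i + 2 : ℕ) : ℝ) ≤ d := by exact_mod_cast h
    push_cast at this
    linarith
  refine le_of_mul_le_mul_right ?_ hd
  calc (d.choose i : ℝ) * d.choose (i + 2) * (i + 2) * (d - i)
      = (d.choose i * (d - i)) * (d.choose (i + 2) * (i + 2)) := by ring
    _ = (d.choose (i + 1) : ℝ) ^ 2 * (i + 1) * (d - i - 1) := by rw [← h1, h2]; ring
    _ ≤ _ := mul_le_mul_of_nonneg_left (by linarith) (by positivity)

lemma choose_mul_choose_le_sq (d i : ℕ) (h : i + 2 ≤ d) :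
    (d.choose i : ℝ) * d.choose (i + 2) ≤ (d.choose (i + 1) : ℝ) ^ 2 := by
  have h1 := choose_mul_choose_mul_le d i h
  have h2 : (d.choose (i + 1) : ℝ) ^ 2 * (i + 1) ≤ (d.choose (i + 1) : ℝ) ^ 2 * (i + 2) :=
    mul_le_mul_of_nonneg_left (by linarith) (by positivity)
  exact le_of_mul_le_mul_right (h1.trans h2) (by positivity)

lemma coeff_indPoly (d k : ℕ) :
    (indPoly d).coeff k = 2 * d.choose k - if k = 0 then 1 else 0 := by
  rw [indPoly, coeff_sub, coeff_one, ← C_ofNat, coeff_C_mul, coeff_one_add_X_pow]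

/-- Only the constant coefficient differs from twice a binomial; lowering it helps, since it appears
only on the smaller side. -/
lemma logConcavePoly_indPoly (d : ℕ) : LogConcavePoly (indPoly d) d := by
  refine ⟨?_, fun i hi => ?_, fun i hi => ?_⟩
  · rw [natDegree_le_iff_coeff_eq_zero]
    intro n hn
    rw [coeff_indPoly, Nat.choose_eq_zero_of_lt hn, if_neg (by omega)]
    simp
  · rw [coeff_indPoly]
    have : (1 : ℝ) ≤ d.choose i := by exact_mod_cast Nat.choose_pos hi
    split_ifs <;> linarith
  · rw [coeff_indPoly, coeff_indPoly, coeff_indPoly, if_neg (by omega : ¬ i + 2 = 0),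
      if_neg (by omega : ¬ i + 1 = 0)]
    have h := choose_mul_choose_le_sq d i hi
    have h2 : (0 : ℝ) ≤ d.choose (i + 2) := by positivity
    split_ifs <;> nlinarith

lemma logConcavePoly_matPoly (d : ℕ) : LogConcavePoly (matPoly d) d := by
  refine ⟨?_, fun i hi => ?_, fun i hi => ?_⟩
  · rw [natDegree_le_iff_coeff_eq_zero]
    intro n hn
    rw [coeff_matPoly, Nat.choose_eq_zero_of_lt hn]
    simp
  · rw [coeff_matPoly]
    have : 0 < d.choose i := Nat.choose_pos hi
    positivity
  · rw [coeff_matPoly, coeff_matPoly, coeff_matPoly]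
    have h1 := choose_mul_choose_mul_le d i hi
    have h2 := choose_mul_choose_le_sq d i hi
    rw [Nat.factorial_succ (i + 1), Nat.factorial_succ i]
    push_cast
    have h3 := mul_le_mul h1 h2 (by positivity) (by positivity)
    have h4 : (0 : ℝ) ≤ i.factorial ^ 2 * (i + 1) := by positivity
    calc (d.choose i : ℝ) ^ 2 * i.factorial *
          (d.choose (i + 2) ^ 2 * ((i + 1 + 1) * ((i + 1) * i.factorial)))
        = (i.factorial ^ 2 * (i + 1)) * ((d.choose i : ℝ) * d.choose (i + 2) * (i + 2) *
            (d.choose i * d.choose (i + 2))) := by ring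
      _ ≤ (i.factorial ^ 2 * (i + 1)) * ((d.choose (i + 1) : ℝ) ^ 2 * (i + 1) *
            d.choose (i + 1) ^ 2) := mul_le_mul_of_nonneg_left h3 h4
      _ = _ := by ring

end Choose

section GenPolyFacts

variable {E : Type*} {F : Finset (Finset E)}

lemma eval_zero_genPoly (h : ∅ ∈ F) : (genPoly F).eval 0 = 1 := by
  classical
  rw [eval_genPoly, sum_eq_single ∅]
  · simp
  · intro I _ hI
    rw [zero_pow (by rwa [Ne, card_eq_zero])]
  · exact fun h' => absurd h h'

lemma eval_genPoly_pos (h : ∅ ∈ F) {x : ℝ} (hx : 0 ≤ x) : 0 < (genPoly F).eval x := by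
  rw [eval_genPoly]
  refine lt_of_lt_of_le one_pos ?_
  have := single_le_sum (f := fun I : Finset E => x ^ #I) (fun I _ => pow_nonneg hx _) h
  simpa using this

/-- The generating polynomial of a product family. -/
lemma genPoly_eq_mul {F₁ F₂ : Finset (Finset E)} [DecidableEq E]
    (hdisj : ∀ I ∈ F₁, ∀ J ∈ F₂, Disjoint I J) (hmem : ∀ I ∈ F₁, ∀ J ∈ F₂, I ∪ J ∈ F)
    (hinj : ∀ I ∈ F₁, ∀ J ∈ F₂, ∀ I' ∈ F₁, ∀ J' ∈ F₂, I ∪ J = I' ∪ J' → I = I' ∧ J = J')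
    (hsurj : ∀ K ∈ F, ∃ I ∈ F₁, ∃ J ∈ F₂, I ∪ J = K) :
    genPoly F = genPoly F₁ * genPoly F₂ := by
  unfold genPoly
  rw [sum_mul_sum, ← sum_product']
  symm
  refine sum_bij (fun p _ => p.1 ∪ p.2) ?_ ?_ ?_ ?_
  · rintro ⟨I, J⟩ h
    obtain ⟨h1, h2⟩ := mem_product.mp h
    exact hmem I h1 J h2
  · rintro ⟨I, J⟩ h ⟨I', J'⟩ h' heq
    obtain ⟨h1, h2⟩ := mem_product.mp h
    obtain ⟨h1', h2'⟩ := mem_product.mp h'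
    obtain ⟨e1, e2⟩ := hinj I h1 J h2 I' h1' J' h2' heq
    exact Prod.ext e1 e2
  · intro K hK
    obtain ⟨I, hI, J, hJ, h⟩ := hsurj K hK
    exact ⟨(I, J), mem_product.mpr ⟨hI, hJ⟩, h⟩
  · rintro ⟨I, J⟩ h
    obtain ⟨h1, h2⟩ := mem_product.mp h
    rw [card_union_of_disjoint (hdisj I h1 J h2), pow_add]

end GenPolyFacts

section Union

variable [DecidableEq V] {A B : Finset V}

lemma genPoly_indFam_union (hd : Disjoint A B) (hAB : ∀ a ∈ A, ∀ b ∈ B, ¬ G.Adj a b) :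
    genPoly (indFam G (A ∪ B)) = genPoly (indFam G A) * genPoly (indFam G B) := by
  refine genPoly_eq_mul ?_ ?_ ?_ ?_
  · intro I hI J hJ
    exact disjoint_of_subset_left (mem_indFam.mp hI).1
      (disjoint_of_subset_right (mem_indFam.mp hJ).1 hd)
  · intro I hI J hJ
    rw [mem_indFam] at *
    refine ⟨union_subset_union hI.1 hJ.1, fun u hu w hw => ?_⟩
    rcases mem_union.mp hu with hu | hu <;> rcases mem_union.mp hw with hw | hw
    · exact hI.2 u hu w hw
    · exact hAB u (hI.1 hu) w (hJ.1 hw)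
    · exact fun h => hAB w (hI.1 hw) u (hJ.1 hu) h.symm
    · exact hJ.2 u hu w hw
  · intro I hI J hJ I' hI' J' hJ' h
    have key : ∀ I ∈ indFam G A, ∀ J ∈ indFam G B, (I ∪ J) ∩ A = I ∧ (I ∪ J) ∩ B = J := by
      intro I hI J hJ
      have h1 := (mem_indFam.mp hI).1
      have h2 := (mem_indFam.mp hJ).1
      rw [disjoint_left] at hd
      constructor
      · ext w; rw [mem_inter, mem_union]
        exact ⟨fun h => h.1.resolve_right fun h3 => hd h.2 (h2 h3), fun h => ⟨Or.inl h, h1 h⟩⟩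
      · ext w; rw [mem_inter, mem_union]
        exact ⟨fun h => h.1.resolve_left fun h3 => hd (h1 h3) h.2, fun h => ⟨Or.inr h, h2 h⟩⟩
    obtain ⟨e1, e2⟩ := key I hI J hJ
    obtain ⟨e1', e2'⟩ := key I' hI' J' hJ'
    exact ⟨by rw [← e1, h, e1'], by rw [← e2, h, e2']⟩
  · intro K hK
    rw [mem_indFam] at hK
    refine ⟨K ∩ A, mem_indFam.mpr ⟨inter_subset_right, fun u hu w hw =>
      hK.2 u (mem_inter.mp hu).1 w (mem_inter.mp hw).1⟩, K ∩ B, mem_indFam.mpr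
      ⟨inter_subset_right, fun u hu w hw => hK.2 u (mem_inter.mp hu).1 w (mem_inter.mp hw).1⟩, ?_⟩
    rw [← inter_union_distrib_left, inter_eq_left.mpr hK.1]

lemma genPoly_matFam_union (hd : Disjoint A B) (hAB : ∀ a ∈ A, ∀ b ∈ B, ¬ G.Adj a b) :
    genPoly (matFam G (A ∪ B)) = genPoly (matFam G A) * genPoly (matFam G B) := by
  have hne : ∀ e : Sym2 V, ∃ v, v ∈ e := fun e => by
    induction e with | h x y => exact ⟨x, Sym2.mem_mk_left x y⟩
  have hsep : ∀ e : Sym2 V, (∀ v ∈ e, v ∈ A) → (∀ v ∈ e, v ∈ B) → False := by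
    intro e h1 h2
    obtain ⟨v, hv⟩ := hne e
    exact disjoint_left.mp hd (h1 v hv) (h2 v hv)
  refine genPoly_eq_mul ?_ ?_ ?_ ?_
  · intro I hI J hJ
    rw [disjoint_left]
    intro e he he'
    exact hsep e ((mem_matFam.mp hI).1 e he).2 ((mem_matFam.mp hJ).1 e he').2
  · intro I hI J hJ
    rw [mem_matFam] at *
    refine ⟨fun e he => ?_, fun e he e' he' v hv hv' => ?_⟩
    · rcases mem_union.mp he with h | h
      · exact ⟨(hI.1 e h).1, fun v hv => mem_union_left _ ((hI.1 e h).2 v hv)⟩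
      · exact ⟨(hJ.1 e h).1, fun v hv => mem_union_right _ ((hJ.1 e h).2 v hv)⟩
    · rcases mem_union.mp he with h | h <;> rcases mem_union.mp he' with h' | h'
      · exact hI.2 e h e' h' v hv hv'
      · exact absurd ((hJ.1 e' h').2 v hv') (disjoint_left.mp hd ((hI.1 e h).2 v hv))
      · exact absurd ((hJ.1 e h).2 v hv) (disjoint_left.mp hd ((hI.1 e' h').2 v hv'))
      · exact hJ.2 e h e' h' v hv hv'
  · intro I hI J hJ I' hI' J' hJ' h
    have key : ∀ I ∈ matFam G A, ∀ J ∈ matFam G B,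
        (I ∪ J) ∩ A.sym2 = I ∧ (I ∪ J) ∩ B.sym2 = J := by
      intro I hI J hJ
      have h1 := fun e he => ((mem_matFam.mp hI).1 e he).2
      have h2 := fun e he => ((mem_matFam.mp hJ).1 e he).2
      constructor
      · ext e; rw [mem_inter, mem_union, mem_sym2_iff]
        exact ⟨fun h => h.1.resolve_right fun h3 => hsep e h.2 (h2 e h3),
          fun h => ⟨Or.inl h, h1 e h⟩⟩
      · ext e; rw [mem_inter, mem_union, mem_sym2_iff]
        exact ⟨fun h => h.1.resolve_left fun h3 => hsep e (h1 e h3) h.2,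
          fun h => ⟨Or.inr h, h2 e h⟩⟩
    obtain ⟨e1, e2⟩ := key I hI J hJ
    obtain ⟨e1', e2'⟩ := key I' hI' J' hJ'
    exact ⟨by rw [← e1, h, e1'], by rw [← e2, h, e2']⟩
  · intro K hK
    rw [mem_matFam] at hK
    refine ⟨K ∩ A.sym2, mem_matFam.mpr ⟨fun e he => ⟨(hK.1 e (mem_inter.mp he).1).1,
      mem_sym2_iff.mp (mem_inter.mp he).2⟩, fun e he e' he' => hK.2 e (mem_inter.mp he).1 e'
      (mem_inter.mp he').1⟩, K ∩ B.sym2, mem_matFam.mpr ⟨fun e he =>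
      ⟨(hK.1 e (mem_inter.mp he).1).1, mem_sym2_iff.mp (mem_inter.mp he).2⟩,
      fun e he e' he' => hK.2 e (mem_inter.mp he).1 e' (mem_inter.mp he').1⟩, ?_⟩
    rw [← inter_union_distrib_left]
    refine inter_eq_left.mpr fun e he => ?_
    obtain ⟨hadj, hmem⟩ := hK.1 e he
    rw [mem_union, mem_sym2_iff, mem_sym2_iff]
    induction e with
    | h p q =>
      have hpq : G.Adj p q := hadj
      simp only [Sym2.mem_iff, forall_eq_or_imp, forall_eq] at hmem ⊢
      rcases mem_union.mp hmem.1 with h1 | h1 <;> rcases mem_union.mp hmem.2 with h2 | h2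
      · exact Or.inl ⟨h1, h2⟩
      · exact absurd hpq (hAB p h1 q h2)
      · exact absurd hpq.symm (hAB q h2 p h1)
      · exact Or.inr ⟨h1, h2⟩

end Union

section CompleteBipartite

lemma genPoly_powerset (A : Finset V) : genPoly A.powerset = (1 + X) ^ #A := by
  unfold genPoly
  rw [add_comm, ← sum_pow_mul_eq_add_pow]
  simp

lemma matFam_eq_singleton {B : Finset V} (hB : ∀ b ∈ B, ∀ b' ∈ B, ¬ G.Adj b b') : matFam G B = {∅} := by
  ext M
  rw [mem_singleton]
  constructor
  · intro hM
    refine eq_empty_of_forall_notMem fun e he => ?_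
    obtain ⟨h1, h2⟩ := (mem_matFam.mp hM).1 e he
    induction e with
    | h p q => exact hB p (h2 p (Sym2.mem_mk_left p q)) q (h2 q (Sym2.mem_mk_right p q)) h1
  · rintro rfl; exact empty_mem_matFam G B

variable [DecidableEq V] {A B : Finset V}

lemma genPoly_indFam_completeBipartite (hd : Disjoint A B) (hA : ∀ a ∈ A, ∀ a' ∈ A, ¬ G.Adj a a')
    (hB : ∀ b ∈ B, ∀ b' ∈ B, ¬ G.Adj b b') (hAB : ∀ a ∈ A, ∀ b ∈ B, G.Adj a b) :
    genPoly (indFam G (A ∪ B)) = (1 + X) ^ #A + (1 + X) ^ #B - 1 := by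
  have h1 : indFam G (A ∪ B) = A.powerset ∪ B.powerset := by
    ext I
    rw [mem_indFam, mem_union, mem_powerset, mem_powerset]
    constructor
    · rintro ⟨hI, hind⟩
      by_contra! hcon
      obtain ⟨hnA, hnB⟩ := hcon
      obtain ⟨u, hu, huA⟩ := not_subset.mp hnA
      obtain ⟨w, hw, hwB⟩ := not_subset.mp hnB
      exact hind w hw u hu (hAB w ((mem_union.mp (hI hw)).resolve_right hwB) u
        ((mem_union.mp (hI hu)).resolve_left huA))
    · rintro (h | h)
      · exact ⟨h.trans subset_union_left, fun u hu w hw => hA u (h hu) w (h hw)⟩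
      · exact ⟨h.trans subset_union_right, fun u hu w hw => hB u (h hu) w (h hw)⟩
  have h2 : A.powerset ∩ B.powerset = {∅} := by
    ext I
    rw [mem_inter, mem_powerset, mem_powerset, mem_singleton]
    constructor
    · rintro ⟨h3, h4⟩
      exact eq_empty_of_forall_notMem fun u hu => disjoint_left.mp hd (h3 hu) (h4 hu)
    · rintro rfl; simp
  have h3 := sum_union_inter (s₁ := A.powerset) (s₂ := B.powerset)
    (f := fun I => (X : ℝ[X]) ^ #I)
  rw [h2, sum_singleton, card_empty, pow_zero] at h3
  have h4 := genPoly_powerset A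
  have h5 := genPoly_powerset B
  unfold genPoly at *
  rw [h4, h5] at h3
  rw [h1, ← h3]
  ring

/-- The matching polynomial of `K_{a,b}`, evaluated at `x`. -/
lemma eval_genPoly_matFam_completeBipartite (x : ℝ) (A : Finset V) : ∀ B : Finset V,
    Disjoint A B → (∀ a ∈ A, ∀ a' ∈ A, ¬ G.Adj a a') → (∀ b ∈ B, ∀ b' ∈ B, ¬ G.Adj b b') →
    (∀ a ∈ A, ∀ b ∈ B, G.Adj a b) →
    (genPoly (matFam G (A ∪ B))).eval x =
      ∑ k ∈ range (#A + 1), ((#A).choose k : ℝ) * (#B).choose k * k.factorial * x ^ k := by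
  classical
  induction A using Finset.induction_on with
  | empty =>
    intro B _ _ hB _
    rw [empty_union, matFam_eq_singleton hB]
    simp [genPoly]
  | insert v A hv ih =>
    intro B hd hA hB hAB
    have hvB : v ∉ B := fun h => disjoint_left.mp hd (mem_insert_self v A) h
    have hd' : Disjoint A B := disjoint_of_subset_left (subset_insert v A) hd
    have hA' : ∀ a ∈ A, ∀ a' ∈ A, ¬ G.Adj a a' := fun a ha a' ha' =>
      hA a (mem_insert_of_mem ha) a' (mem_insert_of_mem ha')
    have hAB' : ∀ a ∈ A, ∀ b ∈ B, G.Adj a b := fun a ha b hb => hAB a (mem_insert_of_mem ha) b hb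
    have hera : (insert v A ∪ B).erase v = A ∪ B := by
      rw [insert_union, erase_insert]
      rw [mem_union]; tauto
    have hfree : ∀ M, freeNbrs G (A ∪ B) v M = {y ∈ B | ¬ Cov M y} := by
      intro M
      ext y
      rw [mem_freeNbrs, mem_filter, mem_union]
      constructor
      · rintro ⟨hy | hy, h1, h2⟩
        · exact absurd h1 (hA v (mem_insert_self v A) y (mem_insert_of_mem hy))
        · exact ⟨hy, h2⟩
      · exact fun h => ⟨Or.inr h.1, hAB v (mem_insert_self v A) y h.1, h.2⟩
    -- Either v is uncovered, or it is matched to some y in B, leaving a matching of the smaller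
    -- graph on A and B without y.
    rw [eval_genPoly_matFam (mem_union_left B (mem_insert_self v A)), hera]
    have e1 : ∀ M ∈ matFam G (A ∪ B), x ^ #M * (1 + x * #(freeNbrs G (A ∪ B) v M)) =
        x ^ #M + x * ∑ y ∈ B, if ¬ Cov M y then x ^ #M else 0 := by
      intro M _
      rw [hfree, ← sum_filter, sum_const, nsmul_eq_mul]
      ring
    have e2 : ∀ y ∈ B, ∑ M ∈ matFam G (A ∪ B), (if ¬ Cov M y then x ^ #M else 0) =
        ∑ k ∈ range (#A + 1), ((#A).choose k : ℝ) * (#B - 1).choose k * k.factorial * x ^ k := by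
      intro y hy
      have hyA : y ∉ A := fun h => disjoint_left.mp hd' h hy
      rw [← sum_filter, filter_not_cov_matFam, erase_union_distrib, erase_eq_of_notMem hyA,
        ← eval_genPoly, ih (B.erase y) (disjoint_of_subset_right (erase_subset _ _) hd') hA'
          (fun b hb b' hb' => hB b (mem_of_mem_erase hb) b' (mem_of_mem_erase hb'))
          (fun a ha b hb => hAB' a ha b (mem_of_mem_erase hb)), card_erase_of_mem hy]
    rw [sum_congr rfl e1, sum_add_distrib, ← mul_sum, sum_comm, sum_congr rfl e2, ← eval_genPoly,
      ih B hd' hA' hB hAB', sum_const, nsmul_eq_mul, card_insert_of_notMem hv]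
    generalize #A = a
    generalize #B = b
    rw [sum_range_succ' _ (a + 1)]
    have e3 : ∀ k ∈ range (a + 1), ((a + 1).choose (k + 1) : ℝ) * b.choose (k + 1) *
        (k + 1).factorial * x ^ (k + 1) = (a.choose (k + 1) : ℝ) * b.choose (k + 1) *
        (k + 1).factorial * x ^ (k + 1) +
        x * (b * ((a.choose k : ℝ) * (b - 1).choose k * k.factorial * x ^ k)) := by
      intro k _
      have h2 : (b : ℝ) * (b - 1).choose k = b.choose (k + 1) * (k + 1) := by
        rcases b with _ | b
        · simp
        · rw [Nat.add_sub_cancel]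
          exact_mod_cast Nat.add_one_mul_choose_eq b k
      rw [Nat.choose_succ_succ', Nat.factorial_succ, pow_succ]
      push_cast
      linear_combination -(a.choose k : ℝ) * k.factorial * x ^ k * x * h2
    rw [sum_congr rfl e3, sum_add_distrib, ← mul_sum, ← mul_sum]
    have e4 := sum_range_succ' (fun k => (a.choose k : ℝ) * b.choose k * k.factorial * x ^ k)
      (a + 1)
    rw [sum_range_succ] at e4
    simp only [Nat.choose_succ_self, Nat.choose_zero_right, Nat.cast_zero, zero_mul,
      add_zero] at e4 ⊢
    rw [e4]
    ring

end CompleteBipartite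

section ClosedSets

variable [DecidableEq V]

lemma Closed.sdiff {S C : Finset V} (hS : Closed G S) (hC : Closed G C) : Closed G (S \ C) := by
  intro z hz y hy
  rw [mem_sdiff] at hz ⊢
  exact ⟨hS z hz.1 y hy, fun h => hz.2 (hC y h z hy.symm)⟩

lemma genPoly_split {S C : Finset V} (hCS : C ⊆ S) (hC : Closed G C) :
    genPoly (indFam G S) = genPoly (indFam G C) * genPoly (indFam G (S \ C)) ∧
    genPoly (matFam G S) = genPoly (matFam G C) * genPoly (matFam G (S \ C)) := by
  have h1 : ∀ a ∈ C, ∀ b ∈ S \ C, ¬ G.Adj a b := fun a ha b hb h =>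
    (mem_sdiff.mp hb).2 (hC a ha b h)
  have h2 := genPoly_indFam_union disjoint_sdiff h1
  have h3 := genPoly_matFam_union disjoint_sdiff h1
  rw [union_sdiff_of_subset hCS] at h2 h3
  exact ⟨h2, h3⟩

end ClosedSets

section Decomposition

variable [Fintype V] [DecidableRel G.Adj]

/-- Every neighbour of v is a twin of w and hence adjacent to u; equality follows from equal
degrees. -/
lemma InKdd.neighborFinset_eq {d : ℕ} (hreg : G.IsRegularOfDegree d) {v w u : V} (hv : InKdd G v)
    (hvw : G.Adj v w) (hwu : G.Adj w u) : G.neighborFinset u = G.neighborFinset v := by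
  symm
  refine eq_of_subset_of_card_le (fun z hz => ?_) ?_
  · rw [SimpleGraph.mem_neighborFinset] at hz ⊢
    exact (hv w z hvw hz u hwu).symm
  · rw [SimpleGraph.card_neighborFinset_eq_degree, SimpleGraph.card_neighborFinset_eq_degree,
      hreg u, hreg v]

lemma InKdd.of_adj {d : ℕ} (hreg : G.IsRegularOfDegree d) {v w : V} (hv : InKdd G v)
    (hvw : G.Adj v w) : InKdd G w := by
  intro u u' hu hu' z hz
  have h1 := hv.neighborFinset_eq hreg hvw hu
  have h2 := hv.neighborFinset_eq hreg hvw hu'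
  rw [← SimpleGraph.mem_neighborFinset] at hz ⊢
  rwa [h2, ← h1]

variable [DecidableEq V]

/-- The component of a vertex all of whose neighbours are twins is a copy of `K_{d,d}`. -/
lemma InKdd.component {d : ℕ} (hd : 1 ≤ d) (hreg : G.IsRegularOfDegree d) {v : V}
    (hv : InKdd G v) {S : Finset V} (hS : Closed G S) (hvS : v ∈ S) :
    ∃ C ⊆ S, Closed G C ∧ #C = 2 * d ∧ genPoly (indFam G C) = indPoly d ∧
      genPoly (matFam G C) = matPoly d := by
  obtain ⟨w, hvw⟩ : ∃ w, G.Adj v w := by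
    have : 0 < G.degree v := by rw [hreg v]; exact hd
    exact (G.degree_pos_iff_exists_adj v).mp this
  set A := G.neighborFinset v with hA
  set B := G.neighborFinset w with hB
  have mA : ∀ z, z ∈ A ↔ G.Adj v z := fun z => by rw [hA, SimpleGraph.mem_neighborFinset]
  have mB : ∀ z, z ∈ B ↔ G.Adj w z := fun z => by rw [hB, SimpleGraph.mem_neighborFinset]
  have hAN : ∀ a ∈ A, ∀ z, G.Adj a z ↔ z ∈ B := fun a ha z => by
    rw [mB]
    exact ⟨hv a w ((mA a).mp ha) hvw z, hv w a hvw ((mA a).mp ha) z⟩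
  have hBN : ∀ b ∈ B, ∀ z, G.Adj b z ↔ z ∈ A := fun b hb z => by
    rw [← SimpleGraph.mem_neighborFinset, hv.neighborFinset_eq hreg hvw ((mB b).mp hb)]
  have hdis : Disjoint A B := disjoint_left.mpr fun z hzA hzB => by
    exact G.irrefl ((hAN z hzA z).mpr hzB)
  have hAA : ∀ a ∈ A, ∀ a' ∈ A, ¬ G.Adj a a' := fun a ha a' ha' h =>
    disjoint_left.mp hdis ha' ((hAN a ha a').mp h)
  have hBB : ∀ b ∈ B, ∀ b' ∈ B, ¬ G.Adj b b' := fun b hb b' hb' h =>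
    disjoint_left.mp hdis ((hBN b hb b').mp h) hb'
  have hAB : ∀ a ∈ A, ∀ b ∈ B, G.Adj a b := fun a ha b hb => (hAN a ha b).mpr hb
  have cA : #A = d := by rw [hA, SimpleGraph.card_neighborFinset_eq_degree, hreg v]
  have cB : #B = d := by rw [hB, SimpleGraph.card_neighborFinset_eq_degree, hreg w]
  have hAS : A ⊆ S := fun z hz => hS v hvS z ((mA z).mp hz)
  refine ⟨A ∪ B, union_subset hAS fun z hz => hS w (hS v hvS w hvw) z ((mB z).mp hz), ?_, ?_, ?_,
    ?_⟩
  · intro z hz y hy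
    rcases mem_union.mp hz with h | h
    · exact mem_union_right _ ((hAN z h y).mp hy)
    · exact mem_union_left _ ((hBN z h y).mp hy)
  · rw [card_union_of_disjoint hdis, cA, cB, two_mul]
  · rw [genPoly_indFam_completeBipartite hdis hAA hBB hAB, cA, cB, indPoly]
    ring
  · refine Polynomial.funext fun x => ?_
    rw [eval_genPoly_matFam_completeBipartite x A B hdis hAA hBB hAB, cA, cB, eval_matPoly]
    exact sum_congr rfl fun k _ => by ring

/-- Peel off one component at a time; the remainder stays closed, and each component contributes one
factor. -/
lemma exists_genPoly_eq_pow {d : ℕ} (hd : 1 ≤ d) (hreg : G.IsRegularOfDegree d) (m : ℕ) :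
    ∀ S : Finset V, #S ≤ m → Closed G S → (∀ v ∈ S, InKdd G v) →
      ∃ t : ℕ, #S = 2 * d * t ∧ genPoly (indFam G S) = indPoly d ^ t ∧
        genPoly (matFam G S) = matPoly d ^ t := by
  induction m with
  | zero =>
    intro S hm _ _
    obtain rfl : S = ∅ := card_eq_zero.mp (by omega)
    refine ⟨0, by simp, ?_, ?_⟩
    · have : indFam G ∅ = {∅} := by
        ext I; rw [mem_indFam, subset_empty, mem_singleton]
        exact ⟨fun h => h.1, fun h => ⟨h, by simp [h]⟩⟩
      rw [this]; simp [genPoly]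
    · rw [matFam_eq_singleton (by simp)]; simp [genPoly]
  | succ m ih =>
    intro S hm hS hK
    rcases S.eq_empty_or_nonempty with rfl | ⟨v, hv⟩
    · exact ih ∅ (by simp) hS hK
    obtain ⟨C, hCS, hC, hcard, hind, hmat⟩ := (hK v hv).component hd hreg hS hv
    have hcs := card_sdiff_of_subset hCS
    have hcl := card_le_card hCS
    obtain ⟨t, h1, h2, h3⟩ := ih (S \ C) (by omega) (hS.sdiff hC)
      fun z hz => hK z (mem_sdiff.mp hz).1
    obtain ⟨h4, h5⟩ := genPoly_split hCS hC
    refine ⟨t + 1, ?_, ?_, ?_⟩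
    · have : #S = 2 * d * t + 2 * d := by omega
      rw [this]; ring
    · rw [h4, hind, h2, pow_succ']
    · rw [h5, hmat, h3, pow_succ']

end Decomposition

end RegularSlices

/-! ### Identification of the counts and assembly of the theorem. -/

namespace RegularSlices

section Counts

variable {V : Type*}

lemma coeff_genPoly_indFam_univ [Fintype V] (G : SimpleGraph V) (k : ℕ) :
    (genPoly (indFam G univ)).coeff k = indepCount G k := by
  rw [coeff_genPoly, indepCount, ← Set.ncard_coe_finset]
  congr 2
  ext I
  simp only [coe_filter, mem_indFam, subset_univ, true_and, Set.mem_ofPred_eq,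
    SimpleGraph.isNIndepSet_iff, SimpleGraph.isIndepSet_iff]
  refine and_congr_left fun _ => ⟨fun h u hu w hw _ => h u hu w hw, fun h u hu w hw huw => ?_⟩
  exact h hu hw huw.ne huw

/-- The subgraph whose edges are the members of `M`, without isolated vertices. -/
def subgraphOfEdges (G : SimpleGraph V) (M : Finset (Sym2 V)) (hM : ∀ e ∈ M, e ∈ G.edgeSet) :
    G.Subgraph where
  verts := {v | Cov M v}
  Adj u w := s(u, w) ∈ M
  adj_sub h := hM _ h
  edge_vert h := ⟨_, h, Sym2.mem_mk_left _ _⟩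
  symm := ⟨fun u w h => by rwa [Sym2.eq_swap]⟩

lemma edgeSet_subgraphOfEdges (G : SimpleGraph V) (M : Finset (Sym2 V))
    (hM : ∀ e ∈ M, e ∈ G.edgeSet) : (subgraphOfEdges G M hM).edgeSet = ↑M := by
  ext e
  induction e with | h p q => rfl

lemma coeff_genPoly_matFam_univ [Fintype V] (G : SimpleGraph V) (k : ℕ) :
    (genPoly (matFam G univ)).coeff k = matchingCount G k := by
  classical
  rw [coeff_genPoly, matchingCount, ← Set.ncard_coe_finset]
  congr 1
  have hmem : ∀ M ∈ (({M ∈ matFam G univ | #M = k} : Finset _) : Set (Finset (Sym2 V))),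
      M ∈ matFam G univ ∧ #M = k := fun M hM => mem_filter.mp (mem_coe.mp hM)
  refine Set.ncard_congr (fun M hM => subgraphOfEdges G M
    fun e he => ((mem_matFam.mp (hmem M hM).1).1 e he).1) ?_ ?_ ?_
  · intro M hM
    obtain ⟨h1, h2⟩ := hmem M hM
    refine ⟨?_, by rw [edgeSet_subgraphOfEdges, Set.ncard_coe_finset, h2]⟩
    rintro v ⟨e, he, hv⟩
    obtain ⟨w, rfl⟩ := hv
    refine ⟨w, he, fun y hy => ?_⟩
    have := (mem_matFam.mp h1).2 _ hy _ he v (Sym2.mem_mk_left v y) (Sym2.mem_mk_left v w)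
    exact Sym2.congr_right.mp this
  · intro M M' hM hM' h
    have := congrArg SimpleGraph.Subgraph.edgeSet h
    rwa [edgeSet_subgraphOfEdges, edgeSet_subgraphOfEdges, coe_inj] at this
  · rintro H ⟨hH, hk⟩
    have hfin : H.edgeSet.Finite := Set.toFinite _
    have hE : ∀ e ∈ hfin.toFinset, e ∈ G.edgeSet := fun e he =>
      H.edgeSet_subset (hfin.mem_toFinset.mp he)
    have hmat : hfin.toFinset ∈ matFam G univ := by
      refine mem_matFam.mpr ⟨fun e he => ⟨hE e he, fun v _ => mem_univ v⟩, ?_⟩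
      intro e he e' he' v hv hv'
      obtain ⟨w, rfl⟩ := hv
      obtain ⟨w', rfl⟩ := hv'
      rw [hfin.mem_toFinset, SimpleGraph.Subgraph.mem_edgeSet] at he he'
      rw [(hH (H.edge_vert he)).unique he he']
    refine ⟨hfin.toFinset, mem_coe.mpr (mem_filter.mpr ⟨hmat, ?_⟩), ?_⟩
    · rw [← hk, Set.ncard_eq_toFinset_card _ hfin]
    · refine SimpleGraph.Subgraph.ext ?_ ?_
      · ext v
        constructor
        · rintro ⟨e, he, w, rfl⟩
          exact H.edge_vert (H.mem_edgeSet.mp (hfin.mem_toFinset.mp he))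
        · intro hv
          obtain ⟨w, hw, -⟩ := hH hv
          exact ⟨s(v, w), hfin.mem_toFinset.mpr hw, Sym2.mem_mk_left v w⟩
      · ext u w
        exact hfin.mem_toFinset.trans H.mem_edgeSet

end Counts

section Union

lemma inKdd_unionKdd (d n : ℕ) (v : Fin (n / (2 * d)) × (Fin d ⊕ Fin d)) :
    InKdd (unionKdd d n) v := by
  rintro ⟨i, w⟩ ⟨j, w'⟩ ⟨rfl, h⟩ ⟨h1, h'⟩ ⟨l, u⟩ ⟨rfl, h''⟩
  refine ⟨h1.symm, ?_⟩
  obtain ⟨m, v⟩ := v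
  rcases v with v | v <;> rcases w with w | w <;> rcases w' with w' | w' <;>
    rcases u with u | u <;> simp_all

lemma isRegularOfDegree_unionKdd (d n : ℕ) [DecidableRel (unionKdd d n).Adj] :
    (unionKdd d n).IsRegularOfDegree d := by
  classical
  rintro ⟨i, a | a⟩ <;> rw [← SimpleGraph.card_neighborFinset_eq_degree]
  · have : (unionKdd d n).neighborFinset (i, Sum.inl a) =
        univ.image fun b : Fin d => (i, Sum.inr b) := by
      ext ⟨j, b | b⟩ <;> rw [SimpleGraph.mem_neighborFinset] <;> simp [unionKdd]
    rw [this, card_image_of_injective _ fun b c h => by simpa using h, card_univ, Fintype.card_fin]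
  · have : (unionKdd d n).neighborFinset (i, Sum.inr a) =
        univ.image fun b : Fin d => (i, Sum.inl b) := by
      ext ⟨j, b | b⟩ <;> rw [SimpleGraph.mem_neighborFinset] <;> simp [unionKdd]
    rw [this, card_image_of_injective _ fun b c h => by simpa using h, card_univ, Fintype.card_fin]

/-- The extremal graph is handled by the same decomposition as G, all of its vertices being in
copies of K_{d,d}; counting vertices identifies the exponent. -/
lemma genPoly_unionKdd {d n m : ℕ} (hd : 1 ≤ d) (hn : n = 2 * d * m) :
    genPoly (indFam (unionKdd d n) univ) = indPoly d ^ m ∧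
      genPoly (matFam (unionKdd d n) univ) = matPoly d ^ m := by
  classical
  obtain ⟨t, h1, h2, h3⟩ := exists_genPoly_eq_pow hd (isRegularOfDegree_unionKdd d n) _ univ le_rfl
    (fun _ _ w _ => mem_univ w) fun v _ => inKdd_unionKdd d n v
  have hd0 : 0 < 2 * d := by omega
  obtain rfl : m = t := by
    rw [card_univ, Fintype.card_prod, Fintype.card_sum, Fintype.card_fin, Fintype.card_fin] at h1
    refine Nat.eq_of_mul_eq_mul_left hd0 ?_
    rw [← h1, hn, Nat.mul_div_cancel_left _ hd0]; ring
  exact ⟨h2, h3⟩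

end Union

/-- Uniform comparison of the coefficients of `P ^ t * Q` and `P ^ (t + s)` for polynomials `Q` in a
class `R s` whose logarithmic derivatives are at most `s` times that of `P`, with a linear gain on
compact intervals. -/
lemma exists_coeff_pow_mul_le_of_stable {P : ℝ[X]} {d : ℕ} (hd : 1 ≤ d) (hP : LogConcavePoly P d)
    (hP0 : P.eval 0 = 1) (R : ℕ → ℝ[X] → Prop)
    (hcoeff : ∀ s Q, R s Q → ∀ n, 0 ≤ Q.coeff n)
    (hpos : ∀ s Q, R s Q → ∀ x, 0 ≤ x → 0 < Q.eval x) (hone : ∀ s Q, R s Q → Q.eval 0 = 1)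
    (hle : ∀ s Q, R s Q → ∀ x, 0 < x →
      Q.derivative.eval x * P.eval x ≤ s * P.derivative.eval x * Q.eval x)
    (hstab : ∀ a b : ℝ, 0 < a → a ≤ b → ∃ c > 0, ∀ s Q, R s Q → ∀ x, a ≤ x → x ≤ b →
      Q.derivative.eval x * P.eval x + c * s * (Q.eval x * P.eval x) ≤
        s * P.derivative.eval x * Q.eval x) {ε : ℝ} (hε : 0 < ε) :
    ∃ N : ℕ, ∀ t s : ℕ, N ≤ t + s → ∀ Q, R s Q → ∀ k : ℕ, ε * (t + s : ℕ) < k →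
      (P ^ t * Q).coeff k ≤ (P ^ (t + s)).coeff k := by
  obtain ⟨l, hl, h⟩ := exists_forall_coeff_pow_mul_le hd hP hε
  -- The gain is collected just below l, so it is available at every x ≥ l. The threshold l depends
  -- only on P and ε and is fixed before c.
  obtain ⟨c, hc, hgain⟩ := hstab (l / 2) l (by positivity) (by linarith)
  obtain ⟨N, hN⟩ := h (c * (l - l / 2)) (mul_pos hc (by linarith))
  refine ⟨N, fun t s hts Q hQ => hN t s hts Q (hcoeff s Q hQ) ?_⟩
  exact eval_le_of_derivative_le (by positivity) (by linarith) (fun x hx => hP.eval_pos hx)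
    (hpos s Q hQ) hP0 (hone s Q hQ) (hle s Q hQ) (hgain s Q hQ)

lemma exists_forall_coeff_le.{u} {d : ℕ} (hd : 2 ≤ d) {ε : ℝ} (hε : 0 < ε) :
    ∃ N : ℕ, ∀ t s : ℕ, N ≤ t + s → ∀ (V : Type u) [Fintype V] [DecidableEq V] (G : SimpleGraph V)
      [DecidableRel G.Adj], G.IsRegularOfDegree d → ∀ S : Finset V, Closed G S →
      (∀ v ∈ S, ¬ InKdd G v) → #S = 2 * d * s → ∀ k : ℕ, ε * (t + s : ℕ) < k →
      (indPoly d ^ t * genPoly (indFam G S)).coeff k ≤ (indPoly d ^ (t + s)).coeff k ∧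
      (matPoly d ^ t * genPoly (matFam G S)).coeff k ≤ (matPoly d ^ (t + s)).coeff k := by
  obtain ⟨N₁, h₁⟩ := exists_coeff_pow_mul_le_of_stable (by omega) (logConcavePoly_indPoly d)
    (by rw [eval_indPoly]; norm_num)
    (fun s Q => ∃ (V : Type u) (_ : Fintype V) (_ : DecidableEq V) (G : SimpleGraph V)
      (_ : DecidableRel G.Adj) (S : Finset V), G.IsRegularOfDegree d ∧ Closed G S ∧
      (∀ v ∈ S, ¬ InKdd G v) ∧ #S = 2 * d * s ∧ Q = genPoly (indFam G S))
    (by rintro s _ ⟨V, _, _, G, _, S, -, -, -, -, rfl⟩; exact coeff_genPoly_nonneg _)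
    (by
      rintro s _ ⟨V, _, _, G, _, S, -, -, -, -, rfl⟩ x hx
      exact eval_genPoly_pos (empty_mem_indFam G S) hx)
    (by
      rintro s _ ⟨V, _, _, G, _, S, -, -, -, -, rfl⟩
      exact eval_zero_genPoly (empty_mem_indFam G S))
    (by
      rintro s _ ⟨V, _, _, G, _, S, hreg, hS, -, hs, rfl⟩ x hx
      exact genPoly_indFam_derivative_le (by omega) hreg hS hs hx)
    (by
      intro a b ha hab
      obtain ⟨c, hc, h⟩ := exists_genPoly_indFam_derivative_add_le hd ha hab
      refine ⟨c, hc, ?_⟩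
      rintro s _ ⟨V, _, _, G, _, S, hreg, hS, hK, hs, rfl⟩
      exact h G hreg S hS hK s hs) hε
  obtain ⟨N₂, h₂⟩ := exists_coeff_pow_mul_le_of_stable (by omega) (logConcavePoly_matPoly d)
    (by rw [eval_matPoly, sum_range_succ']; simp)
    (fun s Q => ∃ (V : Type u) (_ : Fintype V) (_ : DecidableEq V) (G : SimpleGraph V)
      (_ : DecidableRel G.Adj) (S : Finset V), G.IsRegularOfDegree d ∧ Closed G S ∧
      (∀ v ∈ S, ¬ InKdd G v) ∧ #S = 2 * d * s ∧ Q = genPoly (matFam G S))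
    (by rintro s _ ⟨V, _, _, G, _, S, -, -, -, -, rfl⟩; exact coeff_genPoly_nonneg _)
    (by
      rintro s _ ⟨V, _, _, G, _, S, -, -, -, -, rfl⟩ x hx
      exact eval_genPoly_pos (empty_mem_matFam G S) hx)
    (by
      rintro s _ ⟨V, _, _, G, _, S, -, -, -, -, rfl⟩
      exact eval_zero_genPoly (empty_mem_matFam G S))
    (by
      rintro s _ ⟨V, _, _, G, _, S, hreg, hS, -, hs, rfl⟩ x hx
      obtain ⟨e, rfl⟩ : ∃ e, d = e + 1 := ⟨d - 1, by omega⟩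
      exact genPoly_matFam_derivative_le (by omega) hreg hS hs hx)
    (by
      intro a b ha hab
      obtain ⟨e, rfl⟩ : ∃ e, d = e + 1 := ⟨d - 1, by omega⟩
      obtain ⟨c, hc, h⟩ := exists_genPoly_matFam_derivative_add_le (e := e) (by omega) ha hab
      refine ⟨c, hc, ?_⟩
      rintro s _ ⟨V, _, _, G, _, S, hreg, hS, hK, hs, rfl⟩
      exact h G hreg S hS hK s hs) hε
  refine ⟨max N₁ N₂, fun t s hN V iF iD G iA hreg S hS hK hs k hk => ⟨?_, ?_⟩⟩
  · exact h₁ t s ((le_max_left _ _).trans hN) _ ⟨V, iF, iD, G, iA, S, hreg, hS, hK, hs, rfl⟩ k hk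
  · exact h₂ t s ((le_max_right _ _).trans hN) _ ⟨V, iF, iD, G, iA, S, hreg, hS, hK, hs, rfl⟩ k hk

end RegularSlices

open RegularSlices

theorem theorem3 (d : ℕ) (hd : 2 ≤ d) (ε : ℝ) (hε : 0 < ε) :
    ∃ N : ℕ, ∀ n : ℕ, N ≤ n → 2 * d ∣ n →
      ∀ (V : Type*) [Fintype V] (G : SimpleGraph V) [DecidableRel G.Adj],
        Fintype.card V = n → G.IsRegularOfDegree d →
        ∀ k : ℕ, ε * (n : ℝ) < (k : ℝ) →
          RegularSlices.indepCount G k ≤ RegularSlices.indepCount (RegularSlices.unionKdd d n) k ∧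
          RegularSlices.matchingCount G k ≤
            RegularSlices.matchingCount (RegularSlices.unionKdd d n) k := by
  -- With n = 2d(t + s), the condition k > εn reads k > 2dε(t + s).
  obtain ⟨N, hN⟩ := exists_forall_coeff_le hd (ε := 2 * d * ε) (by positivity)
  refine ⟨2 * d * N, fun n hn hdvd V _ G _ hcard hreg k hk => ?_⟩
  classical
  have hd0 : 0 < 2 * d := by omega
  obtain ⟨m, rfl⟩ := hdvd
  set T : Finset V := {v | InKdd G v} with hT
  have mT : ∀ v, v ∈ T ↔ InKdd G v := fun v => by simp [hT]
  have hTc : Closed G T := fun v hv w hvw => (mT w).mpr (((mT v).mp hv).of_adj hreg hvw)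
  have hU : Closed G (univ : Finset V) := fun _ _ w _ => mem_univ w
  obtain ⟨t, ht, hti, htm⟩ := exists_genPoly_eq_pow (by omega) hreg _ T le_rfl hTc
    fun v hv => (mT v).mp hv
  obtain ⟨hsi, hsm⟩ := genPoly_split (subset_univ T) hTc
  have htm' : t ≤ m := by
    refine Nat.le_of_mul_le_mul_left ?_ hd0
    rw [← ht, ← hcard]
    exact card_le_univ T
  obtain ⟨s, rfl⟩ := Nat.exists_eq_add_of_le htm'
  have hs : #(univ \ T) = 2 * d * s := by
    rw [card_sdiff_of_subset (subset_univ T), card_univ, hcard, ht, mul_add]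
    omega
  obtain ⟨h1, h2⟩ := hN t s (Nat.le_of_mul_le_mul_left hn hd0) V G hreg (univ \ T) (hU.sdiff hTc)
    (fun v hv hK => (mem_sdiff.mp hv).2 ((mT v).mpr hK)) hs k (by
      push_cast at hk ⊢
      linarith)
  obtain ⟨hi, hm⟩ := genPoly_unionKdd (d := d) (by omega) (rfl : 2 * d * (t + s) = _)
  rw [← hti, ← hsi, ← hi, coeff_genPoly_indFam_univ, coeff_genPoly_indFam_univ] at h1
  rw [← htm, ← hsm, ← hm, coeff_genPoly_matFam_univ, coeff_genPoly_matFam_univ] at h2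
  exact ⟨by exact_mod_cast h1, by exact_mod_cast h2⟩
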